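/- **Setting.** Let $M,N,J_m,I_m\ge 0$ be integers ($m\in[M]=\{1,\dots,M\}$), $\mathcal X\subseteq\mathbb R^N$, $\widetilde{\mathcal Z}_m\subseteq\mathbb R^{J_m}$, $f_0:\mathbb R^N\to\mathbb R\cup\{+\infty\}$, $g_m:\mathbb R^N\times\mathbb R^{J_m}\to\mathbb R\cup\{\pm\infty\}$, $h_{m,i}:\mathbb R^{J_m}\to\mathbb R\cup\{+\infty\}$ ($i\in[I_m]$). Put $\mathcal Z_m=\widetilde{\mathcal Z}_m\cap\bigcap_{i}\{z: h_{m,i}(z)\le 0\}$, $f_m(x)=\sup_{z\in\mathcal Z_m}g_m(x,z)$, $h_m=(h_{m,1},\dots,h_{m,I_m})$, and consider the robust problem $$\min\ f_0(x)\quad\text{s.t. } x\in\mathcal X,\ f_m(x)\le 0\ \ \forall m\in[M].\tag{R}$$ A point $x\in\mathcal X$ is an $\varepsilon$-approximate optimal solution if $f_0(x)-f_0(x^\star)\le\varepsilon$ for an optimal solution $x^\star$ and $\max\{f_m(x),0\}\le\varepsilon$ for all $m$. Norms are Euclidean, $\mathrm{Proj}$ is the Euclidean projection, $[s]_+=\max\{s,0\}$,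 and $\partial$ is the convex subdifferential, $\partial f(x)=\{\xi: f(y)\ge f(x)+\langle\xi,y-x\rangle\ \forall y\}$, with $y$ ranging over the whole space. **Assumption A.** (i) $\mathcal X$ and all $\widetilde{\mathcal Z}_m$ are non-empty, compact and convex. (ii) $f_0$ is convex and finite on $\mathcal X$; $g_m(\cdot,z)$ is convex on $\mathbb R^N$ for $z\in\widetilde{\mathcal Z}_m$, $g_m(x,\cdot)$ is concave on $\mathbb R^{J_m}$ for $x\in\mathcal X$, and $g_m$ is finite on $\mathcal X\times\widetilde{\mathcal Z}_m$; each $h_{m,i}$ is convex and finite on $\widetilde{\mathcal Z}_m$. (iii) There is $\bar x\in\mathcal X$ with $\sup_{z\in\widetilde{\mathcal Z}_m}g_m(\bar x,z)<0$ for all $m$, and for each $m$ there is $\bar z_m\in\widetilde{\mathcal Z}_m$ with $h_{m,i}(\bar z_m)<0$ for all $i$. (iv) (R) has an optimal solution. **Assumption B.** The sets $\partial f_0(x)$, $\partial_x g_m(x,z)$, $\partial_z(-g_m)(x,z)$, $\partial h_{m,i}(z)$ are non-empty for all $x\in\mathcal X$, $z\in\widetilde{\mathcal Z}_m$, $m$,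 $i$, and their elements are bounded in norm by constants $D_0,D_m,E_m,F_m$ respectively, uniformly in $x$, $z$, $i$. **Assumption C.** $f_0$, $g_m$, $h_{m,i}$ are finite and differentiable on open sets containing $\mathcal X$, $\mathcal X\times\widetilde{\mathcal Z}_m$, $\widetilde{\mathcal Z}_m$ respectively, and there are constants $D_0',D_m',E_{m,1}',E_{m,2}',F_m'>0$ such that for all $m$, $i$, $x,x'\in\mathcal X$ and $z,z'\in\widetilde{\mathcal Z}_m$: $\|\nabla f_0(x)-\nabla f_0(x')\|\le D_0'\|x-x'\|$, $\|\nabla_xg_m(x,z)-\nabla_xg_m(x',z)\|\le D_m'\|x-x'\|$, $\|\nabla_zg_m(x,z)-\nabla_zg_m(x',z')\|\le E_{m,1}'\|x-x'\|+E_{m,2}'\|z-z'\|$, $\|\nabla h_{m,i}(z)-\nabla h_{m,i}(z')\|\le F_m'\|z-z'\|$. **Algorithm (extended ProM$^3$).** Fix any $\bar z_m$ as in A(iii) and any $G_m<0$ with $g_m(x,\bar z_m)\ge G_m$ for all $x\in\mathcal X$. Let $a_m=G_m/\max_i h_{m,i}(\bar z_m)$ (irrelevant if $I_m=0$), $\mathcal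 M=\prod_m[0,a_m]^{I_m}$, $\tilde g_m(x,\mu_m,z)=g_m(x,z)-\mu_m^\top h_m(z)$. Parameters: integers $K,T\ge1$ and reals $\alpha,\beta,\theta,\nu,\gamma,\delta>0$. Start from $x^0\in\mathcal X$, $\mu^0\in\mathcal M$, $\lambda^0=0$. For $k=0,\dots,K-1$: * for each $m$ take any $z_m^k\in\widetilde{\mathcal Z}_m$ with $\sup_{w\in\widetilde{\mathcal Z}_m}\tilde g_m(x^k,\mu_m^k,w)\le\tilde g_m(x^k,\mu_m^k,z_m^k)+\theta$ and set $\lambda_m^{k+1}=[\lambda_m^k+\beta(2\tilde g_m(x^k,\mu_m^k,z_m^k)-\tilde g_m(x^{k-1},\mu_m^{k-1},z_m^{k-1}))]_+$, where index $-1$ means index $0$; * from any $x_0\in\mathcal X$, $\mu_0\in\mathcal M$, $z_0\in\prod_m\widetilde{\mathcal Z}_m$, run for $t=0,\dots,T-1$ (index $-1$ again meaning $0$): take any $\zeta_{t,m}\in\partial_z(-g_m)(x_t,z_{t,m})$, $\eta_{t,m,i}\in\partial h_{m,i}(z_{t,m})$, $$z_{t+1,m}=\mathrm{Proj}_{\widetilde{\mathcal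 Z}_m}\Big(z_{t,m}-\delta\lambda_m^{k+1}\big(2\zeta_{t,m}-\zeta_{t-1,m}+\textstyle\sum_i(2\mu_{t,m,i}\eta_{t,m,i}-\mu_{t-1,m,i}\eta_{t-1,m,i})\big)\Big),$$ take any $\xi_{t,0}\in\partial f_0(x_t)$, $\xi_{t,m}\in\partial_xg_m(x_t,z_{t+1,m})$, put $\xi_t=\xi_{t,0}+\sum_m\lambda_m^{k+1}\xi_{t,m}$ and $$x_{t+1}=\mathrm{Proj}_{\mathcal X}\Big(\tfrac{\alpha\gamma}{\alpha+\gamma}\big(\tfrac1\alpha x^k+\tfrac1\gamma x_t-\xi_t\big)\Big),\quad \mu_{t+1,m}=\mathrm{Proj}_{[0,a_m]^{I_m}}\Big(\tfrac{\alpha\gamma}{\alpha+\gamma}\big(\tfrac1\alpha\mu_m^k+\tfrac1\gamma\mu_{t,m}+\lambda_m^{k+1}h_m(z_{t+1,m})\big)\Big);$$ set $(x^{k+1},\mu^{k+1},\tilde z^{k+1})=\frac1T\sum_{t=1}^T(x_t,\mu_t,z_t)$. Output $\bar x^K=\frac1K\sum_{k=1}^Kx^k$. The number of oracle calls counts every subgradient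 computation, every projection and every approximate maximization. **Theorem.** Let Assumption A hold, and let $r=3$ under Assumption B and $r=2$ under Assumption C. Then there is a constant $C>0$ such that for every $\varepsilon>0$ the parameters can be chosen so that the number of oracle calls is at most $C\max\{1,\varepsilon^{-r}\}$ and, for every starting point $(x^0,\mu^0)\in\mathcal X\times\mathcal M$, the algorithm can be run, and in every run: $(x^{k+1},\mu^{k+1},\tilde z^{k+1})$ is, for each $k<K$, a strong $\nu$-approximate saddle point of $$F(x,\mu;z)=f_0(x)+\sum_m\lambda_m^{k+1}\tilde g_m(x,\mu_m,z_m)+\tfrac1{2\alpha}\|x-x^k\|^2+\tfrac1{2\alpha}\|\mu-\mu^k\|^2,$$ that is, $F(x^{k+1},\mu^{k+1};z)\le F(x,\mu;\tilde z^{k+1})-\tfrac1{2\alpha}(\|x-x^{k+1}\|^2+\|\mu-\mu^{k+1}\|^2)+\nu$ for all $x\in\mathcal X$, $\mu\in\mathcal M$, $z\in\prod_m\widetilde{\mathcal Z}_m$; and $\bar x^K$ is an $\varepsilon$-approximate optimal solution of (R). In short, the oracle complexity of extended ProM$^3$ is $O(\varepsilon^{-3})$ under A and B, and $O(\varepsilon^{-2})$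 under A and C. -/

import Mathlib

namespace RobustOpt

/-- `ℝⁿ` with the Euclidean norm. -/
abbrev Vec (n : ℕ) : Type := EuclideanSpace ℝ (Fin n)

/-- Convexity of an extended-real-valued function on the whole space: its epigraph is convex. -/
def IsConvexFn {n : ℕ} (f : Vec n → EReal) : Prop :=
  Convex ℝ {p : Vec n × ℝ | f p.1 ≤ (p.2 : EReal)}

/-- The subdifferential of an extended-real-valued function: all `ξ` with
`f x + ⟪ξ, y - x⟫ ≤ f y` for every `y` of the whole space. -/
def subdiff {n : ℕ} (f : Vec n → EReal) (x : Vec n) : Set (Vec n) :=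
  {ξ | ∀ y : Vec n, f x + ((inner ℝ ξ (y - x) : ℝ) : EReal) ≤ f y}

/-- The value is a real number. -/
def IsFinite (r : EReal) : Prop := r ≠ ⊥ ∧ r ≠ ⊤

/-- `p` is the Euclidean projection of `y` onto `S`. -/
def IsProj {n : ℕ} (S : Set (Vec n)) (y p : Vec n) : Prop :=
  p ∈ S ∧ ∀ q ∈ S, ‖y - p‖ ≤ ‖y - q‖

/-- Differentiability on a set that need not be open: the function is real-valued and
differentiable on some open set containing it. -/
def DiffOnNhd {E : Type*} [NormedAddCommGroup E] [NormedSpace ℝ E]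
    (f : E → EReal) (S : Set E) : Prop :=
  ∃ U : Set E, IsOpen U ∧ S ⊆ U ∧ (∀ p ∈ U, IsFinite (f p)) ∧
    DifferentiableOn ℝ (fun p => (f p).toReal) U

/-- The gradient of (the real-valued part of) an extended-real-valued function. -/
noncomputable def grad {n : ℕ} (f : Vec n → EReal) (x : Vec n) : Vec n :=
  gradient (fun y => (f y).toReal) x

/-- Data of a robust optimization problem with `M` uncertain constraints in dimension `N`;
the `m`-th uncertainty set lives in dimension `J m`, and it is cut out of `Zt m` by the `I m`
inequalities `h m i ≤ 0`. -/
structure Problem (M N : ℕ) (J I : Fin M → ℕ) where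
  f0 : Vec N → EReal
  g : (m : Fin M) → Vec N → Vec (J m) → EReal
  h : (m : Fin M) → Fin (I m) → Vec (J m) → EReal
  X : Set (Vec N)
  Zt : (m : Fin M) → Set (Vec (J m))

namespace Problem

variable {M N : ℕ} {J I : Fin M → ℕ} (P : Problem M N J I)

/-- The uncertainty set `Z̃ₘ ∩ ⋂ᵢ {h_{m,i} ≤ 0}`. -/
def Z (m : Fin M) : Set (Vec (J m)) := P.Zt m ∩ ⋂ i, {z | P.h m i z ≤ 0}

/-- The worst-case constraint function `fₘ(x) = sup {gₘ(x, z) | z ∈ Zₘ}`. -/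
noncomputable def worst (m : Fin M) (x : Vec N) : EReal := ⨆ z ∈ P.Z m, P.g m x z

/-- Feasibility for the robust problem. -/
def IsFeasible (x : Vec N) : Prop := x ∈ P.X ∧ ∀ m, P.worst m x ≤ 0

/-- Optimality for the robust problem. -/
def IsOptimal (x : Vec N) : Prop :=
  P.IsFeasible x ∧ ∀ y, P.IsFeasible y → P.f0 x ≤ P.f0 y

/-- `ε`-approximate optimal solutions of the robust problem:
`f₀(x) - f₀(x⋆) ≤ ε` and `[fₘ(x)]₊ ≤ ε` for every `m`. -/
def IsApproxOptimal (ε : ℝ) (x : Vec N) : Prop :=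
  x ∈ P.X ∧ (∀ xs, P.IsOptimal xs → P.f0 x ≤ P.f0 xs + (ε : EReal)) ∧
    ∀ m, max (P.worst m x) 0 ≤ (ε : EReal)

/-- A family of Slater points for the uncertainty sets. -/
def IsSlaterFamily (zbar : (m : Fin M) → Vec (J m)) : Prop :=
  ∀ m, zbar m ∈ P.Zt m ∧ ∀ i, P.h m i (zbar m) < 0

/-- Convexity, compactness, Slater points, existence of an optimal solution. -/
structure Regular : Prop where
  X_nonempty : P.X.Nonempty
  X_compact : IsCompact P.X
  X_convex : Convex ℝ P.X
  Zt_nonempty : ∀ m, (P.Zt m).Nonempty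
  Zt_compact : ∀ m, IsCompact (P.Zt m)
  Zt_convex : ∀ m, Convex ℝ (P.Zt m)
  f0_ne_bot : ∀ x, P.f0 x ≠ ⊥
  f0_convex : IsConvexFn P.f0
  f0_finite : ∀ x ∈ P.X, IsFinite (P.f0 x)
  g_convex : ∀ m, ∀ z ∈ P.Zt m, IsConvexFn (fun x => P.g m x z)
  g_concave : ∀ m, ∀ x ∈ P.X, IsConvexFn (fun z => -P.g m x z)
  g_finite : ∀ m, ∀ x ∈ P.X, ∀ z ∈ P.Zt m, IsFinite (P.g m x z)
  h_ne_bot : ∀ m i z, P.h m i z ≠ ⊥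
  h_convex : ∀ m i, IsConvexFn (P.h m i)
  h_finite : ∀ m i, ∀ z ∈ P.Zt m, IsFinite (P.h m i z)
  slater_x : ∃ xbar ∈ P.X, ∀ m, (⨆ z ∈ P.Zt m, P.g m xbar z) < 0
  slater_z : ∃ zbar, P.IsSlaterFamily zbar
  exists_optimal : ∃ xs, P.IsOptimal xs

/-- Non-empty and uniformly bounded subdifferentials. -/
structure BoundedSubgradients : Prop where
  f0_nonempty : ∀ x ∈ P.X, (subdiff P.f0 x).Nonempty
  gx_nonempty : ∀ m, ∀ x ∈ P.X, ∀ z ∈ P.Zt m, (subdiff (fun y => P.g m y z) x).Nonempty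
  gz_nonempty : ∀ m, ∀ x ∈ P.X, ∀ z ∈ P.Zt m, (subdiff (fun w => -P.g m x w) z).Nonempty
  h_nonempty : ∀ m i, ∀ z ∈ P.Zt m, (subdiff (P.h m i) z).Nonempty
  f0_bounded : ∃ D0 > (0 : ℝ), ∀ x ∈ P.X, ∀ ξ ∈ subdiff P.f0 x, ‖ξ‖ ≤ D0
  gx_bounded : ∀ m, ∃ D > (0 : ℝ), ∀ x ∈ P.X, ∀ z ∈ P.Zt m,
    ∀ ξ ∈ subdiff (fun y => P.g m y z) x, ‖ξ‖ ≤ D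
  gz_bounded : ∀ m, ∃ E > (0 : ℝ), ∀ x ∈ P.X, ∀ z ∈ P.Zt m,
    ∀ ζ ∈ subdiff (fun w => -P.g m x w) z, ‖ζ‖ ≤ E
  h_bounded : ∀ m, ∃ F > (0 : ℝ), ∀ i, ∀ z ∈ P.Zt m, ∀ η ∈ subdiff (P.h m i) z, ‖η‖ ≤ F

/-- Differentiability with Lipschitz continuous gradients. -/
structure LipschitzGradients : Prop where
  f0_diff : DiffOnNhd P.f0 P.X
  g_diff : ∀ m, DiffOnNhd (fun p : Vec N × Vec (J m) => P.g m p.1 p.2) (P.X ×ˢ P.Zt m)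
  h_diff : ∀ m i, DiffOnNhd (P.h m i) (P.Zt m)
  f0_lip : ∃ D0 > (0 : ℝ), ∀ x ∈ P.X, ∀ x' ∈ P.X,
    ‖grad P.f0 x - grad P.f0 x'‖ ≤ D0 * ‖x - x'‖
  gx_lip : ∀ m, ∃ D > (0 : ℝ), ∀ x ∈ P.X, ∀ x' ∈ P.X, ∀ z ∈ P.Zt m,
    ‖grad (fun y => P.g m y z) x - grad (fun y => P.g m y z) x'‖ ≤ D * ‖x - x'‖
  gz_lip : ∀ m, ∃ E1 > (0 : ℝ), ∃ E2 > (0 : ℝ),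
    ∀ x ∈ P.X, ∀ x' ∈ P.X, ∀ z ∈ P.Zt m, ∀ z' ∈ P.Zt m,
      ‖grad (P.g m x) z - grad (P.g m x') z'‖ ≤ E1 * ‖x - x'‖ + E2 * ‖z - z'‖
  h_lip : ∀ m, ∃ F > (0 : ℝ), ∀ i, ∀ z ∈ P.Zt m, ∀ z' ∈ P.Zt m,
    ‖grad (P.h m i) z - grad (P.h m i) z'‖ ≤ F * ‖z - z'‖

/-- `G m < 0` is a lower bound of `gₘ(·, z̄ₘ)` on `X`. -/
def IsLowerBound (zbar : (m : Fin M) → Vec (J m)) (G : Fin M → ℝ) : Prop :=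
  ∀ m, G m < 0 ∧ ∀ x ∈ P.X, (G m : EReal) ≤ P.g m x (zbar m)

/-- The bound `aₘ = Gₘ / maxᵢ h_{m,i}(z̄ₘ)` on the multipliers. If `I m = 0` there are no
multipliers for `m` and the value is irrelevant. -/
noncomputable def multBound (zbar : (m : Fin M) → Vec (J m)) (G : Fin M → ℝ) (m : Fin M) : ℝ :=
  G m / ⨆ i, (P.h m i (zbar m)).toReal

end Problem

/-- The box `[0, c]ⁿ`. -/
def box (n : ℕ) (c : ℝ) : Set (Vec n) := {μ | ∀ i, 0 ≤ μ i ∧ μ i ≤ c}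

/-- Input parameters of the extended algorithm. -/
structure Params where
  K : ℕ
  T : ℕ
  α : ℝ
  β : ℝ
  θ : ℝ
  ν : ℝ
  γ : ℝ
  δ : ℝ
  one_le_K : 1 ≤ K
  one_le_T : 1 ≤ T
  α_pos : 0 < α
  β_pos : 0 < β
  θ_pos : 0 < θ
  ν_pos : 0 < ν
  γ_pos : 0 < γ
  δ_pos : 0 < δ

namespace Problem

variable {M N : ℕ} {J I : Fin M → ℕ} (P : Problem M N J I)

/-- The vector `hₘ(z)`. -/
noncomputable def hvec (m : Fin M) (z : Vec (J m)) : Vec (I m) :=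
  WithLp.toLp 2 (fun i => (P.h m i z).toReal)

/-- The penalized constraint function `g̃ₘ(x, μₘ, z) = gₘ(x, z) - μₘᵀ hₘ(z)`. -/
noncomputable def gpen (m : Fin M) (x : Vec N) (μ : Vec (I m)) (z : Vec (J m)) : ℝ :=
  (P.g m x z).toReal - ∑ i, μ i * (P.h m i z).toReal

/-- Objective of the inner saddle-point problem with multipliers `lam` and prox-centre
`(xc, μc)`. -/
noncomputable def innerObj (α : ℝ) (xc : Vec N) (μc : (m : Fin M) → Vec (I m))
    (lam : Fin M → ℝ) (x : Vec N) (μ : (m : Fin M) → Vec (I m))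
    (z : (m : Fin M) → Vec (J m)) : ℝ :=
  (P.f0 x).toReal + ∑ m, lam m * P.gpen m x (μ m) (z m)
    + 1 / (2 * α) * ‖x - xc‖ ^ 2 + 1 / (2 * α) * ∑ m, ‖μ m - μc m‖ ^ 2

/-- `((xs, μs), zs)` is a strong `ν`-approximate saddle point of the inner saddle-point problem,
whose objective is `1/α`-strongly convex in `(x, μ)`. -/
def IsStrongSaddle (a : Fin M → ℝ) (α ν : ℝ) (xc : Vec N) (μc : (m : Fin M) → Vec (I m))
    (lam : Fin M → ℝ) (xs : Vec N) (μs : (m : Fin M) → Vec (I m))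
    (zs : (m : Fin M) → Vec (J m)) : Prop :=
  xs ∈ P.X ∧ (∀ m, μs m ∈ box (I m) (a m)) ∧ (∀ m, zs m ∈ P.Zt m) ∧
    ∀ x ∈ P.X, ∀ μ : (m : Fin M) → Vec (I m), (∀ m, μ m ∈ box (I m) (a m)) →
      ∀ z : (m : Fin M) → Vec (J m), (∀ m, z m ∈ P.Zt m) →
        P.innerObj α xc μc lam xs μs z ≤ P.innerObj α xc μc lam x μ zs
          - 1 / α / 2 * (‖x - xs‖ ^ 2 + ∑ m, ‖μ m - μs m‖ ^ 2) + ν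

end Problem

/-- Everything that is computed during one call of the inner algorithm; index `t`. -/
structure InnerTrace (M N : ℕ) (J I : Fin M → ℕ) where
  x : ℕ → Vec N
  μ : ℕ → (m : Fin M) → Vec (I m)
  z : ℕ → (m : Fin M) → Vec (J m)
  ζ : ℕ → (m : Fin M) → Vec (J m)
  η : ℕ → (m : Fin M) → Fin (I m) → Vec (J m)
  ξ0 : ℕ → Vec N
  ξ : ℕ → Fin M → Vec N

namespace InnerTrace

variable {M N : ℕ} {J I : Fin M → ℕ} (R : InnerTrace M N J I)

/-- The trace is a run of the extended inner algorithm with prox-centre `(xc, μc)` and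
multipliers `lam`, from some starting point. The natural-number index `t - 1` is `0` for `t = 0`,
which is the convention `ζ₋₁ = ζ₀`, `η₋₁ = η₀`, `μ₋₁ = μ₀` for the first iteration. -/
structure IsRun (P : Problem M N J I) (a : Fin M → ℝ) (p : Params) (xc : Vec N)
    (μc : (m : Fin M) → Vec (I m)) (lam : Fin M → ℝ) : Prop where
  x_init : R.x 0 ∈ P.X
  μ_init : ∀ m, R.μ 0 m ∈ box (I m) (a m)
  z_init : ∀ m, R.z 0 m ∈ P.Zt m
  ζ_mem : ∀ t < p.T, ∀ m, R.ζ t m ∈ subdiff (fun w => -P.g m (R.x t) w) (R.z t m)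
  η_mem : ∀ t < p.T, ∀ m i, R.η t m i ∈ subdiff (P.h m i) (R.z t m)
  z_step : ∀ t < p.T, ∀ m, IsProj (P.Zt m)
    (R.z t m - (p.δ * lam m) • ((2 : ℝ) • R.ζ t m - R.ζ (t - 1) m
      + ∑ i, ((2 * R.μ t m i) • R.η t m i - R.μ (t - 1) m i • R.η (t - 1) m i)))
    (R.z (t + 1) m)
  ξ0_mem : ∀ t < p.T, R.ξ0 t ∈ subdiff P.f0 (R.x t)
  ξ_mem : ∀ t < p.T, ∀ m, R.ξ t m ∈ subdiff (fun y => P.g m y (R.z (t + 1) m)) (R.x t)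
  x_step : ∀ t < p.T, IsProj P.X
    ((p.α * p.γ / (p.α + p.γ)) • ((1 / p.α) • xc + (1 / p.γ) • R.x t
      - (R.ξ0 t + ∑ m, lam m • R.ξ t m)))
    (R.x (t + 1))
  μ_step : ∀ t < p.T, ∀ m, IsProj (box (I m) (a m))
    ((p.α * p.γ / (p.α + p.γ)) • ((1 / p.α) • μc m + (1 / p.γ) • R.μ t m
      + lam m • P.hvec m (R.z (t + 1) m)))
    (R.μ (t + 1) m)

/-- The outputs: averages of the iterates `1, …, T`. -/
noncomputable def xout (T : ℕ) : Vec N := (1 / (T : ℝ)) • ∑ t ∈ Finset.Icc 1 T, R.x t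

noncomputable def μout (T : ℕ) (m : Fin M) : Vec (I m) :=
  (1 / (T : ℝ)) • ∑ t ∈ Finset.Icc 1 T, R.μ t m

noncomputable def zout (T : ℕ) (m : Fin M) : Vec (J m) :=
  (1 / (T : ℝ)) • ∑ t ∈ Finset.Icc 1 T, R.z t m

end InnerTrace

/-- Everything that is computed during the extended algorithm; index `k`. `z k m` is the
approximate maximizer of the multiplier update, `inner k` the call of the inner algorithm. -/
structure Trace (M N : ℕ) (J I : Fin M → ℕ) where
  x : ℕ → Vec N
  μ : ℕ → (m : Fin M) → Vec (I m)
  lam : ℕ → Fin M → ℝ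
  z : ℕ → (m : Fin M) → Vec (J m)
  inner : ℕ → InnerTrace M N J I

namespace Trace

variable {M N : ℕ} {J I : Fin M → ℕ} (R : Trace M N J I)

/-- The trace is a run of the extended algorithm from `(x0, μ0)`: the outer algorithm, whose
`(x, μ)`-update is the output of the inner algorithm after `T` iterations. The natural-number
index `k - 1` is `0` for `k = 0`, which is the convention for the first iteration. That the
outputs of the inner algorithm are strong approximate saddle points is not required here. -/
structure IsRun (P : Problem M N J I) (a : Fin M → ℝ) (p : Params) (x0 : Vec N)
    (μ0 : (m : Fin M) → Vec (I m)) : Prop where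
  x_init : R.x 0 = x0
  μ_init : R.μ 0 = μ0
  lam_init : R.lam 0 = 0
  z_mem : ∀ k < p.K, ∀ m, R.z k m ∈ P.Zt m
  z_approx : ∀ k < p.K, ∀ m, ∀ w ∈ P.Zt m,
    P.gpen m (R.x k) (R.μ k m) w ≤ P.gpen m (R.x k) (R.μ k m) (R.z k m) + p.θ
  lam_step : ∀ k < p.K, ∀ m, R.lam (k + 1) m =
    max (R.lam k m + p.β * (2 * P.gpen m (R.x k) (R.μ k m) (R.z k m)
      - P.gpen m (R.x (k - 1)) (R.μ (k - 1) m) (R.z (k - 1) m))) 0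
  inner_run : ∀ k < p.K, (R.inner k).IsRun P a p (R.x k) (R.μ k) (R.lam (k + 1))
  x_step : ∀ k < p.K, R.x (k + 1) = (R.inner k).xout p.T
  μ_step : ∀ k < p.K, R.μ (k + 1) = (R.inner k).μout p.T

/-- The output: the average of the outer iterates `1, …, K`. -/
noncomputable def output (K : ℕ) : Vec N := (1 / (K : ℝ)) • ∑ k ∈ Finset.Icc 1 K, R.x k

end Trace

namespace Params

/-- Oracle calls in one inner iteration: a subgradient of `f₀`; for each `m` a subgradient of
`gₘ(·, z)` and one of `-gₘ(x, ·)`; for each `(m, i)` a subgradient of `h_{m,i}`; the projection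
onto `X`; for each `m` the projections onto `Z̃ₘ` and onto `[0, aₘ]^{Iₘ}`. -/
def innerIterCalls (M : ℕ) (I : Fin M → ℕ) : ℕ :=
  (1 + M + M + ∑ m, I m) + (1 + M + M)

/-- Oracle calls of the whole algorithm: in each of the `K` outer iterations, the `M`
approximate maximizations of the multiplier update (one call each) and `T` inner iterations. -/
def calls (p : Params) (M : ℕ) (I : Fin M → ℕ) : ℕ :=
  ∑ _k ∈ Finset.range p.K, (M + ∑ _t ∈ Finset.range p.T, innerIterCalls M I)

end Params

/-- The oracle complexity of the extended algorithm with multiplier bounds `a` for reaching an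
`ε`-approximate optimal solution is `O(ε⁻ʳ)`: there is a constant `C` such that for every `ε > 0`
the parameters can be chosen with at most `C max(1, ε⁻ʳ)` oracle calls so that, from every
starting point, the algorithm can be run, and in every run (whatever the subgradients, the
approximate maximizers and the starting points of the inner calls are) each inner call returns a
strong `ν`-approximate saddle point and the output is `ε`-approximately optimal. -/
def HasOracleComplexity {M N : ℕ} {J I : Fin M → ℕ} (P : Problem M N J I) (a : Fin M → ℝ)
    (r : ℕ) : Prop :=
  ∃ C : ℝ, 0 < C ∧ ∀ ε : ℝ, 0 < ε → ∃ p : Params,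
    (p.calls M I : ℝ) ≤ C * max 1 ((1 / ε) ^ r) ∧
    ∀ x0 ∈ P.X, ∀ μ0 : (m : Fin M) → Vec (I m), (∀ m, μ0 m ∈ box (I m) (a m)) →
      (∃ R : Trace M N J I, R.IsRun P a p x0 μ0) ∧
      ∀ R : Trace M N J I, R.IsRun P a p x0 μ0 →
        (∀ k < p.K, P.IsStrongSaddle a p.α p.ν (R.x k) (R.μ k) (R.lam (k + 1))
          ((R.inner k).xout p.T) ((R.inner k).μout p.T) ((R.inner k).zout p.T)) ∧
        P.IsApproxOptimal ε (R.output p.K)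

end RobustOpt

open Filter Topology

/-! Write Φ_m(x, μ) for the supremum of g̃_m(x, μ, ·) over Z̃_m (`penSup`). It is jointly convex in
(x, μ), because x and μ do not couple in g̃_m, and it is Lipschitz on the domain. For μ ≥ 0 it
dominates f_m, and at a feasible x convex duality in z produces a multiplier in the box with Φ_m ≤
0; the Slater point z̄_m is what bounds it by a_m (`exists_multiplier`). So (R) is the lifted convex
program of minimizing f_0 under Φ_m(x, μ_m) ≤ 0. It has the Slater point (x̄, 0), so its Lagrangian
has a saddle point (x*, μ*; l) (`exists_saddle`).

The outer algorithm is a proximal primal step combined with extrapolated dual ascent on this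
Lagrangian: a strong approximate saddle point of F is an approximate proximal step for f_0 + ∑ λ_m
Φ_m (`prox_le`). With α, β fixed and ν = θ = 1/K, the Lagrangian gaps accumulated over n ≤ K
iterations, plus ∑ (l'_m - λ_m^n)² / (4β), stay below a constant E independent of K (`outer_sum_le`,
`sum_gap_le`). This is used for three choices of l'. For l' = l the gaps are non-negative, so λ^n,
and after one more update λ^{n+1}, lies below a constant Λ. For l' = 0 and l' = l + e_m, averaging
by convexity gives error E/K in the objective and in the m-th constraint.

The inner algorithm takes an extrapolated subgradient step in z and proximal steps in x and μ. For
multipliers in [0, Λ], a telescoping Lyapunov function bounds its averaged gap by a multiple of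
1/(γT) plus γ times a noise constant (`gap_le`, `exists_inner_params`). The noise comes only from
jumps of subgradients and vanishes for Lipschitz gradients. Accuracy 1/K thus needs T of order K
with constant γ under Assumption C, and T of order K² with γ of order 1/K under Assumption B. With K
of order 1/ε the total K·T is of order ε⁻² or ε⁻³.

The bound on λ^{k+1} needs the saddle property of the earlier inner calls, and the k-th inner call
needs that bound; strong induction on k resolves this. Both assumptions are handled at once by
letting subgradients vary by at most A + L · distance (`SubgradientBounds`), with L = 0 in one case
and A = 0 in the other. -/

namespace RobustOpt

/-! ### Lagrange multipliers -/

/-- Existence of Lagrange multipliers for a convex program with a Slater point. -/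
theorem exists_lagrange_multiplier {E ι : Type*} [AddCommGroup E] [Module ℝ E] [Fintype ι]
    {S : Set E} {f : E → ℝ} {c : ι → E → ℝ} (hf : ConvexOn ℝ S f)
    (hc : ∀ i, ConvexOn ℝ S (c i)) {s₀ : E} (hs₀ : s₀ ∈ S) (hslater : ∀ i, c i s₀ < 0) {v : ℝ}
    (hv : ∀ s ∈ S, (∀ i, c i s ≤ 0) → v ≤ f s) :
    ∃ l : ι → ℝ, (∀ i, 0 ≤ l i) ∧ ∀ s ∈ S, v ≤ f s + ∑ i, l i * c i s := by
  classical
  -- Strict inequalities make `C` open without any continuity of `f` and `c`. The separation happens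
  -- in the finite-dimensional space of values, so `E` needs no topology.
  set C : Set ((ι → ℝ) × ℝ) := {p | ∃ s ∈ S, (∀ i, c i s < p.1 i) ∧ f s < p.2} with hC
  have hCconv : Convex ℝ C := by
    rintro p ⟨s, hs, hs1, hs2⟩ q ⟨t, ht, ht1, ht2⟩ a b ha hb hab
    refine ⟨a • s + b • t, hf.1 hs ht ha hb hab, fun i => ?_, ?_⟩
    · have h := (hc i).2 hs ht ha hb hab
      have h1 := hs1 i
      have h2 := ht1 i
      simp only [smul_eq_mul, Prod.fst_add, Prod.smul_fst, Pi.add_apply, Pi.smul_apply] at h ⊢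
      rcases ha.eq_or_lt with rfl | ha'
      · have : b = 1 := by linarith
        subst this; linarith
      · nlinarith [mul_lt_mul_of_pos_left h1 ha', mul_le_mul_of_nonneg_left h2.le hb]
    · have h := hf.2 hs ht ha hb hab
      simp only [smul_eq_mul, Prod.snd_add, Prod.smul_snd] at h ⊢
      rcases ha.eq_or_lt with rfl | ha'
      · have : b = 1 := by linarith
        subst this; linarith
      · nlinarith [mul_lt_mul_of_pos_left hs2 ha', mul_le_mul_of_nonneg_left ht2.le hb]
  have hCopen : IsOpen C := by
    have : C = ⋃ s ∈ S, {p : (ι → ℝ) × ℝ | (∀ i, c i s < p.1 i) ∧ f s < p.2} := by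
      ext p; simp only [hC, Set.mem_ofPred_eq, Set.mem_iUnion, exists_prop]
    rw [this]
    refine isOpen_biUnion fun s _ => IsOpen.inter ?_ ?_
    · have : {p : (ι → ℝ) × ℝ | ∀ i, c i s < p.1 i} = ⋂ i, {p | c i s < p.1 i} := by
        ext p; simp
      change IsOpen {p : (ι → ℝ) × ℝ | ∀ i, c i s < p.1 i}
      rw [this]
      exact isOpen_iInter_of_finite fun i => isOpen_lt continuous_const (by fun_prop)
    · exact isOpen_lt continuous_const continuous_snd
  have hnot : ((0 : ι → ℝ), v) ∉ C := by
    rintro ⟨s, hs, h1, h2⟩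
    exact absurd (hv s hs fun i => (h1 i).le) (not_le.2 h2)
  obtain ⟨φ, hφ⟩ := geometric_hahn_banach_point_open hCconv hCopen hnot
  set y : ι → ℝ := fun i => φ (Pi.single i 1, 0) with hy
  set y₀ : ℝ := φ (0, 1) with hy0
  have hφeq : ∀ u r, φ (u, r) = (∑ i, y i * u i) + y₀ * r := by
    intro u r
    have h1 : ((u, r) : (ι → ℝ) × ℝ) =
        (∑ i, u i • ((Pi.single i 1 : ι → ℝ), (0 : ℝ))) + r • ((0 : ι → ℝ), (1 : ℝ)) := by
      ext j
      · simp [Prod.fst_sum, Finset.sum_apply, Pi.single_apply]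
      · simp [Prod.snd_sum]
    rw [h1, map_add, map_sum, map_smul]
    simp only [map_smul, smul_eq_mul, hy, hy0]
    congr 1
    · exact Finset.sum_congr rfl fun i _ => mul_comm _ _
    · exact mul_comm _ _
  have hkey : ∀ s ∈ S, ∀ u : ι → ℝ, ∀ r, (∀ i, c i s < u i) → f s < r →
      y₀ * v < (∑ i, y i * u i) + y₀ * r := by
    intro s hs u r h1 h2
    have := hφ (u, r) ⟨s, hs, h1, h2⟩
    rw [hφeq, hφeq] at this
    simpa using this
  have nonneg_of : ∀ a b d : ℝ, (∀ t : ℝ, 0 ≤ t → a < b + t * d) → 0 ≤ d := by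
    intro a b d h
    by_contra hd
    push Not at hd
    have h1 := h (|a - b| / (-d)) (div_nonneg (abs_nonneg _) (by linarith))
    have h2 : |a - b| / (-d) * d = -|a - b| := by
      rw [div_neg, neg_mul, div_mul_cancel₀ _ hd.ne]
    rw [h2] at h1
    linarith [neg_abs_le (a - b), h1, le_abs_self (b - a), neg_le_abs (a - b)]
  have hy_nonneg : ∀ j, 0 ≤ y j := by
    intro j
    refine nonneg_of (y₀ * v) ((∑ i, y i * (c i s₀ + 1)) + y₀ * (f s₀ + 1)) _ fun t ht => ?_
    have := hkey s₀ hs₀ (fun i => c i s₀ + 1 + if i = j then t else 0) (f s₀ + 1)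
      (fun i => by split_ifs <;> linarith) (by linarith)
    simp only [mul_add, Finset.sum_add_distrib] at this ⊢
    simp at this ⊢
    linarith
  have hy0_nonneg : 0 ≤ y₀ := by
    refine nonneg_of (y₀ * v) ((∑ i, y i * (c i s₀ + 1)) + y₀ * (f s₀ + 1)) _ fun t ht => ?_
    have := hkey s₀ hs₀ (fun i => c i s₀ + 1) (f s₀ + 1 + t) (fun i => by linarith) (by linarith)
    linarith
  -- If `y₀` were zero, the Slater point would give a point of `C` with negative first component,
  -- where the functional is non-positive, against strict separation.
  have hy0_pos : 0 < y₀ := by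
    refine hy0_nonneg.lt_of_ne fun h0 => ?_
    have := hkey s₀ hs₀ (fun i => c i s₀ / 2) (f s₀ + 1)
      (fun i => by linarith [hslater i]) (by linarith)
    rw [← h0] at this
    have h2 : ∑ i, y i * (c i s₀ / 2) ≤ 0 :=
      Finset.sum_nonpos fun i _ =>
        mul_nonpos_of_nonneg_of_nonpos (hy_nonneg i) (by linarith [hslater i])
    linarith
  refine ⟨fun i => y i / y₀, fun i => div_nonneg (hy_nonneg i) hy0_nonneg, fun s hs => ?_⟩
  have hle : y₀ * v ≤ (∑ i, y i * c i s) + y₀ * f s := by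
    have hpos : 0 < (∑ i, y i) + y₀ := by
      have := Finset.sum_nonneg fun i (_ : i ∈ Finset.univ) => hy_nonneg i
      linarith
    refine le_of_forall_pos_le_add fun τ hτ => ?_
    have := hkey s hs (fun i => c i s + τ / ((∑ i, y i) + y₀)) (f s + τ / ((∑ i, y i) + y₀))
      (fun i => by linarith [div_pos hτ hpos]) (by linarith [div_pos hτ hpos])
    simp only [mul_add, Finset.sum_add_distrib, ← Finset.sum_mul] at this
    have e : (∑ i, y i) * (τ / ((∑ i, y i) + y₀)) + y₀ * (τ / ((∑ i, y i) + y₀)) = τ := by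
      field_simp
    linarith
  have e : f s + ∑ i, y i / y₀ * c i s = ((∑ i, y i * c i s) + y₀ * f s) / y₀ := by
    have h3 : ∑ i, y i / y₀ * c i s = (∑ i, y i * c i s) / y₀ := by
      rw [Finset.sum_div]
      exact Finset.sum_congr rfl fun i _ => by ring
    rw [h3]
    field_simp
    ring
  rw [e, le_div_iff₀ hy0_pos]
  linarith

/-! ### Euclidean projections and boxes -/

theorem exists_isProj {n : ℕ} {S : Set (Vec n)} (hS : IsCompact S) (hne : S.Nonempty)
    (y : Vec n) : ∃ p, IsProj S y p := by
  obtain ⟨p, hp, hmin⟩ := hS.exists_isMinOn hne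
    (f := fun q => ‖y - q‖) (by fun_prop)
  exact ⟨p, hp, fun q hq => hmin hq⟩

theorem IsProj.inner_le_zero {n : ℕ} {S : Set (Vec n)} (hS : Convex ℝ S) {y p : Vec n}
    (h : IsProj S y p) {q : Vec n} (hq : q ∈ S) : inner ℝ (y - p) (q - p) ≤ 0 := by
  refine (norm_eq_iInf_iff_real_inner_le_zero hS h.1).1 ?_ q hq
  have : Nonempty S := ⟨⟨p, h.1⟩⟩
  refine le_antisymm (le_ciInf fun w => h.2 w w.2) ?_
  exact ciInf_le ⟨0, by rintro _ ⟨w, rfl⟩; exact norm_nonneg _⟩ (⟨p, h.1⟩ : S)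

theorem inner_sub_sub_eq {V : Type*} [NormedAddCommGroup V] [InnerProductSpace ℝ V]
    (c p q : V) : inner ℝ (c - p) (q - p) = (‖p - c‖ ^ 2 + ‖q - p‖ ^ 2 - ‖q - c‖ ^ 2) / 2 := by
  have h : q - c = (q - p) - (c - p) := by abel
  rw [h, norm_sub_sq_real (q - p) (c - p), real_inner_comm, norm_sub_rev p c]
  ring

/-- The three-point inequality of a projected (sub)gradient step. -/
theorem IsProj.step_le {n : ℕ} {S : Set (Vec n)} (hS : Convex ℝ S) {δ : ℝ} (hδ : 0 < δ)
    {y p v : Vec n} (h : IsProj S (y - δ • v) p) {q : Vec n} (hq : q ∈ S) :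
    inner ℝ v (p - q) ≤ (‖q - y‖ ^ 2 - ‖q - p‖ ^ 2 - ‖p - y‖ ^ 2) / (2 * δ) := by
  have h1 := h.inner_le_zero hS hq
  have h2 : y - δ • v - p = (y - p) - δ • v := by abel
  rw [h2, inner_sub_left, inner_smul_left, inner_sub_sub_eq] at h1
  have h3 : inner ℝ v (q - p) = - inner ℝ v (p - q) := by rw [← inner_neg_right, neg_sub]
  rw [h3] at h1
  simp only [conj_trivial] at h1
  rw [le_div_iff₀ (by positivity)]
  linarith

/-- The three-point inequality of a proximal step with two prox-centres. -/
theorem IsProj.prox_step_le {n : ℕ} {S : Set (Vec n)} (hS : Convex ℝ S) {α γ : ℝ}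
    (hα : 0 < α) (hγ : 0 < γ) {c y p v : Vec n}
    (h : IsProj S ((α * γ / (α + γ)) • ((1 / α) • c + (1 / γ) • y - v)) p) {q : Vec n}
    (hq : q ∈ S) :
    inner ℝ v (p - q) + 1 / (2 * α) * ‖p - c‖ ^ 2 - 1 / (2 * α) * ‖q - c‖ ^ 2
        + 1 / (2 * α) * ‖q - p‖ ^ 2
      ≤ (‖q - y‖ ^ 2 - ‖q - p‖ ^ 2 - ‖p - y‖ ^ 2) / (2 * γ) := by
  have h1 := h.inner_le_zero hS hq
  have h2 : (α * γ / (α + γ)) • ((1 / α) • c + (1 / γ) • y - v) - p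
      = (α * γ / (α + γ)) • ((1 / α) • (c - p) + (1 / γ) • (y - p) - v) := by
    -- The weights 1/α and 1/γ, scaled by αγ/(α+γ), sum to 1. So the vector to be tested is a
    -- positive multiple of a combination of c - p, y - p and v, and the factor cancels.
    have e : p = (α * γ / (α + γ)) • ((1 / α) • p + (1 / γ) • p) := by
      rw [← add_smul, smul_smul]
      have : α * γ / (α + γ) * (1 / α + 1 / γ) = 1 := by
        field_simp
        ring
      rw [this, one_smul]
    nth_rewrite 1 [e]
    rw [← smul_sub]
    congr 1
    simp only [smul_sub]
    abel
  rw [h2, inner_smul_left] at h1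
  have h4 := nonpos_of_mul_nonpos_right h1
    (by simp only [conj_trivial]; positivity)
  rw [inner_sub_left, inner_add_left, inner_smul_left, inner_smul_left, inner_sub_sub_eq,
    inner_sub_sub_eq] at h4
  have h3 : inner ℝ v (q - p) = - inner ℝ v (p - q) := by rw [← inner_neg_right, neg_sub]
  rw [h3] at h4
  simp only [conj_trivial] at h4
  have e1 : 1 / α * ((‖p - c‖ ^ 2 + ‖q - p‖ ^ 2 - ‖q - c‖ ^ 2) / 2)
      = 1 / (2 * α) * ‖p - c‖ ^ 2 + 1 / (2 * α) * ‖q - p‖ ^ 2 - 1 / (2 * α) * ‖q - c‖ ^ 2 := by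
    field_simp
  have e2 : 1 / γ * ((‖p - y‖ ^ 2 + ‖q - p‖ ^ 2 - ‖q - y‖ ^ 2) / 2)
      = - ((‖q - y‖ ^ 2 - ‖q - p‖ ^ 2 - ‖p - y‖ ^ 2) / (2 * γ)) := by
    field_simp; ring
  rw [e1, e2] at h4
  linarith

theorem convex_box (n : ℕ) (c : ℝ) : Convex ℝ (box n c) := by
  intro x hx y hy a b ha hb hab i
  have h1 := hx i
  have h2 := hy i
  simp only [PiLp.add_apply, PiLp.smul_apply, smul_eq_mul]
  have hb' : b = 1 - a := by linarith
  subst hb'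
  constructor
  · exact add_nonneg (mul_nonneg ha h1.1) (mul_nonneg hb h2.1)
  · nlinarith [mul_le_mul_of_nonneg_left h1.2 ha, mul_le_mul_of_nonneg_left h2.2 hb]

theorem abs_apply_le_norm {n : ℕ} (x : Vec n) (i : Fin n) : |x i| ≤ ‖x‖ := by
  simpa using PiLp.norm_apply_le x i

theorem norm_le_sum_abs {n : ℕ} (x : Vec n) : ‖x‖ ≤ ∑ i, |x i| := by
  have h : x = ∑ i, x i • EuclideanSpace.single i (1 : ℝ) := by
    ext j
    simp [Finset.sum_apply, Pi.single_apply]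
  calc ‖x‖ = ‖∑ i, x i • EuclideanSpace.single i (1 : ℝ)‖ := by rw [← h]
    _ ≤ ∑ i, ‖x i • EuclideanSpace.single i (1 : ℝ)‖ := norm_sum_le _ _
    _ = ∑ i, |x i| := by simp [norm_smul]

theorem norm_le_of_mem_box {n : ℕ} {c : ℝ} {x : Vec n} (hx : x ∈ box n c) :
    ‖x‖ ≤ n * c := by
  refine (norm_le_sum_abs x).trans ?_
  calc ∑ i, |x i| ≤ ∑ _i : Fin n, c :=
        Finset.sum_le_sum fun i _ => by rw [abs_of_nonneg (hx i).1]; exact (hx i).2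
    _ = n * c := by simp

theorem isCompact_box (n : ℕ) (c : ℝ) : IsCompact (box n c) := by
  refine Metric.isCompact_of_isClosed_isBounded ?_ ?_
  · have : box n c = ⋂ i, ({x : Vec n | 0 ≤ x i} ∩ {x | x i ≤ c}) := by
      ext x; simp [box]
    rw [this]
    exact isClosed_iInter fun i =>
      (isClosed_le continuous_const (by fun_prop)).inter (isClosed_le (by fun_prop) continuous_const)
  · exact isBounded_iff_forall_norm_le.2 ⟨n * c, fun x hx => norm_le_of_mem_box hx⟩

/-! ### Extended-real-valued convex functions, subgradients and gradients -/

theorem IsFinite.coe_toReal {r : EReal} (h : IsFinite r) : ((r.toReal : ℝ) : EReal) = r :=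
  EReal.coe_toReal h.2 h.1

theorem IsFinite.neg {r : EReal} (h : IsFinite r) : IsFinite (-r) := by
  obtain ⟨h1, h2⟩ := h
  exact ⟨fun h => h2 (by simpa using h), fun h => h1 (by simpa using h)⟩

theorem IsConvexFn.convexOn {n : ℕ} {f : Vec n → EReal} (hf : IsConvexFn f) {S : Set (Vec n)}
    (hS : Convex ℝ S) (hfin : ∀ x ∈ S, IsFinite (f x)) :
    ConvexOn ℝ S fun x => (f x).toReal := by
  refine ⟨hS, fun x hx y hy a b ha hb hab => ?_⟩
  have hx' : ((x, (f x).toReal) : Vec n × ℝ) ∈ {p : Vec n × ℝ | f p.1 ≤ (p.2 : EReal)} := by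
    simp [(hfin x hx).coe_toReal]
  have hy' : ((y, (f y).toReal) : Vec n × ℝ) ∈ {p : Vec n × ℝ | f p.1 ≤ (p.2 : EReal)} := by
    simp [(hfin y hy).coe_toReal]
  have h := hf hx' hy' ha hb hab
  have h2 : f (a • x + b • y) ≤ ((a * (f x).toReal + b * (f y).toReal : ℝ) : EReal) := h
  rw [← (hfin _ (hS hx hy ha hb hab)).coe_toReal] at h2
  simpa using EReal.coe_le_coe_iff.1 h2

theorem subdiff_real {n : ℕ} {f : Vec n → EReal} {x ξ y : Vec n} (h : ξ ∈ subdiff f x)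
    (hx : IsFinite (f x)) (hy : IsFinite (f y)) :
    (f x).toReal + inner ℝ ξ (y - x) ≤ (f y).toReal := by
  have := h y
  rw [← hx.coe_toReal, ← hy.coe_toReal, ← EReal.coe_add] at this
  exact EReal.coe_le_coe_iff.1 this

/-- By convexity, difference quotients from `x` towards `y` are at most `r - f x` for every real `r`
above `f y`; then pass to the limit. Using `r` in place of `f y` covers infinite values at `y`. -/
theorem grad_mem_subdiff {n : ℕ} {f : Vec n → EReal} (hf : IsConvexFn f) {x : Vec n}
    (hfin : ∀ᶠ y in 𝓝 x, IsFinite (f y)) (hd : DifferentiableAt ℝ (fun y => (f y).toReal) x) :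
    grad f x ∈ subdiff f x := by
  intro y
  have hx : IsFinite (f x) := hfin.self_of_nhds
  have key : ∀ r : ℝ, f y ≤ (r : EReal) →
      (f x).toReal + inner ℝ (grad f x) (y - x) ≤ r := by
    intro r hr
    have hgr : HasGradientAt (fun y => (f y).toReal) (grad f x) x := hd.hasGradientAt
    have hline : HasDerivAt (fun s : ℝ => (f (x + s • (y - x))).toReal)
        (inner ℝ (grad f x) (y - x)) 0 := by
      have h1 : HasDerivAt (fun s : ℝ => x + s • (y - x)) (y - x) 0 := by
        simpa using ((hasDerivAt_id (0 : ℝ)).smul_const (y - x)).const_add x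
      have h2 : HasFDerivAt (fun y => (f y).toReal)
          ((InnerProductSpace.toDual ℝ (Vec n)) (grad f x)) (x + (0 : ℝ) • (y - x)) := by
        simpa using hgr.hasFDerivAt
      have h3 := h2.comp_hasDerivAt (0 : ℝ) h1
      rwa [InnerProductSpace.toDual_apply_apply] at h3
    have htend := hline.tendsto_slope_zero_right
    have hcont : Tendsto (fun s : ℝ => x + s • (y - x)) (𝓝[>] 0) (𝓝 x) := by
      have : Tendsto (fun s : ℝ => x + s • (y - x)) (𝓝 0) (𝓝 (x + (0 : ℝ) • (y - x))) :=
        Continuous.tendsto (by fun_prop) 0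
      simp only [zero_smul, add_zero] at this
      exact this.mono_left nhdsWithin_le_nhds
    have hev : ∀ᶠ s : ℝ in 𝓝[>] 0,
        s⁻¹ • ((f (x + (0 + s) • (y - x))).toReal - (f (x + (0 : ℝ) • (y - x))).toReal)
          ≤ r - (f x).toReal := by
      filter_upwards [hcont.eventually hfin, self_mem_nhdsWithin,
        nhdsWithin_le_nhds (Iio_mem_nhds (show (0 : ℝ) < 1 by norm_num))] with s hs hs0 hs1
      have hs0' : (0 : ℝ) < s := hs0
      have hs1' : s < 1 := hs1
      have hx' : ((x, (f x).toReal) : Vec n × ℝ) ∈ {p : Vec n × ℝ | f p.1 ≤ (p.2 : EReal)} := by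
        simp [hx.coe_toReal]
      have hy' : ((y, r) : Vec n × ℝ) ∈ {p : Vec n × ℝ | f p.1 ≤ (p.2 : EReal)} := hr
      have h := hf hx' hy' (show (0 : ℝ) ≤ 1 - s by linarith) hs0'.le (by ring)
      have h2 : f ((1 - s) • x + s • y) ≤ (((1 - s) * (f x).toReal + s * r : ℝ) : EReal) := h
      have e : (1 - s) • x + s • y = x + s • (y - x) := by
        rw [sub_smul, one_smul, smul_sub]; abel
      rw [e, ← hs.coe_toReal] at h2
      have h3 := EReal.coe_le_coe_iff.1 h2
      simp only [zero_add, zero_smul, add_zero, smul_eq_mul]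
      rw [inv_mul_le_iff₀ hs0']
      linarith
    have := le_of_tendsto htend hev
    linarith
  rw [← hx.coe_toReal, ← EReal.coe_add]
  exact EReal.le_of_forall_lt_iff_le.1 fun z hz => EReal.coe_le_coe_iff.2 (key z hz.le)

/-- The point `x` is a local minimum of `f` minus the linear function given by `ξ`, so the
derivative of the difference vanishes. -/
theorem eq_grad_of_mem_subdiff {n : ℕ} {f : Vec n → EReal} {x ξ : Vec n}
    (hfin : ∀ᶠ y in 𝓝 x, IsFinite (f y)) (hd : DifferentiableAt ℝ (fun y => (f y).toReal) x)
    (hξ : ξ ∈ subdiff f x) : ξ = grad f x := by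
  have hx : IsFinite (f x) := hfin.self_of_nhds
  have hmin : IsLocalMin (fun y => (f y).toReal - inner ℝ ξ (y - x)) x := by
    filter_upwards [hfin] with y hy
    have := subdiff_real hξ hx hy
    simp only [sub_self, inner_zero_right]
    linarith
  have hgr : HasFDerivAt (fun y => (f y).toReal)
      ((InnerProductSpace.toDual ℝ (Vec n)) (grad f x)) x := hd.hasGradientAt.hasFDerivAt
  have hlin : HasFDerivAt (fun y : Vec n => inner ℝ ξ (y - x))
      ((InnerProductSpace.toDual ℝ (Vec n)) ξ) x := by
    have h := ((InnerProductSpace.toDual ℝ (Vec n)) ξ).hasFDerivAt.comp x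
      ((hasFDerivAt_id x).sub_const x)
    simpa [Function.comp_def] using h
  have h0 := hmin.hasFDerivAt_eq_zero (hgr.sub hlin)
  rw [sub_eq_zero] at h0
  exact ((InnerProductSpace.toDual ℝ (Vec n)).injective h0).symm

/-- A small closed thickening of the compact set is compact and still inside the open domain. The
margin `r` is what `norm_subgradient_le` consumes. -/
theorem DiffOnNhd.exists_bound {E : Type*} [NormedAddCommGroup E] [NormedSpace ℝ E]
    [FiniteDimensional ℝ E] {f : E → EReal} {S : Set E} (h : DiffOnNhd f S) (hS : IsCompact S) :
    ∃ r > (0 : ℝ), ∃ B : ℝ, ∀ p ∈ S, ∀ q, dist q p ≤ r → IsFinite (f q) ∧ |(f q).toReal| ≤ B := by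
  obtain ⟨U, hU, hSU, hfin, hd⟩ := h
  obtain ⟨r, hr, hsub⟩ := hS.exists_cthickening_subset_open hU hSU
  have : ProperSpace E := FiniteDimensional.proper ℝ E
  have hcomp : IsCompact (Metric.cthickening r S) := hS.cthickening
  obtain ⟨B, hB⟩ := hcomp.exists_bound_of_continuousOn (hd.continuousOn.mono hsub)
  refine ⟨r, hr, B, fun p hp q hq => ?_⟩
  have hq' : q ∈ Metric.cthickening r S := Metric.mem_cthickening_of_dist_le q p r S hp hq
  exact ⟨hfin q (hsub hq'), by simpa using hB q hq'⟩

/-- Test the subgradient inequality at distance `r` from `x` in the direction of `ξ`: `r * ‖ξ‖` is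
at most a difference of two values. -/
theorem norm_subgradient_le {n : ℕ} {f : Vec n → EReal} {x ξ : Vec n} {r B : ℝ} (hr : 0 < r)
    (h : ∀ y, dist y x ≤ r → IsFinite (f y) ∧ |(f y).toReal| ≤ B) (hξ : ξ ∈ subdiff f x) :
    ‖ξ‖ ≤ 2 * B / r := by
  have h0 := h x (by simpa using hr.le)
  have hB : 0 ≤ B := (abs_nonneg _).trans h0.2
  rcases eq_or_ne ξ 0 with rfl | hne
  · simp; positivity
  have hpos : 0 < ‖ξ‖ := norm_pos_iff.2 hne
  have h1 := h (x + (r / ‖ξ‖) • ξ) (by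
    rw [dist_eq_norm, add_sub_cancel_left, norm_smul, Real.norm_of_nonneg (by positivity)]
    field_simp; rfl)
  have h2 := subdiff_real hξ h0.1 h1.1
  rw [add_sub_cancel_left, inner_smul_right, real_inner_self_eq_norm_sq] at h2
  have e : r / ‖ξ‖ * ‖ξ‖ ^ 2 = r * ‖ξ‖ := by field_simp
  rw [e] at h2
  rw [le_div_iff₀ hr]
  linarith [abs_le.1 h0.2, abs_le.1 h1.2, (abs_le.1 h0.2).1, (abs_le.1 h1.2).2]

theorem grad_neg {n : ℕ} (f : Vec n → EReal) (x : Vec n) :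
    grad (fun y => -f y) x = -grad f x := by
  have h : (fun y => (-f y).toReal) = fun y => -(f y).toReal :=
    funext fun y => EReal.toReal_neg_eq
  simp only [grad, gradient, h]
  rw [fderiv_fun_neg, map_neg]

theorem DiffOnNhd.subdiff_eq {n : ℕ} {f : Vec n → EReal} {S : Set (Vec n)} (h : DiffOnNhd f S)
    (hf : IsConvexFn f) {x : Vec n} (hx : x ∈ S) : subdiff f x = {grad f x} := by
  obtain ⟨U, hU, hSU, hfin, hd⟩ := h
  have hev : ∀ᶠ y in 𝓝 x, IsFinite (f y) := by
    filter_upwards [hU.mem_nhds (hSU hx)] with y hy using hfin y hy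
  have hdiff : DifferentiableAt ℝ (fun y => (f y).toReal) x :=
    (hd x (hSU hx)).differentiableAt (hU.mem_nhds (hSU hx))
  ext ξ
  constructor
  · exact fun h => eq_grad_of_mem_subdiff hev hdiff h
  · rintro rfl
    exact grad_mem_subdiff hf hev hdiff

theorem DiffOnNhd.neg {E : Type*} [NormedAddCommGroup E] [NormedSpace ℝ E] {f : E → EReal}
    {S : Set E} (h : DiffOnNhd f S) : DiffOnNhd (fun x => -f x) S := by
  obtain ⟨U, hU, hSU, hfin, hd⟩ := h
  refine ⟨U, hU, hSU, fun p hp => (hfin p hp).neg, ?_⟩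
  simpa only [EReal.toReal_neg_eq] using hd.fun_neg

section Product

variable {E F : Type*} [NormedAddCommGroup E] [NormedSpace ℝ E] [NormedAddCommGroup F]
  [NormedSpace ℝ F] {f : E × F → EReal} {S : Set E} {T : Set F}

theorem DiffOnNhd.prod_left (h : DiffOnNhd f (S ×ˢ T)) {z : F} (hz : z ∈ T) :
    DiffOnNhd (fun x => f (x, z)) S := by
  obtain ⟨U, hU, hSU, hfin, hd⟩ := h
  refine ⟨(fun x => (x, z)) ⁻¹' U, hU.preimage (by fun_prop), fun x hx => hSU ⟨hx, hz⟩,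
    fun p hp => hfin _ hp, ?_⟩
  exact hd.comp (f := fun x : E => (x, z)) (by fun_prop) fun x hx => hx

theorem DiffOnNhd.prod_right (h : DiffOnNhd f (S ×ˢ T)) {x : E} (hx : x ∈ S) :
    DiffOnNhd (fun z => f (x, z)) T := by
  obtain ⟨U, hU, hSU, hfin, hd⟩ := h
  refine ⟨(fun z => (x, z)) ⁻¹' U, hU.preimage (by fun_prop), fun z hz => hSU ⟨hx, hz⟩,
    fun p hp => hfin _ hp, ?_⟩
  exact hd.comp (f := fun z : F => (x, z)) (by fun_prop) fun x hx => hx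

end Product

/-! ### Uniform bounds on subgradients -/

/-- Non-empty subdifferentials, bounded by `D`, whose elements vary by at most `A` plus `L` times
the distance of the base points. -/
structure SubgradientBounds {M N : ℕ} {J I : Fin M → ℕ} (P : Problem M N J I) (A L D : ℝ) :
    Prop where
  A_nonneg : 0 ≤ A
  L_nonneg : 0 ≤ L
  D_nonneg : 0 ≤ D
  f0_nonempty : ∀ x ∈ P.X, (subdiff P.f0 x).Nonempty
  gx_nonempty : ∀ m, ∀ x ∈ P.X, ∀ z ∈ P.Zt m, (subdiff (fun y => P.g m y z) x).Nonempty
  gz_nonempty : ∀ m, ∀ x ∈ P.X, ∀ z ∈ P.Zt m, (subdiff (fun w => -P.g m x w) z).Nonempty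
  h_nonempty : ∀ m i, ∀ z ∈ P.Zt m, (subdiff (P.h m i) z).Nonempty
  f0_bounded : ∀ x ∈ P.X, ∀ ξ ∈ subdiff P.f0 x, ‖ξ‖ ≤ D
  gx_bounded : ∀ m, ∀ x ∈ P.X, ∀ z ∈ P.Zt m, ∀ ξ ∈ subdiff (fun y => P.g m y z) x, ‖ξ‖ ≤ D
  gz_bounded : ∀ m, ∀ x ∈ P.X, ∀ z ∈ P.Zt m, ∀ ζ ∈ subdiff (fun w => -P.g m x w) z, ‖ζ‖ ≤ D
  h_bounded : ∀ m i, ∀ z ∈ P.Zt m, ∀ η ∈ subdiff (P.h m i) z, ‖η‖ ≤ D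
  f0_diff : ∀ x ∈ P.X, ∀ x' ∈ P.X, ∀ ξ ∈ subdiff P.f0 x, ∀ ξ' ∈ subdiff P.f0 x',
    ‖ξ - ξ'‖ ≤ A + L * ‖x - x'‖
  gx_diff : ∀ m, ∀ x ∈ P.X, ∀ x' ∈ P.X, ∀ z ∈ P.Zt m, ∀ ξ ∈ subdiff (fun y => P.g m y z) x,
    ∀ ξ' ∈ subdiff (fun y => P.g m y z) x', ‖ξ - ξ'‖ ≤ A + L * ‖x - x'‖
  gz_diff : ∀ m, ∀ x ∈ P.X, ∀ x' ∈ P.X, ∀ z ∈ P.Zt m, ∀ z' ∈ P.Zt m,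
    ∀ ζ ∈ subdiff (fun w => -P.g m x w) z, ∀ ζ' ∈ subdiff (fun w => -P.g m x' w) z',
      ‖ζ - ζ'‖ ≤ A + L * (‖x - x'‖ + ‖z - z'‖)
  h_diff : ∀ m i, ∀ z ∈ P.Zt m, ∀ z' ∈ P.Zt m, ∀ η ∈ subdiff (P.h m i) z,
    ∀ η' ∈ subdiff (P.h m i) z', ‖η - η'‖ ≤ A + L * ‖z - z'‖

variable {M N : ℕ} {J I : Fin M → ℕ} {P : Problem M N J I}

/-- Two vectors of norm at most `D` differ by at most `2 * D` wherever their base points are, so the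
jump constant alone suffices. -/
theorem Problem.BoundedSubgradients.exists_bounds (h : P.BoundedSubgradients) :
    ∃ A D, SubgradientBounds P A 0 D := by
  obtain ⟨D0, hD0, hf⟩ := h.f0_bounded
  choose Dx hDx hgx using h.gx_bounded
  choose Dz hDz hgz using h.gz_bounded
  choose Dh hDh hh using h.h_bounded
  set D := D0 + ∑ m, (Dx m + Dz m + Dh m) with hD
  have hle : ∀ m, Dx m + Dz m + Dh m ≤ ∑ m, (Dx m + Dz m + Dh m) := fun m =>
    Finset.single_le_sum (f := fun m => Dx m + Dz m + Dh m)
      (fun m _ => by have := hDx m; have := hDz m; have := hDh m; positivity) (Finset.mem_univ m)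
  have hsum : 0 ≤ ∑ m, (Dx m + Dz m + Dh m) :=
    Finset.sum_nonneg fun m _ => by have := hDx m; have := hDz m; have := hDh m; positivity
  have b0 : ∀ x ∈ P.X, ∀ ξ ∈ subdiff P.f0 x, ‖ξ‖ ≤ D := fun x hx ξ hξ => by
    linarith [hf x hx ξ hξ]
  have b1 : ∀ m, ∀ x ∈ P.X, ∀ z ∈ P.Zt m, ∀ ξ ∈ subdiff (fun y => P.g m y z) x, ‖ξ‖ ≤ D :=
    fun m x hx z hz ξ hξ => by
      linarith [hgx m x hx z hz ξ hξ, hle m, hDz m, hDh m]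
  have b2 : ∀ m, ∀ x ∈ P.X, ∀ z ∈ P.Zt m, ∀ ζ ∈ subdiff (fun w => -P.g m x w) z, ‖ζ‖ ≤ D :=
    fun m x hx z hz ξ hξ => by
      linarith [hgz m x hx z hz ξ hξ, hle m, hDx m, hDh m]
  have b3 : ∀ m i, ∀ z ∈ P.Zt m, ∀ η ∈ subdiff (P.h m i) z, ‖η‖ ≤ D :=
    fun m i z hz ξ hξ => by
      linarith [hh m i z hz ξ hξ, hle m, hDx m, hDz m]
  have two : ∀ {n : ℕ} {u v : Vec n}, ‖u‖ ≤ D → ‖v‖ ≤ D → ‖u - v‖ ≤ 2 * D := fun hu hv => by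
    linarith [norm_sub_le_of_le hu hv]
  refine ⟨2 * D, D, by positivity, le_rfl, by positivity, h.f0_nonempty, h.gx_nonempty,
    h.gz_nonempty, h.h_nonempty, b0, b1, b2, b3, ?_, ?_, ?_, ?_⟩
  · intro x hx x' hx' ξ hξ ξ' hξ'
    rw [zero_mul, add_zero]
    exact two (b0 x hx ξ hξ) (b0 x' hx' ξ' hξ')
  · intro m x hx x' hx' z hz ξ hξ ξ' hξ'
    rw [zero_mul, add_zero]
    exact two (b1 m x hx z hz ξ hξ) (b1 m x' hx' z hz ξ' hξ')
  · intro m x hx x' hx' z hz z' hz' ξ hξ ξ' hξ'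
    rw [zero_mul, add_zero]
    exact two (b2 m x hx z hz ξ hξ) (b2 m x' hx' z' hz' ξ' hξ')
  · intro m i z hz z' hz' ξ hξ ξ' hξ'
    rw [zero_mul, add_zero]
    exact two (b3 m i z hz ξ hξ) (b3 m i z' hz' ξ' hξ')

/-- Subdifferentials are singletons here, so the gradient estimates give variation without jumps.
Boundedness of the gradients is not assumed; it follows from bounds on function values near the
compact sets. -/
theorem Problem.LipschitzGradients.exists_bounds (h : P.LipschitzGradients) (hP : P.Regular) :
    ∃ L D, SubgradientBounds P 0 L D := by
  have s0 : ∀ x ∈ P.X, subdiff P.f0 x = {grad P.f0 x} := fun x hx =>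
    h.f0_diff.subdiff_eq hP.f0_convex hx
  have s1 : ∀ m, ∀ x ∈ P.X, ∀ z ∈ P.Zt m,
      subdiff (fun y => P.g m y z) x = {grad (fun y => P.g m y z) x} := fun m x hx z hz =>
    ((h.g_diff m).prod_left hz).subdiff_eq (hP.g_convex m z hz) hx
  have s2 : ∀ m, ∀ x ∈ P.X, ∀ z ∈ P.Zt m,
      subdiff (fun w => -P.g m x w) z = {-grad (P.g m x) z} := fun m x hx z hz => by
    rw [((h.g_diff m).prod_right hx).neg.subdiff_eq (hP.g_concave m x hx) hz, ← grad_neg]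
  have s3 : ∀ m i, ∀ z ∈ P.Zt m, subdiff (P.h m i) z = {grad (P.h m i) z} := fun m i z hz =>
    (h.h_diff m i).subdiff_eq (hP.h_convex m i) hz
  obtain ⟨r0, hr0, B0, hB0⟩ := h.f0_diff.exists_bound hP.X_compact
  choose r1 hr1 B1 hB1 using fun m =>
    (h.g_diff m).exists_bound (hP.X_compact.prod (hP.Zt_compact m))
  choose r2 hr2 B2 hB2 using fun m i => (h.h_diff m i).exists_bound (hP.Zt_compact m)
  obtain ⟨L0, hL0, hf⟩ := h.f0_lip
  choose Lx hLx hgx using h.gx_lip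
  choose Lz hLz Lz' hLz' hgz using h.gz_lip
  choose Lh hLh hh using h.h_lip
  set L := L0 + ∑ m, (Lx m + Lz m + Lz' m + Lh m) with hL
  set D := |2 * B0 / r0| + ∑ m, (|2 * B1 m / r1 m| + ∑ i, |2 * B2 m i / r2 m i|) with hD
  have hLpos : ∀ m, 0 ≤ Lx m + Lz m + Lz' m + Lh m := fun m => by
    have := hLx m; have := hLz m; have := hLz' m; have := hLh m; positivity
  have hLle : ∀ m, Lx m + Lz m + Lz' m + Lh m ≤ ∑ m, (Lx m + Lz m + Lz' m + Lh m) := fun m =>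
    Finset.single_le_sum (f := fun m => Lx m + Lz m + Lz' m + Lh m)
      (fun m _ => hLpos m) (Finset.mem_univ m)
  have hLsum : 0 ≤ ∑ m, (Lx m + Lz m + Lz' m + Lh m) := Finset.sum_nonneg fun m _ => hLpos m
  have hDpos : ∀ m, 0 ≤ |2 * B1 m / r1 m| + ∑ i, |2 * B2 m i / r2 m i| := fun m => by positivity
  have hDsum : 0 ≤ ∑ m, (|2 * B1 m / r1 m| + ∑ i, |2 * B2 m i / r2 m i|) :=
    Finset.sum_nonneg fun m _ => hDpos m
  have hDle : ∀ m, |2 * B1 m / r1 m| + ∑ i, |2 * B2 m i / r2 m i|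
      ≤ ∑ m, (|2 * B1 m / r1 m| + ∑ i, |2 * B2 m i / r2 m i|) := fun m =>
    Finset.single_le_sum (f := fun m => |2 * B1 m / r1 m| + ∑ i, |2 * B2 m i / r2 m i|)
      (fun m _ => hDpos m) (Finset.mem_univ m)
  have hDle0 : |2 * B0 / r0| ≤ D := by linarith
  have hDle1 : ∀ m, |2 * B1 m / r1 m| ≤ D := fun m => by
    have h1 : 0 ≤ ∑ i, |2 * B2 m i / r2 m i| := by positivity
    linarith [hDle m, abs_nonneg (2 * B0 / r0)]
  have hDle2 : ∀ m i, |2 * B2 m i / r2 m i| ≤ D := fun m i => by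
    have h1 : |2 * B2 m i / r2 m i| ≤ ∑ i, |2 * B2 m i / r2 m i| :=
      Finset.single_le_sum (f := fun i => |2 * B2 m i / r2 m i|)
        (fun i _ => abs_nonneg _) (Finset.mem_univ i)
    linarith [hDle m, abs_nonneg (2 * B0 / r0), abs_nonneg (2 * B1 m / r1 m)]
  refine ⟨L, D, le_rfl, by positivity, by positivity, fun x hx => ?_, fun m x hx z hz => ?_,
    fun m x hx z hz => ?_, fun m i z hz => ?_, ?_, ?_, ?_, ?_, ?_, ?_, ?_, ?_⟩
  · rw [s0 x hx]; exact Set.singleton_nonempty _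
  · rw [s1 m x hx z hz]; exact Set.singleton_nonempty _
  · rw [s2 m x hx z hz]; exact Set.singleton_nonempty _
  · rw [s3 m i z hz]; exact Set.singleton_nonempty _
  · intro x hx ξ hξ
    exact (norm_subgradient_le hr0 (fun y hy => hB0 x hx y hy) hξ).trans
      ((le_abs_self _).trans hDle0)
  · intro m x hx z hz ξ hξ
    exact (norm_subgradient_le (hr1 m) (fun y hy => hB1 m (x, z) ⟨hx, hz⟩ (y, z) (by simpa using hy))
      hξ).trans ((le_abs_self _).trans (hDle1 m))
  · intro m x hx z hz ξ hξ
    refine (norm_subgradient_le (hr1 m) (fun y hy => ?_) hξ).trans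
      ((le_abs_self _).trans (hDle1 m))
    have := hB1 m (x, z) ⟨hx, hz⟩ (x, y) (by simpa using hy)
    exact ⟨this.1.neg, by rw [EReal.toReal_neg_eq, abs_neg]; exact this.2⟩
  · intro m i z hz ξ hξ
    exact (norm_subgradient_le (hr2 m i) (fun y hy => hB2 m i z hz y hy) hξ).trans
      ((le_abs_self _).trans (hDle2 m i))
  · intro x hx x' hx' ξ hξ ξ' hξ'
    rw [s0 x hx, Set.mem_singleton_iff] at hξ
    rw [s0 x' hx', Set.mem_singleton_iff] at hξ'
    subst hξ hξ'
    rw [zero_add]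
    exact (hf x hx x' hx').trans (by gcongr; linarith)
  · intro m x hx x' hx' z hz ξ hξ ξ' hξ'
    rw [s1 m x hx z hz, Set.mem_singleton_iff] at hξ
    rw [s1 m x' hx' z hz, Set.mem_singleton_iff] at hξ'
    subst hξ hξ'
    rw [zero_add]
    refine (hgx m x hx x' hx' z hz).trans ?_
    gcongr
    linarith [hLle m, hLz m, hLz' m, hLh m]
  · intro m x hx x' hx' z hz z' hz' ξ hξ ξ' hξ'
    rw [s2 m x hx z hz, Set.mem_singleton_iff] at hξ
    rw [s2 m x' hx' z' hz', Set.mem_singleton_iff] at hξ'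
    subst hξ hξ'
    rw [zero_add, neg_sub_neg, norm_sub_rev, mul_add]
    refine (hgz m x hx x' hx' z hz z' hz').trans ?_
    gcongr
    · linarith [hLle m, hLx m, hLz' m, hLh m]
    · linarith [hLle m, hLx m, hLz m, hLh m]
  · intro m i z hz z' hz' ξ hξ ξ' hξ'
    rw [s3 m i z hz, Set.mem_singleton_iff] at hξ
    rw [s3 m i z' hz', Set.mem_singleton_iff] at hξ'
    subst hξ hξ'
    rw [zero_add]
    refine (hh m i z hz z' hz').trans ?_
    gcongr
    linarith [hLle m, hLx m, hLz m, hLz' m]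

/-! ### Subgradients of the penalized constraints -/

/-- Subgradients at `z` of `-gₘ(x, ·) + ∑ᵢ μᵢ hₘᵢ` that are sums of subgradients. -/
def penSubdiff (P : Problem M N J I) (m : Fin M) (x : Vec N) (μ : Vec (I m)) (z : Vec (J m)) :
    Set (Vec (J m)) :=
  {σ | ∃ ζ ∈ subdiff (fun w => -P.g m x w) z, ∃ η : Fin (I m) → Vec (J m),
    (∀ i, η i ∈ subdiff (P.h m i) z) ∧ σ = ζ + ∑ i, μ i • η i}

theorem SubgradientBounds.penSubdiff_nonempty {A L D : ℝ} (hB : SubgradientBounds P A L D)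
    {m : Fin M} {x : Vec N} (hx : x ∈ P.X) (μ : Vec (I m)) {z : Vec (J m)} (hz : z ∈ P.Zt m) :
    (penSubdiff P m x μ z).Nonempty := by
  obtain ⟨ζ, hζ⟩ := hB.gz_nonempty m x hx z hz
  choose η hη using fun i => hB.h_nonempty m i z hz
  exact ⟨_, ζ, hζ, η, hη, rfl⟩

theorem Problem.Regular.gpen_le (hP : P.Regular) {m : Fin M} {x : Vec N} (hx : x ∈ P.X)
    {μ : Vec (I m)} (hμ : ∀ i, 0 ≤ μ i) {z z' : Vec (J m)} (hz : z ∈ P.Zt m)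
    (hz' : z' ∈ P.Zt m) {σ : Vec (J m)} (hσ : σ ∈ penSubdiff P m x μ z) :
    P.gpen m x μ z' ≤ P.gpen m x μ z + inner ℝ σ (z - z') := by
  obtain ⟨ζ, hζ, η, hη, rfl⟩ := hσ
  have h1 := subdiff_real hζ (hP.g_finite m x hx z hz).neg (hP.g_finite m x hx z' hz').neg
  have h2 : ∀ i, μ i * (P.h m i z).toReal + μ i * inner ℝ (η i) (z' - z)
      ≤ μ i * (P.h m i z').toReal := fun i => by
    rw [← mul_add]
    exact mul_le_mul_of_nonneg_left
      (subdiff_real (hη i) (hP.h_finite m i z hz) (hP.h_finite m i z' hz')) (hμ i)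
  have h3 := Finset.sum_le_sum fun i (_ : i ∈ Finset.univ) => h2 i
  rw [Finset.sum_add_distrib] at h3
  rw [EReal.toReal_neg_eq, EReal.toReal_neg_eq] at h1
  have h4 : inner ℝ (ζ + ∑ i, μ i • η i) (z - z')
      = -(inner ℝ ζ (z' - z) + ∑ i, μ i * inner ℝ (η i) (z' - z)) := by
    rw [← neg_sub z' z, inner_neg_right, inner_add_left, sum_inner]
    simp only [inner_smul_left, conj_trivial]
  rw [h4]
  unfold Problem.gpen
  linarith

/-- Write μη - μ'η' = μ(η - η') + (μ - μ')η'. The second term is Lipschitz in μ because the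
subgradients of h are bounded, so the jump part stays proportional to `A` and vanishes with it. -/
theorem SubgradientBounds.penSubdiff_sub_le {A L D : ℝ} (hB : SubgradientBounds P A L D)
    {m : Fin M} {a : ℝ} (ha : 0 ≤ a) {x x' : Vec N} (hx : x ∈ P.X) (hx' : x' ∈ P.X)
    {μ μ' : Vec (I m)} (hμ : μ ∈ box (I m) a) {z z' : Vec (J m)}
    (hz : z ∈ P.Zt m) (hz' : z' ∈ P.Zt m) {σ σ' : Vec (J m)} (hσ : σ ∈ penSubdiff P m x μ z)
    (hσ' : σ' ∈ penSubdiff P m x' μ' z') :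
    ‖σ - σ'‖ ≤ (1 + I m * a) * A
      + ((1 + I m * a) * L + I m * D) * (‖x - x'‖ + ‖μ - μ'‖ + ‖z - z'‖) := by
  obtain ⟨ζ, hζ, η, hη, rfl⟩ := hσ
  obtain ⟨ζ', hζ', η', hη', rfl⟩ := hσ'
  have hA := hB.A_nonneg
  have hL := hB.L_nonneg
  have hD := hB.D_nonneg
  have h1 := hB.gz_diff m x hx x' hx' z hz z' hz' ζ hζ ζ' hζ'
  have h2 : ∀ i, ‖μ i • η i - μ' i • η' i‖ ≤ a * (A + L * ‖z - z'‖) + D * ‖μ - μ'‖ := by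
    intro i
    have e : μ i • η i - μ' i • η' i = μ i • (η i - η' i) + (μ - μ') i • η' i := by
      rw [PiLp.sub_apply, sub_smul, smul_sub]; abel
    rw [e]
    refine (norm_add_le _ _).trans (add_le_add ?_ ?_)
    · rw [norm_smul, Real.norm_of_nonneg (hμ i).1]
      exact mul_le_mul (hμ i).2 (hB.h_diff m i z hz z' hz' _ (hη i) _ (hη' i))
        (norm_nonneg _) ha
    · rw [norm_smul, mul_comm]
      exact mul_le_mul (hB.h_bounded m i z' hz' _ (hη' i)) (abs_apply_le_norm _ i)
        (norm_nonneg _) hD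
  have h3 : ‖∑ i, μ i • η i - ∑ i, μ' i • η' i‖
      ≤ I m * (a * (A + L * ‖z - z'‖) + D * ‖μ - μ'‖) := by
    rw [← Finset.sum_sub_distrib]
    refine (norm_sum_le _ _).trans ((Finset.sum_le_sum fun i _ => h2 i).trans ?_)
    rw [Finset.sum_const, Finset.card_univ, Fintype.card_fin, nsmul_eq_mul]
  have e : ζ + ∑ i, μ i • η i - (ζ' + ∑ i, μ' i • η' i)
      = (ζ - ζ') + (∑ i, μ i • η i - ∑ i, μ' i • η' i) := by abel
  rw [e]
  refine (norm_add_le _ _).trans ((add_le_add h1 h3).trans ?_)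
  have n1 := norm_nonneg (x - x')
  have n2 := norm_nonneg (μ - μ')
  have n3 := norm_nonneg (z - z')
  have hI : (0 : ℝ) ≤ I m := Nat.cast_nonneg _
  have p1 : 0 ≤ (I m : ℝ) * a * L * ‖x - x'‖ := by positivity
  have p2 : 0 ≤ (1 + (I m : ℝ) * a) * L * ‖μ - μ'‖ := by positivity
  have p3 : 0 ≤ (I m : ℝ) * D * ‖x - x'‖ := by positivity
  have p4 : 0 ≤ (I m : ℝ) * D * ‖z - z'‖ := by positivity
  nlinarith

/-- A substitute for the descent lemma: the subgradient at the old point `u` is used at the new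
point `u'`. With `e = A + L * ‖u' - u‖` it serves the nonsmooth and the smooth case alike. -/
theorem sub_le_of_mem_subdiff {n : ℕ} {f : Vec n → EReal} {u u' x ξ ξ' : Vec n} {e : ℝ}
    (hu : IsFinite (f u)) (hu' : IsFinite (f u')) (hx : IsFinite (f x)) (hξ : ξ ∈ subdiff f u)
    (hξ' : ξ' ∈ subdiff f u') (he : ‖ξ' - ξ‖ ≤ e) :
    (f u').toReal - (f x).toReal ≤ inner ℝ ξ (u' - x) + e * ‖u' - u‖ := by
  have h1 := subdiff_real hξ hu hx
  have h2 := subdiff_real hξ' hu' hu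
  have h3 : inner ℝ (ξ' - ξ) (u' - u) ≤ e * ‖u' - u‖ :=
    (real_inner_le_norm _ _).trans (mul_le_mul_of_nonneg_right he (norm_nonneg _))
  have h4 : inner ℝ ξ (u' - x) = inner ℝ ξ (u' - u) - inner ℝ ξ (x - u) := by
    rw [← inner_sub_right]; congr 1; abel
  have h5 : inner ℝ (ξ' - ξ) (u' - u) = inner ℝ ξ' (u' - u) - inner ℝ ξ (u' - u) :=
    inner_sub_left _ _ _
  have h6 : inner ℝ ξ' (u' - u) = - inner ℝ ξ' (u - u') := by rw [← inner_neg_right, neg_sub]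
  linarith

/-! ### One iteration of the inner algorithm -/

namespace InnerTrace.IsRun

variable {Q : InnerTrace M N J I} {a : Fin M → ℝ} {p : Params} {xc : Vec N}
  {μc : (m : Fin M) → Vec (I m)} {lam : Fin M → ℝ}

theorem x_mem (h : Q.IsRun P a p xc μc lam) {t : ℕ} (ht : t ≤ p.T) : Q.x t ∈ P.X := by
  cases t with
  | zero => exact h.x_init
  | succ t => exact (h.x_step t ht).1

theorem μ_mem (h : Q.IsRun P a p xc μc lam) {t : ℕ} (ht : t ≤ p.T) (m : Fin M) :
    Q.μ t m ∈ box (I m) (a m) := by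
  cases t with
  | zero => exact h.μ_init m
  | succ t => exact (h.μ_step t ht m).1

theorem z_mem (h : Q.IsRun P a p xc μc lam) {t : ℕ} (ht : t ≤ p.T) (m : Fin M) :
    Q.z t m ∈ P.Zt m := by
  cases t with
  | zero => exact h.z_init m
  | succ t => exact (h.z_step t ht m).1

/-- Combines the ζ and μη terms into one subgradient sequence. A run computes subgradients only for
`t < p.T`, while the estimate of the last iteration needs one at index `p.T`; there an arbitrary one
is chosen. -/
theorem exists_penSubdiff {A L D : ℝ} (h : Q.IsRun P a p xc μc lam)
    (hB : SubgradientBounds P A L D) :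
    ∃ σ : ℕ → (m : Fin M) → Vec (J m),
      (∀ t ≤ p.T, ∀ m, σ t m ∈ penSubdiff P m (Q.x t) (Q.μ t m) (Q.z t m)) ∧
      ∀ t < p.T, ∀ m, IsProj (P.Zt m)
        (Q.z t m - p.δ • (lam m • ((2 : ℝ) • σ t m - σ (t - 1) m))) (Q.z (t + 1) m) := by
  have hne : ∀ t m, ∃ σ : Vec (J m), (t ≤ p.T → σ ∈ penSubdiff P m (Q.x t) (Q.μ t m) (Q.z t m)) ∧
      (t < p.T → σ = Q.ζ t m + ∑ i, Q.μ t m i • Q.η t m i) := by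
    intro t m
    rcases lt_trichotomy t p.T with ht | ht | ht
    · exact ⟨_, fun _ => ⟨_, h.ζ_mem t ht m, Q.η t m, h.η_mem t ht m, rfl⟩, fun _ => rfl⟩
    · obtain ⟨σ, hσ⟩ := hB.penSubdiff_nonempty (h.x_mem ht.le) (Q.μ t m) (h.z_mem ht.le m)
      exact ⟨σ, fun _ => hσ, fun h => absurd h (by omega)⟩
    · exact ⟨0, fun h => absurd h (by omega), fun h => absurd h (by omega)⟩
  choose σ h1 h2 using hne
  refine ⟨σ, fun t ht m => h1 t m ht, fun t ht m => ?_⟩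
  have h3 := h.z_step t ht m
  rw [smul_smul, h2 t m ht, h2 (t - 1) m (by omega)]
  convert h3 using 4
  rw [Finset.sum_sub_distrib, smul_add, Finset.smul_sum]
  simp only [smul_smul]
  abel

/-- The step already uses z_{t+1}, so no extrapolation is needed in x; the only error comes from
taking subgradients at x_t instead of x_{t+1}. -/
theorem x_step_le {A L D Λ : ℝ} (h : Q.IsRun P a p xc μc lam) (hP : P.Regular)
    (hB : SubgradientBounds P A L D) (hlam : ∀ m, 0 ≤ lam m ∧ lam m ≤ Λ) {t : ℕ} (ht : t < p.T)
    {x : Vec N} (hx : x ∈ P.X) :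
    (P.f0 (Q.x (t + 1))).toReal + ∑ m, lam m * (P.g m (Q.x (t + 1)) (Q.z (t + 1) m)).toReal
      - ((P.f0 x).toReal + ∑ m, lam m * (P.g m x (Q.z (t + 1) m)).toReal)
      + 1 / (2 * p.α) * (‖Q.x (t + 1) - xc‖ ^ 2 - ‖x - xc‖ ^ 2 + ‖x - Q.x (t + 1)‖ ^ 2)
    ≤ (‖x - Q.x t‖ ^ 2 - ‖x - Q.x (t + 1)‖ ^ 2 - ‖Q.x (t + 1) - Q.x t‖ ^ 2) / (2 * p.γ)
      + (1 + M * Λ) * (A + L * ‖Q.x (t + 1) - Q.x t‖) * ‖Q.x (t + 1) - Q.x t‖ := by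
  have hxt := h.x_mem ht.le
  have hxt' := h.x_mem (t := t + 1) ht
  have hz := fun m => h.z_mem (t := t + 1) ht m
  set e := A + L * ‖Q.x (t + 1) - Q.x t‖ with he
  have he0 : 0 ≤ e := by
    have := hB.A_nonneg
    have := hB.L_nonneg
    positivity
  have h0 : (P.f0 (Q.x (t + 1))).toReal - (P.f0 x).toReal
      ≤ inner ℝ (Q.ξ0 t) (Q.x (t + 1) - x) + e * ‖Q.x (t + 1) - Q.x t‖ := by
    obtain ⟨ξ', hξ'⟩ := hB.f0_nonempty _ hxt'
    exact sub_le_of_mem_subdiff (hP.f0_finite _ hxt) (hP.f0_finite _ hxt') (hP.f0_finite _ hx)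
      (h.ξ0_mem t ht) hξ' (hB.f0_diff _ hxt' _ hxt _ hξ' _ (h.ξ0_mem t ht))
  have h1 : ∀ m, lam m * (P.g m (Q.x (t + 1)) (Q.z (t + 1) m)).toReal
      - lam m * (P.g m x (Q.z (t + 1) m)).toReal
      ≤ lam m * inner ℝ (Q.ξ t m) (Q.x (t + 1) - x) + Λ * (e * ‖Q.x (t + 1) - Q.x t‖) := by
    intro m
    obtain ⟨ξ', hξ'⟩ := hB.gx_nonempty m _ hxt' _ (hz m)
    have h2 := sub_le_of_mem_subdiff (f := fun y => P.g m y (Q.z (t + 1) m)) (x := x)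
      (hP.g_finite m _ hxt _ (hz m))
      (hP.g_finite m _ hxt' _ (hz m)) (hP.g_finite m _ hx _ (hz m))
      (h.ξ_mem t ht m) hξ' (hB.gx_diff m _ hxt' _ hxt _ (hz m) _ hξ' _ (h.ξ_mem t ht m))
    have h3 := mul_le_mul_of_nonneg_left h2 (hlam m).1
    have h4 : lam m * (e * ‖Q.x (t + 1) - Q.x t‖) ≤ Λ * (e * ‖Q.x (t + 1) - Q.x t‖) :=
      mul_le_mul_of_nonneg_right (hlam m).2 (by positivity)
    linarith
  have h2 := Finset.sum_le_sum fun m (_ : m ∈ Finset.univ) => h1 m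
  simp only [Finset.sum_sub_distrib, Finset.sum_add_distrib, Finset.sum_const, Finset.card_univ,
    Fintype.card_fin, nsmul_eq_mul] at h2
  have h3 := IsProj.prox_step_le hP.X_convex p.α_pos p.γ_pos (h.x_step t ht) hx
  have h4 : inner ℝ (Q.ξ0 t + ∑ m, lam m • Q.ξ t m) (Q.x (t + 1) - x)
      = inner ℝ (Q.ξ0 t) (Q.x (t + 1) - x)
        + ∑ m, lam m * inner ℝ (Q.ξ t m) (Q.x (t + 1) - x) := by
    rw [inner_add_left, sum_inner]
    simp only [inner_smul_left, conj_trivial]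
  rw [h4] at h3
  linarith

/-- The objective is linear in μ apart from the proximal term, so this step is exact. -/
theorem μ_step_le (h : Q.IsRun P a p xc μc lam) {t : ℕ} (ht : t < p.T) (m : Fin M)
    {μ : Vec (I m)} (hμ : μ ∈ box (I m) (a m)) :
    lam m * ((∑ i, μ i * (P.h m i (Q.z (t + 1) m)).toReal)
        - ∑ i, Q.μ (t + 1) m i * (P.h m i (Q.z (t + 1) m)).toReal)
      + 1 / (2 * p.α) * (‖Q.μ (t + 1) m - μc m‖ ^ 2 - ‖μ - μc m‖ ^ 2 + ‖μ - Q.μ (t + 1) m‖ ^ 2)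
    ≤ (‖μ - Q.μ t m‖ ^ 2 - ‖μ - Q.μ (t + 1) m‖ ^ 2 - ‖Q.μ (t + 1) m - Q.μ t m‖ ^ 2)
        / (2 * p.γ) := by
  have h2 := IsProj.prox_step_le (v := -(lam m • P.hvec m (Q.z (t + 1) m))) (convex_box _ _)
    p.α_pos p.γ_pos (by rw [sub_neg_eq_add]; exact h.μ_step t ht m) hμ
  have h3 : inner ℝ (-(lam m • P.hvec m (Q.z (t + 1) m))) (Q.μ (t + 1) m - μ)
      = lam m * ((∑ i, μ i * (P.h m i (Q.z (t + 1) m)).toReal)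
        - ∑ i, Q.μ (t + 1) m i * (P.h m i (Q.z (t + 1) m)).toReal) := by
    rw [inner_neg_left, inner_smul_left, inner_sub_right]
    simp only [Problem.hvec, PiLp.inner_apply, conj_trivial, RCLike.inner_apply]
    ring
  rw [h3] at h2
  linarith

/-- Sum of the squared lengths of the last inner step, restricted to the `m`-th constraint. -/
noncomputable def stepSq (Q : InnerTrace M N J I) (m : Fin M) (t : ℕ) : ℝ :=
  ‖Q.x t - Q.x (t - 1)‖ ^ 2 + ‖Q.μ t m - Q.μ (t - 1) m‖ ^ 2 + ‖Q.z t m - Q.z (t - 1) m‖ ^ 2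

/-- The part of the Lyapunov function of the inner algorithm that belongs to the `m`-th
constraint. -/
noncomputable def potential (Q : InnerTrace M N J I) (γ c l : ℝ) (m : Fin M) (μ : Vec (I m))
    (z : Vec (J m)) (σ : ℕ → Vec (J m)) (t : ℕ) : ℝ :=
  (‖μ - Q.μ t m‖ ^ 2 + ‖z - Q.z t m‖ ^ 2) / (2 * γ)
    - l * inner ℝ (σ t - σ (t - 1)) (Q.z t m - z) + c * stepSq Q m t

/-- The gap calls for σ_{t+1}, the step used 2σ_t - σ_{t-1}. Their difference splits into a
telescoping cross term, kept in `potential`, and ⟨σ_t - σ_{t-1}, z_{t+1} - z_t⟩, treated by Young's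
inequality. The last summand of the bound is left over because all constraints share one x-step;
`gap_le` pays for it. -/
theorem z_step_le {A₁ L₁ Λ : ℝ} (h : Q.IsRun P a p xc μc lam) (hP : P.Regular)
    (hA₁ : 0 ≤ A₁) (hL₁ : 0 ≤ L₁)
    (hlam : ∀ m, 0 ≤ lam m ∧ lam m ≤ Λ) (hγδ : p.γ = p.δ) (hγ : p.γ * (Λ * L₁) ≤ 1 / 12)
    {m : Fin M} {σ : ℕ → Vec (J m)}
    (hσ : ∀ t ≤ p.T, σ t ∈ penSubdiff P m (Q.x t) (Q.μ t m) (Q.z t m))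
    (hσz : ∀ t < p.T, IsProj (P.Zt m)
        (Q.z t m - p.δ • (lam m • ((2 : ℝ) • σ t - σ (t - 1)))) (Q.z (t + 1) m))
    (hσd : ∀ t ≤ p.T, ‖σ t - σ (t - 1)‖ ≤ A₁ + L₁ * (‖Q.x t - Q.x (t - 1)‖
        + ‖Q.μ t m - Q.μ (t - 1) m‖ + ‖Q.z t m - Q.z (t - 1) m‖))
    {t : ℕ} (ht : t < p.T) {μ : Vec (I m)} (hμ : μ ∈ box (I m) (a m)) {z : Vec (J m)}
    (hz : z ∈ P.Zt m) :
    lam m * (P.gpen m (Q.x (t + 1)) (Q.μ (t + 1) m) z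
        - P.gpen m (Q.x (t + 1)) (Q.μ (t + 1) m) (Q.z (t + 1) m))
      + lam m * ((∑ i, μ i * (P.h m i (Q.z (t + 1) m)).toReal)
        - ∑ i, Q.μ (t + 1) m i * (P.h m i (Q.z (t + 1) m)).toReal)
      + 1 / (2 * p.α) * (‖Q.μ (t + 1) m - μc m‖ ^ 2 - ‖μ - μc m‖ ^ 2 + ‖μ - Q.μ (t + 1) m‖ ^ 2)
    ≤ potential Q p.γ (Λ * L₁) (lam m) m μ z σ t - potential Q p.γ (Λ * L₁) (lam m) m μ z σ (t + 1)
      + 2 * p.γ * (Λ * A₁) ^ 2 + Λ * L₁ * ‖Q.x (t + 1) - Q.x t‖ ^ 2 := by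
  have hμs := h.μ_step_le ht m hμ
  have hγ0 := p.γ_pos
  have hΛ : 0 ≤ Λ := (hlam m).1.trans (hlam m).2
  have h1 := hP.gpen_le (h.x_mem (t := t + 1) ht) (fun i => (h.μ_mem (t := t + 1) ht m i).1)
    (h.z_mem (t := t + 1) ht m) hz (hσ (t + 1) ht)
  have h1' := mul_le_mul_of_nonneg_left (sub_le_iff_le_add'.2 h1) (hlam m).1
  have h2 := IsProj.step_le (hP.Zt_convex m) p.δ_pos (hσz t ht) hz
  rw [← hγδ, inner_smul_left] at h2
  have e1 : inner ℝ (σ (t + 1)) (Q.z (t + 1) m - z)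
      = inner ℝ ((2 : ℝ) • σ t - σ (t - 1)) (Q.z (t + 1) m - z)
        + inner ℝ (σ (t + 1) - σ t) (Q.z (t + 1) m - z)
        - inner ℝ (σ t - σ (t - 1)) (Q.z t m - z)
        - inner ℝ (σ t - σ (t - 1)) (Q.z (t + 1) m - Q.z t m) := by
    simp only [inner_sub_left, inner_sub_right, inner_smul_left, conj_trivial]
    ring
  set q := ‖Q.z (t + 1) m - Q.z t m‖ with hq
  have hq0 : 0 ≤ q := norm_nonneg _
  have h3 : -(lam m * inner ℝ (σ t - σ (t - 1)) (Q.z (t + 1) m - Q.z t m))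
      ≤ Λ * (A₁ + L₁ * (‖Q.x t - Q.x (t - 1)‖
        + ‖Q.μ t m - Q.μ (t - 1) m‖ + ‖Q.z t m - Q.z (t - 1) m‖)) * q := by
    have h4 : -inner ℝ (σ t - σ (t - 1)) (Q.z (t + 1) m - Q.z t m)
        ≤ ‖σ t - σ (t - 1)‖ * q :=
      (neg_le_abs _).trans (abs_real_inner_le_norm _ _)
    have h5 := mul_le_mul_of_nonneg_left
      (h4.trans (mul_le_mul_of_nonneg_right (hσd t ht.le) hq0)) (hlam m).1
    have h6 := mul_le_mul_of_nonneg_right (hlam m).2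
      (show 0 ≤ (A₁ + L₁ * (‖Q.x t - Q.x (t - 1)‖
        + ‖Q.μ t m - Q.μ (t - 1) m‖ + ‖Q.z t m - Q.z (t - 1) m‖)) * q by positivity)
    linarith
  have h7 : Λ * (A₁ + L₁ * (‖Q.x t - Q.x (t - 1)‖
        + ‖Q.μ t m - Q.μ (t - 1) m‖ + ‖Q.z t m - Q.z (t - 1) m‖)) * q
      ≤ q ^ 2 / (8 * p.γ) + 2 * p.γ * (Λ * A₁) ^ 2 + Λ * L₁ * (stepSq Q m t + 2 * q ^ 2) := by
    have h8 : Λ * A₁ * q ≤ q ^ 2 / (8 * p.γ) + 2 * p.γ * (Λ * A₁) ^ 2 := by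
      rw [div_add' _ _ _ (by positivity), le_div_iff₀ (by positivity)]
      nlinarith [sq_nonneg (q - 4 * p.γ * (Λ * A₁))]
    have h9 : (‖Q.x t - Q.x (t - 1)‖
        + ‖Q.μ t m - Q.μ (t - 1) m‖ + ‖Q.z t m - Q.z (t - 1) m‖) * q
        ≤ stepSq Q m t + 2 * q ^ 2 := by
      unfold stepSq
      nlinarith [sq_nonneg (‖Q.x t - Q.x (t - 1)‖ - q / 2),
        sq_nonneg (‖Q.μ t m - Q.μ (t - 1) m‖ - q / 2),
        sq_nonneg (‖Q.z t m - Q.z (t - 1) m‖ - q / 2)]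
    have h10 := mul_le_mul_of_nonneg_left h9 (mul_nonneg hΛ hL₁)
    linarith
  have hc : Λ * L₁ ≤ 1 / (12 * p.γ) := by
    rw [le_div_iff₀ (by positivity)]; linarith
  have b1 : Λ * L₁ * ‖Q.μ (t + 1) m - Q.μ t m‖ ^ 2 ≤ ‖Q.μ (t + 1) m - Q.μ t m‖ ^ 2 / (2 * p.γ) := by
    have := mul_le_mul_of_nonneg_right hc (sq_nonneg ‖Q.μ (t + 1) m - Q.μ t m‖)
    have e : ‖Q.μ (t + 1) m - Q.μ t m‖ ^ 2 / (2 * p.γ)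
      = 6 * (1 / (12 * p.γ) * ‖Q.μ (t + 1) m - Q.μ t m‖ ^ 2) := by field_simp; ring
    have : 0 ≤ 1 / (12 * p.γ) * ‖Q.μ (t + 1) m - Q.μ t m‖ ^ 2 := by positivity
    linarith
  -- Budget for q²: two units of Λ L₁ come from `h9`, one from `stepSq` at t + 1, and Λ L₁ ≤
  -- 1/(12γ); altogether 3/12 + 1/8 ≤ 1/2 in units of 1/γ.
  have b2 : 3 * (Λ * L₁ * q ^ 2) + q ^ 2 / (8 * p.γ) ≤ q ^ 2 / (2 * p.γ) := by
    have := mul_le_mul_of_nonneg_right hc (sq_nonneg q)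
    have e : q ^ 2 / (2 * p.γ) = 6 * (1 / (12 * p.γ) * q ^ 2) := by field_simp; ring
    have e' : q ^ 2 / (8 * p.γ) = 3 / 2 * (1 / (12 * p.γ) * q ^ 2) := by field_simp; ring
    have : 0 ≤ 1 / (12 * p.γ) * q ^ 2 := by positivity
    linarith
  have e3 : stepSq Q m (t + 1) = ‖Q.x (t + 1) - Q.x t‖ ^ 2 + ‖Q.μ (t + 1) m - Q.μ t m‖ ^ 2
      + q ^ 2 := by simp [stepSq, hq]
  have e4 := congrArg (lam m * ·) e1
  simp only [conj_trivial] at h2 e4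
  unfold potential
  rw [e3]
  simp only [Nat.add_sub_cancel]
  have d1 : ∀ u v w : ℝ, (u - v - w) / (2 * p.γ) = u / (2 * p.γ) - v / (2 * p.γ) - w / (2 * p.γ) :=
    fun u v w => by ring
  rw [d1] at hμs h2
  simp only [add_div]
  linarith

end InnerTrace.IsRun

/-! ### Averages, and convexity of the inner objective -/

section Average

theorem sum_Icc_one_eq_sum_range {E : Type*} [AddCommMonoid E] (f : ℕ → E) (T : ℕ) :
    ∑ t ∈ Finset.Icc 1 T, f t = ∑ t ∈ Finset.range T, f (t + 1) := by
  rw [Finset.range_eq_Ico, Finset.sum_Ico_add' f 0 T 1]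
  rfl

variable {E : Type*} [AddCommGroup E] [Module ℝ E] {S : Set E} {T : ℕ} {u : ℕ → E}

theorem sum_weights_eq_one (hT : 1 ≤ T) : ∑ _t ∈ Finset.Icc 1 T, 1 / (T : ℝ) = 1 := by
  have : (T : ℝ) ≠ 0 := by positivity
  simp [this]

theorem _root_.Convex.average_Icc_mem (hS : Convex ℝ S) (hT : 1 ≤ T)
    (hu : ∀ t ∈ Finset.Icc 1 T, u t ∈ S) : (1 / (T : ℝ)) • ∑ t ∈ Finset.Icc 1 T, u t ∈ S := by
  rw [Finset.smul_sum]
  exact hS.sum_mem (fun _ _ => by positivity) (sum_weights_eq_one hT) hu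

theorem _root_.ConvexOn.map_average_Icc_le {f : E → ℝ} (hf : ConvexOn ℝ S f) (hT : 1 ≤ T)
    (hu : ∀ t ∈ Finset.Icc 1 T, u t ∈ S) :
    f ((1 / (T : ℝ)) • ∑ t ∈ Finset.Icc 1 T, u t)
      ≤ 1 / (T : ℝ) * ∑ t ∈ Finset.Icc 1 T, f (u t) := by
  rw [Finset.smul_sum, Finset.mul_sum]
  exact hf.map_sum_le (fun _ _ => by positivity) (sum_weights_eq_one hT) hu

theorem _root_.ConcaveOn.average_Icc_le_map {f : E → ℝ} (hf : ConcaveOn ℝ S f) (hT : 1 ≤ T)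
    (hu : ∀ t ∈ Finset.Icc 1 T, u t ∈ S) :
    1 / (T : ℝ) * ∑ t ∈ Finset.Icc 1 T, f (u t)
      ≤ f ((1 / (T : ℝ)) • ∑ t ∈ Finset.Icc 1 T, u t) := by
  rw [Finset.smul_sum, Finset.mul_sum]
  exact hf.le_map_sum (fun _ _ => by positivity) (sum_weights_eq_one hT) hu

theorem convexOn_finset_sum {ι : Type*} (s : Finset ι) {f : ι → E → ℝ} (hS : Convex ℝ S)
    (hf : ∀ i ∈ s, ConvexOn ℝ S (f i)) : ConvexOn ℝ S fun x => ∑ i ∈ s, f i x := by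
  classical
  induction s using Finset.induction_on with
  | empty => simpa using convexOn_const (0 : ℝ) hS
  | insert i s hi ih =>
    simp only [Finset.sum_insert hi]
    exact (hf i (Finset.mem_insert_self i s)).add
      (ih fun j hj => hf j (Finset.mem_insert_of_mem hj))

end Average

theorem convexOn_norm_sub_sq {V : Type*} [NormedAddCommGroup V] [NormedSpace ℝ V] (c : V) :
    ConvexOn ℝ Set.univ fun x : V => ‖x - c‖ ^ 2 := by
  have h := (convexOn_dist c (convex_univ (𝕜 := ℝ) (E := V))).pow (fun _ _ => dist_nonneg) 2
  simpa only [dist_eq_norm] using! h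

/-- For fixed z there is no coupling of x and μ: a convex function of x plus a linear function of μ.
This makes the lifted problem convex. -/
theorem Problem.Regular.convexOn_gpen (hP : P.Regular) {m : Fin M} {z : Vec (J m)}
    (hz : z ∈ P.Zt m) :
    ConvexOn ℝ (P.X ×ˢ (Set.univ : Set (Vec (I m)))) fun w => P.gpen m w.1 w.2 z := by
  have h1 := (hP.g_convex m z hz).convexOn hP.X_convex fun x hx => hP.g_finite m x hx z hz
  refine ⟨hP.X_convex.prod convex_univ, fun w hw w' hw' s t hs ht hst => ?_⟩
  have h2 := h1.2 hw.1 hw'.1 hs ht hst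
  simp only [smul_eq_mul] at h2
  simp only [Problem.gpen, Prod.fst_add, Prod.smul_fst, Prod.snd_add, Prod.smul_snd,
    PiLp.add_apply, PiLp.smul_apply, smul_eq_mul, add_mul, Finset.sum_add_distrib, mul_sub,
    Finset.mul_sum, mul_assoc]
  linarith

theorem Problem.Regular.concaveOn_gpen (hP : P.Regular) {m : Fin M} {x : Vec N} (hx : x ∈ P.X)
    {μ : Vec (I m)} (hμ : ∀ i, 0 ≤ μ i) : ConcaveOn ℝ (P.Zt m) (P.gpen m x μ) := by
  have h1 := (hP.g_concave m x hx).convexOn (hP.Zt_convex m)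
    fun z hz => (hP.g_finite m x hx z hz).neg
  have h2 : ConvexOn ℝ (P.Zt m) fun z => ∑ i, μ i * (P.h m i z).toReal :=
    convexOn_finset_sum _ (hP.Zt_convex m) fun i _ =>
      ((hP.h_convex m i).convexOn (hP.Zt_convex m) fun z hz => hP.h_finite m i z hz).smul (hμ i)
  simp only [EReal.toReal_neg_eq] at h1
  rw [← neg_convexOn_iff]
  refine (h1.add h2).congr fun z _ => ?_
  simp only [Problem.gpen, Pi.neg_apply, Pi.add_apply]
  ring

theorem Problem.Regular.convexOn_innerObj (hP : P.Regular) {α : ℝ} (hα : 0 < α) (xc : Vec N)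
    (μc : (m : Fin M) → Vec (I m)) {lam : Fin M → ℝ} (hlam : ∀ m, 0 ≤ lam m)
    {z : (m : Fin M) → Vec (J m)} (hz : ∀ m, z m ∈ P.Zt m) :
    ConvexOn ℝ (P.X ×ˢ (Set.univ : Set ((m : Fin M) → Vec (I m))))
      fun w => P.innerObj α xc μc lam w.1 w.2 z := by
  have hS : Convex ℝ (P.X ×ˢ (Set.univ : Set ((m : Fin M) → Vec (I m)))) :=
    hP.X_convex.prod convex_univ
  have h1 := (((hP.f0_convex.convexOn hP.X_convex hP.f0_finite).comp_linearMap
    (LinearMap.fst ℝ (Vec N) ((m : Fin M) → Vec (I m)))).subset (fun w hw => hw.1) hS)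
  have h2 : ConvexOn ℝ (P.X ×ˢ (Set.univ : Set ((m : Fin M) → Vec (I m))))
      fun w => ∑ m, lam m * P.gpen m w.1 (w.2 m) (z m) :=
    convexOn_finset_sum _ hS fun m _ =>
      (((hP.convexOn_gpen (hz m)).comp_linearMap
        ((LinearMap.fst ℝ (Vec N) ((m : Fin M) → Vec (I m))).prod
          ((LinearMap.proj m).comp (LinearMap.snd ℝ (Vec N) ((m : Fin M) → Vec (I m)))))).subset
        (fun w hw => ⟨hw.1, trivial⟩) hS).smul (hlam m)
  have h3 := (((convexOn_norm_sub_sq xc).comp_linearMap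
    (LinearMap.fst ℝ (Vec N) ((m : Fin M) → Vec (I m)))).subset (fun w _ => trivial) hS).smul
      (show 0 ≤ 1 / (2 * α) by positivity)
  have h4 : ConvexOn ℝ (P.X ×ˢ (Set.univ : Set ((m : Fin M) → Vec (I m))))
      fun w => ∑ m, ‖w.2 m - μc m‖ ^ 2 :=
    convexOn_finset_sum _ hS fun m _ =>
      ((convexOn_norm_sub_sq (μc m)).comp_linearMap
        ((LinearMap.proj m).comp (LinearMap.snd ℝ (Vec N) ((m : Fin M) → Vec (I m))))).subset
        (fun w _ => trivial) hS
  exact ((h1.add h2).add h3).add (h4.smul (show 0 ≤ 1 / (2 * α) by positivity))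

theorem Problem.Regular.concaveOn_innerObj (hP : P.Regular) (α : ℝ) (xc : Vec N)
    (μc : (m : Fin M) → Vec (I m)) {lam : Fin M → ℝ} (hlam : ∀ m, 0 ≤ lam m) {x : Vec N}
    (hx : x ∈ P.X) {μ : (m : Fin M) → Vec (I m)} (hμ : ∀ m i, 0 ≤ μ m i) :
    ConcaveOn ℝ {z : (m : Fin M) → Vec (J m) | ∀ m, z m ∈ P.Zt m}
      fun z => P.innerObj α xc μc lam x μ z := by
  have hS : Convex ℝ {z : (m : Fin M) → Vec (J m) | ∀ m, z m ∈ P.Zt m} :=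
    fun z hz z' hz' s t hs ht hst m => hP.Zt_convex m (hz m) (hz' m) hs ht hst
  have h1 : ConvexOn ℝ {z : (m : Fin M) → Vec (J m) | ∀ m, z m ∈ P.Zt m}
      fun z => ∑ m, lam m * -P.gpen m x (μ m) (z m) :=
    convexOn_finset_sum _ hS fun m _ =>
      (((hP.concaveOn_gpen hx (hμ m)).neg.comp_linearMap
        (LinearMap.proj (R := ℝ) (φ := fun m => Vec (J m)) m)).subset (fun z (hz : ∀ m, z m ∈ P.Zt m) => hz m) hS).smul
          (hlam m)
  rw [← neg_convexOn_iff]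
  refine (h1.add_const (-((P.f0 x).toReal + 1 / (2 * α) * ‖x - xc‖ ^ 2
    + 1 / (2 * α) * ∑ m, ‖μ m - μc m‖ ^ 2))).congr fun z _ => ?_
  simp only [Problem.innerObj, Pi.neg_apply, mul_neg, Finset.sum_neg_distrib, Pi.add_apply]
  ring

/-! ### Convergence of the inner algorithm -/

namespace InnerTrace.IsRun

variable {Q : InnerTrace M N J I} {a : Fin M → ℝ} {p : Params} {xc : Vec N}
  {μc : (m : Fin M) → Vec (I m)} {lam : Fin M → ℝ}

theorem xout_mem (h : Q.IsRun P a p xc μc lam) (hP : P.Regular) : Q.xout p.T ∈ P.X :=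
  hP.X_convex.average_Icc_mem p.one_le_T fun _ ht => h.x_mem (Finset.mem_Icc.1 ht).2

theorem μout_mem (h : Q.IsRun P a p xc μc lam) (m : Fin M) : Q.μout p.T m ∈ box (I m) (a m) :=
  (convex_box _ _).average_Icc_mem p.one_le_T fun _ ht => h.μ_mem (Finset.mem_Icc.1 ht).2 m

theorem zout_mem (h : Q.IsRun P a p xc μc lam) (hP : P.Regular) (m : Fin M) :
    Q.zout p.T m ∈ P.Zt m :=
  (hP.Zt_convex m).average_Icc_mem p.one_le_T fun _ ht => h.z_mem (Finset.mem_Icc.1 ht).2 m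

/-- Averaging the gaps of the inner iterations gives a strong approximate saddle point. -/
theorem isStrongSaddle_of_sum_le (h : Q.IsRun P a p xc μc lam) (hP : P.Regular)
    (hlam : ∀ m, 0 ≤ lam m) {ν : ℝ}
    (hν : ∀ x ∈ P.X, ∀ μ : (m : Fin M) → Vec (I m), (∀ m, μ m ∈ box (I m) (a m)) →
      ∀ z : (m : Fin M) → Vec (J m), (∀ m, z m ∈ P.Zt m) →
      ∑ t ∈ Finset.range p.T, (P.innerObj p.α xc μc lam (Q.x (t + 1)) (Q.μ (t + 1)) z
        - P.innerObj p.α xc μc lam x μ (Q.z (t + 1))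
        + 1 / p.α / 2 * (‖x - Q.x (t + 1)‖ ^ 2 + ∑ m, ‖μ m - Q.μ (t + 1) m‖ ^ 2)) ≤ p.T * ν) :
    P.IsStrongSaddle a p.α ν xc μc lam (Q.xout p.T) (Q.μout p.T) (Q.zout p.T) := by
  refine ⟨h.xout_mem hP, h.μout_mem, h.zout_mem hP, fun x hx μ hμ z hz => ?_⟩
  have hα := p.α_pos
  have hT : (0 : ℝ) < p.T := by have := p.one_le_T; positivity
  have h0 := hν x hx μ hμ z hz
  rw [← sum_Icc_one_eq_sum_range (fun t => P.innerObj p.α xc μc lam (Q.x t) (Q.μ t) z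
        - P.innerObj p.α xc μc lam x μ (Q.z t)
        + 1 / p.α / 2 * (‖x - Q.x t‖ ^ 2 + ∑ m, ‖μ m - Q.μ t m‖ ^ 2)), Finset.sum_add_distrib,
    Finset.sum_sub_distrib, ← Finset.mul_sum, Finset.sum_add_distrib] at h0
  have h1 := (hP.convexOn_innerObj hα xc μc hlam hz).map_average_Icc_le p.one_le_T
    (u := fun t => (Q.x t, Q.μ t)) fun t ht => ⟨h.x_mem (Finset.mem_Icc.1 ht).2, trivial⟩
  have h2 := (hP.concaveOn_innerObj p.α xc μc hlam hx (μ := μ) fun m i => (hμ m i).1).average_Icc_le_map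
    p.one_le_T (u := fun t => Q.z t) fun t ht => h.z_mem (Finset.mem_Icc.1 ht).2
  have h3 := (convexOn_norm_sub_sq x).map_average_Icc_le p.one_le_T (u := fun t => Q.x t)
    fun _ _ => trivial
  have h4 := fun m => (convexOn_norm_sub_sq (μ m)).map_average_Icc_le p.one_le_T
    (u := fun t => Q.μ t m) fun _ _ => trivial
  have e1 : (1 / (p.T : ℝ)) • ∑ t ∈ Finset.Icc 1 p.T, (Q.x t, Q.μ t)
      = (Q.xout p.T, Q.μout p.T) := by
    ext m
    · simp [xout, Prod.fst_sum]
    · simp [μout, Prod.snd_sum, Finset.sum_apply]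
  have e2 : (1 / (p.T : ℝ)) • ∑ t ∈ Finset.Icc 1 p.T, Q.z t = Q.zout p.T := by
    ext m
    simp [zout, Finset.sum_apply]
  rw [e1] at h1
  rw [e2] at h2
  -- Squared distances are convex, so averaging the iterates only decreases them and the
  -- strong-convexity term survives on the correct side.
  have h5 : ∑ m, ‖μ m - Q.μout p.T m‖ ^ 2
      ≤ 1 / (p.T : ℝ) * ∑ t ∈ Finset.Icc 1 p.T, ∑ m, ‖μ m - Q.μ t m‖ ^ 2 := by
    rw [Finset.sum_comm, Finset.mul_sum]
    refine Finset.sum_le_sum fun m _ => ?_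
    rw [norm_sub_rev]
    simp only [norm_sub_rev (μ m)]
    exact h4 m
  have h6 : ‖x - Q.xout p.T‖ ^ 2 ≤ 1 / (p.T : ℝ) * ∑ t ∈ Finset.Icc 1 p.T, ‖x - Q.x t‖ ^ 2 := by
    rw [norm_sub_rev]
    simp only [norm_sub_rev x]
    exact h3
  have h7 := mul_le_mul_of_nonneg_left (add_le_add h6 h5) (show 0 ≤ 1 / p.α / 2 by positivity)
  have h8 := mul_le_mul_of_nonneg_left h0 (show 0 ≤ 1 / (p.T : ℝ) by positivity)
  have e3 : 1 / (p.T : ℝ) * (p.T * ν) = ν := by field_simp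
  rw [e3] at h8
  simp only at h1 h2
  linarith

/-- Decrease of the Lyapunov function in one inner iteration. -/
theorem gap_le {A L D A₁ L₁ Λ : ℝ} (h : Q.IsRun P a p xc μc lam) (hP : P.Regular)
    (hB : SubgradientBounds P A L D) (hA₁ : 0 ≤ A₁) (hL₁ : 0 ≤ L₁)
    (hlam : ∀ m, 0 ≤ lam m ∧ lam m ≤ Λ) (hγδ : p.γ = p.δ) (hγ : p.γ * (Λ * L₁) ≤ 1 / 12)
    (hγ' : p.γ * (M * (Λ * L₁) + (1 + M * Λ) * L) ≤ 1 / 4)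
    {σ : ℕ → (m : Fin M) → Vec (J m)}
    (hσ : ∀ t ≤ p.T, ∀ m, σ t m ∈ penSubdiff P m (Q.x t) (Q.μ t m) (Q.z t m))
    (hσz : ∀ t < p.T, ∀ m, IsProj (P.Zt m)
        (Q.z t m - p.δ • (lam m • ((2 : ℝ) • σ t m - σ (t - 1) m))) (Q.z (t + 1) m))
    (hσd : ∀ t ≤ p.T, ∀ m, ‖σ t m - σ (t - 1) m‖ ≤ A₁ + L₁ * (‖Q.x t - Q.x (t - 1)‖
        + ‖Q.μ t m - Q.μ (t - 1) m‖ + ‖Q.z t m - Q.z (t - 1) m‖))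
    {t : ℕ} (ht : t < p.T) {x : Vec N} (hx : x ∈ P.X) {μ : (m : Fin M) → Vec (I m)}
    (hμ : ∀ m, μ m ∈ box (I m) (a m)) {z : (m : Fin M) → Vec (J m)} (hz : ∀ m, z m ∈ P.Zt m) :
    P.innerObj p.α xc μc lam (Q.x (t + 1)) (Q.μ (t + 1)) z
        - P.innerObj p.α xc μc lam x μ (Q.z (t + 1))
        + 1 / p.α / 2 * (‖x - Q.x (t + 1)‖ ^ 2 + ∑ m, ‖μ m - Q.μ (t + 1) m‖ ^ 2)
    ≤ (‖x - Q.x t‖ ^ 2 / (2 * p.γ)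
        + ∑ m, potential Q p.γ (Λ * L₁) (lam m) m (μ m) (z m) (fun t => σ t m) t)
      - (‖x - Q.x (t + 1)‖ ^ 2 / (2 * p.γ)
        + ∑ m, potential Q p.γ (Λ * L₁) (lam m) m (μ m) (z m) (fun t => σ t m) (t + 1))
      + p.γ * (2 * M * (Λ * A₁) ^ 2 + 2 * ((1 + M * Λ) * A) ^ 2) := by
  have hγ0 := p.γ_pos
  have h1 := h.x_step_le hP hB hlam ht hx
  have h2 := Finset.sum_le_sum fun m (_ : m ∈ Finset.univ) =>
    h.z_step_le hP hA₁ hL₁ hlam hγδ hγ (fun t ht => hσ t ht m) (fun t ht => hσz t ht m)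
      (fun t ht => hσd t ht m) ht (hμ m) (hz m)
  simp only [Finset.sum_sub_distrib, Finset.sum_add_distrib, Finset.sum_const, Finset.card_univ,
    Fintype.card_fin, nsmul_eq_mul, mul_sub, ← Finset.mul_sum, mul_add] at h2
  set q := ‖Q.x (t + 1) - Q.x t‖ with hq
  -- The negative term -q²/(2γ) of the single x-step absorbs the subgradient error and the `M`
  -- leftovers of `z_step_le`; only the jump part leaves noise of order γ.
  have h3 : (1 + M * Λ) * (A + L * q) * q + M * (Λ * L₁ * q ^ 2)
      ≤ q ^ 2 / (2 * p.γ) + p.γ * (2 * ((1 + M * Λ) * A) ^ 2) := by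
    have h4 : (1 + M * Λ) * A * q ≤ q ^ 2 / (8 * p.γ) + 2 * p.γ * ((1 + M * Λ) * A) ^ 2 := by
      rw [div_add' _ _ _ (by positivity), le_div_iff₀ (by positivity)]
      nlinarith [sq_nonneg (q - 4 * p.γ * ((1 + M * Λ) * A))]
    have h5 : M * (Λ * L₁) + (1 + M * Λ) * L ≤ 1 / (4 * p.γ) := by
      rw [le_div_iff₀ (by positivity)]; linarith
    have h6 := mul_le_mul_of_nonneg_right h5 (sq_nonneg q)
    have e1 : q ^ 2 / (8 * p.γ) = 1 / 2 * (1 / (4 * p.γ) * q ^ 2) := by field_simp; ring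
    have e2 : q ^ 2 / (2 * p.γ) = 2 * (1 / (4 * p.γ) * q ^ 2) := by field_simp; ring
    have : 0 ≤ 1 / (4 * p.γ) * q ^ 2 := by positivity
    linarith
  simp only [Problem.innerObj]
  have e5 : ∑ m, lam m * P.gpen m x (μ m) (Q.z (t + 1) m)
      = ∑ m, lam m * (P.g m x (Q.z (t + 1) m)).toReal
        - ∑ m, lam m * ∑ i, μ m i * (P.h m i (Q.z (t + 1) m)).toReal := by
    rw [← Finset.sum_sub_distrib]
    exact Finset.sum_congr rfl fun m _ => by rw [Problem.gpen, mul_sub]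
  have e6 : ∑ m, lam m * P.gpen m (Q.x (t + 1)) (Q.μ (t + 1) m) (Q.z (t + 1) m)
      = ∑ m, lam m * (P.g m (Q.x (t + 1)) (Q.z (t + 1) m)).toReal
        - ∑ m, lam m * ∑ i, Q.μ (t + 1) m i * (P.h m i (Q.z (t + 1) m)).toReal := by
    rw [← Finset.sum_sub_distrib]
    exact Finset.sum_congr rfl fun m _ => by rw [Problem.gpen, mul_sub]
  rw [e5]
  rw [e6] at h2
  have d1 : ∀ u v w : ℝ, (u - v - w) / (2 * p.γ) = u / (2 * p.γ) - v / (2 * p.γ) - w / (2 * p.γ) :=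
    fun u v w => by ring
  rw [d1] at h1
  have e7 : ∀ u, 1 / p.α / 2 * u = 1 / (2 * p.α) * u := fun u => by field_simp
  rw [e7]
  linarith

end InnerTrace.IsRun

/-- The domain, the uncertainty sets and the multiplier boxes have diameter at most `R`. -/
structure DiameterLE (P : Problem M N J I) (a : Fin M → ℝ) (R : ℝ) : Prop where
  nonneg : 0 ≤ R
  x_le : ∀ x ∈ P.X, ∀ x' ∈ P.X, ‖x - x'‖ ≤ R
  μ_le : ∀ m, ∀ μ ∈ box (I m) (a m), ∀ μ' ∈ box (I m) (a m), ‖μ - μ'‖ ≤ R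
  z_le : ∀ m, ∀ z ∈ P.Zt m, ∀ z' ∈ P.Zt m, ‖z - z'‖ ≤ R

theorem _root_.IsCompact.exists_norm_sub_le {V : Type*} [NormedAddCommGroup V] {S : Set V}
    (hS : IsCompact S) : ∃ R : ℝ, 0 ≤ R ∧ ∀ x ∈ S, ∀ x' ∈ S, ‖x - x'‖ ≤ R :=
  ⟨Metric.diam S, Metric.diam_nonneg, fun x hx x' hx' => by
    rw [← dist_eq_norm]; exact Metric.dist_le_diam_of_mem hS.isBounded hx hx'⟩

theorem Problem.Regular.exists_diameterLE (hP : P.Regular) (a : Fin M → ℝ) :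
    ∃ R, DiameterLE P a R := by
  obtain ⟨R0, hR0, h0⟩ := hP.X_compact.exists_norm_sub_le
  choose R1 hR1 h1 using fun m => (isCompact_box (I m) (a m)).exists_norm_sub_le
  choose R2 hR2 h2 using fun m => (hP.Zt_compact m).exists_norm_sub_le
  have hle : ∀ m, R1 m + R2 m ≤ ∑ m, (R1 m + R2 m) := fun m =>
    Finset.single_le_sum (f := fun m => R1 m + R2 m)
      (fun m _ => add_nonneg (hR1 m) (hR2 m)) (Finset.mem_univ m)
  have hs : 0 ≤ ∑ m, (R1 m + R2 m) := Finset.sum_nonneg fun m _ => add_nonneg (hR1 m) (hR2 m)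
  refine ⟨R0 + ∑ m, (R1 m + R2 m), by positivity, fun x hx x' hx' => ?_,
    fun m x hx x' hx' => ?_, fun m x hx x' hx' => ?_⟩
  · linarith [h0 x hx x' hx']
  · linarith [h1 m x hx x' hx', hle m, hR2 m]
  · linarith [h2 m x hx x' hx', hle m, hR1 m]

theorem InnerTrace.IsRun.isStrongSaddle {Q : InnerTrace M N J I} {a : Fin M → ℝ} {p : Params}
    {xc : Vec N} {μc : (m : Fin M) → Vec (I m)} {lam : Fin M → ℝ} {A L D A₁ L₁ Λ R ν : ℝ}
    (h : Q.IsRun P a p xc μc lam) (hP : P.Regular)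
    (hB : SubgradientBounds P A L D) (hR : DiameterLE P a R) (hA₁ : 0 ≤ A₁) (hL₁ : 0 ≤ L₁)
    (hΛ : 0 ≤ Λ) (hlam : ∀ m, 0 ≤ lam m ∧ lam m ≤ Λ) (hγδ : p.γ = p.δ)
    (hγ : p.γ * (Λ * L₁) ≤ 1 / 12) (hγ' : p.γ * (M * (Λ * L₁) + (1 + M * Λ) * L) ≤ 1 / 4)
    (hpen : ∀ m, ∀ x ∈ P.X, ∀ x' ∈ P.X, ∀ μ ∈ box (I m) (a m), ∀ μ' ∈ box (I m) (a m),
      ∀ z ∈ P.Zt m, ∀ z' ∈ P.Zt m, ∀ σ ∈ penSubdiff P m x μ z, ∀ σ' ∈ penSubdiff P m x' μ' z',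
        ‖σ - σ'‖ ≤ A₁ + L₁ * (‖x - x'‖ + ‖μ - μ'‖ + ‖z - z'‖))
    (hν : (1 + 2 * M) * R ^ 2 / (2 * p.γ) + p.T * (p.γ * (2 * M * (Λ * A₁) ^ 2
      + 2 * ((1 + M * Λ) * A) ^ 2)) + M * (Λ * A₁ * R + Λ * L₁ * R ^ 2) ≤ p.T * ν) :
    P.IsStrongSaddle a p.α ν xc μc lam (Q.xout p.T) (Q.μout p.T) (Q.zout p.T) := by
  refine h.isStrongSaddle_of_sum_le hP (fun m => (hlam m).1) fun x hx μ hμ z hz => ?_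
  obtain ⟨σ, hσ, hσz⟩ := h.exists_penSubdiff hB
  have hγ0 := p.γ_pos
  have hR0 := hR.nonneg
  have hσd : ∀ t ≤ p.T, ∀ m, ‖σ t m - σ (t - 1) m‖ ≤ A₁ + L₁ * (‖Q.x t - Q.x (t - 1)‖
        + ‖Q.μ t m - Q.μ (t - 1) m‖ + ‖Q.z t m - Q.z (t - 1) m‖) := fun t ht m => by
    have ht' : t - 1 ≤ p.T := by omega
    exact hpen m _ (h.x_mem ht) _ (h.x_mem ht') _ (h.μ_mem ht m) _ (h.μ_mem ht' m) _
      (h.z_mem ht m) _ (h.z_mem ht' m) _ (hσ t ht m) _ (hσ _ ht' m)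
  set B := p.γ * (2 * M * (Λ * A₁) ^ 2 + 2 * ((1 + M * Λ) * A) ^ 2) with hBdef
  set Φ : ℕ → ℝ := fun t => ‖x - Q.x t‖ ^ 2 / (2 * p.γ)
    + ∑ m, potential Q p.γ (Λ * L₁) (lam m) m (μ m) (z m) (fun t => σ t m) t with hΦ
  have hsum := Finset.sum_le_sum fun t (ht : t ∈ Finset.range p.T) =>
    h.gap_le hP hB hA₁ hL₁ hlam hγδ hγ hγ' hσ hσz hσd (Finset.mem_range.1 ht) hx hμ hz
  refine hsum.trans ?_
  have e : ∑ t ∈ Finset.range p.T, (Φ t - Φ (t + 1) + B) = Φ 0 - Φ p.T + p.T * B := by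
    rw [Finset.sum_add_distrib, Finset.sum_range_sub']
    simp
  refine e.le.trans ?_
  -- Index t - 1 is 0 at t = 0, so the cross term and the step term of the potential vanish.
  have h0 : Φ 0 ≤ (1 + 2 * M) * R ^ 2 / (2 * p.γ) := by
    have h1 : ∀ m, potential Q p.γ (Λ * L₁) (lam m) m (μ m) (z m) (fun t => σ t m) 0
        ≤ 2 * R ^ 2 / (2 * p.γ) := fun m => by
      have h2 := hR.μ_le m _ (hμ m) _ (h.μ_init m)
      have h3 := hR.z_le m _ (hz m) _ (h.z_init m)
      simp only [potential, stepSq, Nat.zero_sub, sub_self, inner_zero_left, norm_zero]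
      norm_num
      rw [two_mul (R ^ 2)]
      gcongr
    have h2 := Finset.sum_le_sum fun m (_ : m ∈ Finset.univ) => h1 m
    have h3 : ‖x - Q.x 0‖ ^ 2 / (2 * p.γ) ≤ R ^ 2 / (2 * p.γ) := by
      have := hR.x_le _ hx _ h.x_init
      gcongr
    rw [Finset.sum_const, Finset.card_univ, Fintype.card_fin, nsmul_eq_mul] at h2
    have e : (1 + 2 * M) * R ^ 2 / (2 * p.γ)
      = R ^ 2 / (2 * p.γ) + M * (2 * R ^ 2 / (2 * p.γ)) := by ring
    rw [e]
    exact add_le_add h3 h2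
  -- The final cross term has no sign. Its Lipschitz part is absorbed, up to R², by the step term of
  -- the potential.
  have hT : -Φ p.T ≤ M * (Λ * A₁ * R + Λ * L₁ * R ^ 2) := by
    have h1 : ∀ m, -(Λ * A₁ * R + Λ * L₁ * R ^ 2)
        ≤ potential Q p.γ (Λ * L₁) (lam m) m (μ m) (z m) (fun t => σ t m) p.T := fun m => by
      have h2 : lam m * inner ℝ (σ p.T m - σ (p.T - 1) m) (Q.z p.T m - z m)
          ≤ Λ * (‖σ p.T m - σ (p.T - 1) m‖ * ‖Q.z p.T m - z m‖) :=
        (mul_le_mul_of_nonneg_left (real_inner_le_norm _ _) (hlam m).1).trans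
          (mul_le_mul_of_nonneg_right (hlam m).2 (by positivity))
      have h3 : ‖σ p.T m - σ (p.T - 1) m‖ * ‖Q.z p.T m - z m‖
          ≤ (A₁ + L₁ * (‖Q.x p.T - Q.x (p.T - 1)‖ + ‖Q.μ p.T m - Q.μ (p.T - 1) m‖
            + ‖Q.z p.T m - Q.z (p.T - 1) m‖)) * R :=
        mul_le_mul (hσd _ le_rfl m) (hR.z_le m _ (h.z_mem le_rfl m) _ (hz m)) (norm_nonneg _)
          (by positivity)
      have h4 : (‖Q.x p.T - Q.x (p.T - 1)‖ + ‖Q.μ p.T m - Q.μ (p.T - 1) m‖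
            + ‖Q.z p.T m - Q.z (p.T - 1) m‖) * R ≤ stepSq Q m p.T + R ^ 2 := by
        unfold stepSq
        nlinarith [sq_nonneg (‖Q.x p.T - Q.x (p.T - 1)‖ - R / 2),
          sq_nonneg (‖Q.μ p.T m - Q.μ (p.T - 1) m‖ - R / 2),
          sq_nonneg (‖Q.z p.T m - Q.z (p.T - 1) m‖ - R / 2)]
      have h5 := mul_le_mul_of_nonneg_left h4 (mul_nonneg hΛ hL₁)
      have h6 := mul_le_mul_of_nonneg_left h3 hΛ
      have h7 : 0 ≤ (‖μ m - Q.μ p.T m‖ ^ 2 + ‖z m - Q.z p.T m‖ ^ 2) / (2 * p.γ) := by positivity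
      unfold potential
      linarith
    have h2 := Finset.sum_le_sum fun m (_ : m ∈ Finset.univ) => h1 m
    have h3 : 0 ≤ ‖x - Q.x p.T‖ ^ 2 / (2 * p.γ) := by positivity
    rw [Finset.sum_const, Finset.card_univ, Fintype.card_fin, nsmul_eq_mul] at h2
    simp only [hΦ]
    linarith
  linarith

theorem SubgradientBounds.exists_penSubdiff_bound {A L D : ℝ} (hB : SubgradientBounds P A L D)
    {a : Fin M → ℝ} (ha : ∀ m, 0 ≤ a m) :
    ∃ A₁ L₁ : ℝ, 0 ≤ A₁ ∧ 0 ≤ L₁ ∧ (A = 0 → A₁ = 0) ∧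
      ∀ m, ∀ x ∈ P.X, ∀ x' ∈ P.X, ∀ μ ∈ box (I m) (a m), ∀ μ' ∈ box (I m) (a m),
      ∀ z ∈ P.Zt m, ∀ z' ∈ P.Zt m, ∀ σ ∈ penSubdiff P m x μ z, ∀ σ' ∈ penSubdiff P m x' μ' z',
        ‖σ - σ'‖ ≤ A₁ + L₁ * (‖x - x'‖ + ‖μ - μ'‖ + ‖z - z'‖) := by
  have hA := hB.A_nonneg
  have hL := hB.L_nonneg
  have hD := hB.D_nonneg
  have h1 : ∀ m, (I m : ℝ) * a m ≤ ∑ m, (I m : ℝ) * a m := fun m =>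
    Finset.single_le_sum (f := fun m => (I m : ℝ) * a m)
      (fun m _ => mul_nonneg (Nat.cast_nonneg _) (ha m)) (Finset.mem_univ m)
  have h2 : ∀ m, (I m : ℝ) ≤ ∑ m, (I m : ℝ) := fun m =>
    Finset.single_le_sum (f := fun m => (I m : ℝ)) (fun m _ => Nat.cast_nonneg _)
      (Finset.mem_univ m)
  have h3 : 0 ≤ ∑ m, (I m : ℝ) * a m :=
    Finset.sum_nonneg fun m _ => mul_nonneg (Nat.cast_nonneg _) (ha m)
  refine ⟨(1 + ∑ m, (I m : ℝ) * a m) * A,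
    (1 + ∑ m, (I m : ℝ) * a m) * L + (∑ m, (I m : ℝ)) * D, by positivity, by positivity,
    fun h => by rw [h, mul_zero], ?_⟩
  intro m x hx x' hx' μ hμ μ' hμ' z hz z' hz' σ hσ σ' hσ'
  refine (hB.penSubdiff_sub_le (ha m) hx hx' hμ hz hz' hσ hσ').trans ?_
  have h4 := h1 m
  have h5 := h2 m
  gcongr

/-- Step sizes and iteration numbers for which every run of the inner algorithm with multipliers
in `[0, Λ]` returns a strong `1 / n`-approximate saddle point. -/
theorem SubgradientBounds.exists_inner_params {A L D : ℝ} (hB : SubgradientBounds P A L D)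
    (hP : P.Regular) {a : Fin M → ℝ} (ha : ∀ m, 0 ≤ a m) {Λ : ℝ} (hΛ : 0 ≤ Λ) :
    ∃ c : ℕ, 1 ≤ c ∧ ∃ c₀ : ℝ, 0 < c₀ ∧ ∀ n s : ℕ, 1 ≤ n → 1 ≤ s → (n ≤ s ∨ A = 0) →
      ∀ p : Params, p.T = c * (n * s) → p.γ = c₀ / s → p.δ = c₀ / s →
      ∀ (Q : InnerTrace M N J I) (xc : Vec N) (μc : (m : Fin M) → Vec (I m)) (lam : Fin M → ℝ),
      (∀ m, 0 ≤ lam m ∧ lam m ≤ Λ) → Q.IsRun P a p xc μc lam →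
      P.IsStrongSaddle a p.α (1 / n) xc μc lam (Q.xout p.T) (Q.μout p.T) (Q.zout p.T) := by
  obtain ⟨R, hR⟩ := hP.exists_diameterLE a
  obtain ⟨A₁, L₁, hA₁, hL₁, hA, hpen⟩ := hB.exists_penSubdiff_bound ha
  have hL := hB.L_nonneg
  have hR0 := hR.nonneg
  set B := 2 * M * (Λ * A₁) ^ 2 + 2 * ((1 + M * Λ) * A) ^ 2 with hBdef
  have hB0 : 0 ≤ B := by positivity
  -- Times `c₀`, each non-negative summand in the parenthesis is at most 1/12: this gives both
  -- step-size conditions and a small noise term.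
  set c₀ := 1 / (12 * (1 + Λ * L₁ + (M * (Λ * L₁) + (1 + M * Λ) * L) + B)) with hc₀
  have hc₀pos : 0 < c₀ := by positivity
  have hc₀mul : c₀ * (1 + Λ * L₁ + (M * (Λ * L₁) + (1 + M * Λ) * L) + B) = 1 / 12 := by
    rw [hc₀]; field_simp
  have q1 : 0 ≤ c₀ * (Λ * L₁) := by positivity
  have q2 : 0 ≤ c₀ * (M * (Λ * L₁) + (1 + M * Λ) * L) := by positivity
  have q3 : 0 ≤ c₀ * B := by positivity
  set E := (1 + 2 * M) * R ^ 2 / (2 * c₀) + M * (Λ * A₁ * R + Λ * L₁ * R ^ 2) with hE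
  obtain ⟨c, hc⟩ := exists_nat_ge (2 * E)
  -- The target is T/n = (c + 1)s. Boundary terms of the potential cost at most E s ≤ (c/2)s, and
  -- noise at most (c + 1)s/2.
  refine ⟨c + 1, by omega, c₀, hc₀pos, fun n s hn hs hns p hT hγ hδ Q xc μc lam hlam hrun => ?_⟩
  have hn' : (1 : ℝ) ≤ n := by exact_mod_cast hn
  have hs' : (1 : ℝ) ≤ s := by exact_mod_cast hs
  have hγle : p.γ ≤ c₀ := by
    rw [hγ]; exact div_le_self hc₀pos.le hs'
  refine hrun.isStrongSaddle hP hB hR hA₁ hL₁ hΛ hlam (hγ.trans hδ.symm) ?_ ?_ hpen ?_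
  · have := mul_le_mul_of_nonneg_right hγle (show 0 ≤ Λ * L₁ by positivity)
    linarith
  · have := mul_le_mul_of_nonneg_right hγle
      (show 0 ≤ M * (Λ * L₁) + (1 + M * Λ) * L by positivity)
    linarith
  · rw [← hBdef, hT, hγ]
    push_cast
    have e1 : (1 + 2 * M) * R ^ 2 / (2 * (c₀ / s)) = (1 + 2 * M) * R ^ 2 / (2 * c₀) * s := by
      field_simp
    have e2 : ((c : ℝ) + 1) * (n * s) * (c₀ / s * B) = (c + 1) * (n * (c₀ * B)) := by
      field_simp
    have e3 : ((c : ℝ) + 1) * (n * s) * (1 / n) = (c + 1) * s := by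
      field_simp
    rw [e1, e2, e3]
    -- The regimes separate here: noise of size γB is below the accuracy 1/n either because γ is of
    -- order 1/s with n ≤ s, or because B = 0.
    have h1 : n * (c₀ * B) ≤ s / 2 := by
      rcases hns with h | h
      · have h' : (n : ℝ) ≤ s := by exact_mod_cast h
        have h2 : c₀ * B ≤ 1 / 2 := by linarith
        have := mul_le_mul h' h2 q3 (by positivity)
        linarith
      · have : B = 0 := by rw [hBdef, hA h, h]; ring
        rw [this, mul_zero, mul_zero]
        positivity
    have h2 := mul_le_mul_of_nonneg_left h1 (show (0 : ℝ) ≤ c + 1 by positivity)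
    have h3 : M * (Λ * A₁ * R + Λ * L₁ * R ^ 2) ≤ M * (Λ * A₁ * R + Λ * L₁ * R ^ 2) * s :=
      le_mul_of_one_le_right (by positivity) hs'
    have h4 : E * s ≤ c / 2 * s := mul_le_mul_of_nonneg_right (by linarith) (by positivity)
    rw [hE] at h4
    linarith

/-! ### The penalized worst-case function -/

/-- The penalized worst-case constraint function `sup {g̃ₘ(x, μₘ, z) | z ∈ Z̃ₘ}`. -/
noncomputable def Problem.penSup (P : Problem M N J I) (m : Fin M) (x : Vec N) (μ : Vec (I m)) :
    ℝ := ⨆ z : P.Zt m, P.gpen m x μ z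

section PenSup

variable {A L D : ℝ} {m : Fin M} {x : Vec N} {μ : Vec (I m)}

/-- A single subgradient gives an affine majorant, which is bounded on the compact set. Without this
the real supremum would be a default value. -/
theorem Problem.Regular.bddAbove_gpen (hP : P.Regular) (hB : SubgradientBounds P A L D)
    (hx : x ∈ P.X) (hμ : ∀ i, 0 ≤ μ i) :
    BddAbove (Set.range fun z : P.Zt m => P.gpen m x μ z) := by
  obtain ⟨z, hz⟩ := hP.Zt_nonempty m
  obtain ⟨σ, hσ⟩ := hB.penSubdiff_nonempty hx μ hz
  obtain ⟨R, hR, hR'⟩ := (hP.Zt_compact m).exists_norm_sub_le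
  refine ⟨P.gpen m x μ z + ‖σ‖ * R, ?_⟩
  rintro _ ⟨w, rfl⟩
  refine (hP.gpen_le hx hμ hz w.2 hσ).trans (add_le_add le_rfl ((real_inner_le_norm _ _).trans ?_))
  exact mul_le_mul_of_nonneg_left (hR' z hz w w.2) (norm_nonneg _)

theorem Problem.Regular.gpen_le_penSup (hP : P.Regular) (hB : SubgradientBounds P A L D)
    (hx : x ∈ P.X) (hμ : ∀ i, 0 ≤ μ i) {z : Vec (J m)} (hz : z ∈ P.Zt m) :
    P.gpen m x μ z ≤ P.penSup m x μ :=
  le_ciSup (hP.bddAbove_gpen hB hx hμ) (⟨z, hz⟩ : P.Zt m)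

theorem Problem.Regular.penSup_le (hP : P.Regular) {c : ℝ}
    (h : ∀ z ∈ P.Zt m, P.gpen m x μ z ≤ c) : P.penSup m x μ ≤ c := by
  have : Nonempty (P.Zt m) := (hP.Zt_nonempty m).to_subtype
  exact ciSup_le fun z => h z z.2

theorem Problem.Regular.exists_penSup_le_gpen_add (hP : P.Regular) (x : Vec N) (μ : Vec (I m))
    {θ : ℝ} (hθ : 0 < θ) : ∃ z ∈ P.Zt m, P.penSup m x μ ≤ P.gpen m x μ z + θ := by
  have : Nonempty (P.Zt m) := (hP.Zt_nonempty m).to_subtype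
  obtain ⟨z, hz⟩ := exists_lt_of_lt_ciSup (sub_lt_self (P.penSup m x μ) hθ)
  exact ⟨z, z.2, by linarith⟩

end PenSup

/-! ### Existence of runs -/

/-- Recursion on pairs (previous, current); starting from the doubled initial value realizes the
convention that index -1 means 0. -/
theorem exists_two_step_recursion {α : Type*} (s₀ : α) (step : α → α → α) :
    ∃ u : ℕ → α, u 0 = s₀ ∧ ∀ t, u (t + 1) = step (u (t - 1)) (u t) := by
  let v : ℕ → α × α := fun t => Nat.rec (s₀, s₀) (fun _ q => (q.2, step q.1 q.2)) t
  have hv : ∀ t, (v t).1 = (v (t - 1)).2 := by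
    intro t
    cases t <;> rfl
  refine ⟨fun t => (v t).2, rfl, fun t => ?_⟩
  change step (v t).1 (v t).2 = _
  rw [hv t]

theorem zero_mem_box {n : ℕ} {c : ℝ} (hc : 0 ≤ c) : (0 : Vec n) ∈ box n c :=
  fun _ => ⟨le_rfl, hc⟩

theorem SubgradientBounds.exists_inner_run {A L D : ℝ} (hB : SubgradientBounds P A L D)
    (hP : P.Regular) {a : Fin M → ℝ} (ha : ∀ m, 0 ≤ a m) (p : Params) (xc : Vec N)
    (μc : (m : Fin M) → Vec (I m)) (lam : Fin M → ℝ) :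
    ∃ Q : InnerTrace M N J I, Q.IsRun P a p xc μc lam := by
  choose projX hprojX using fun y => exists_isProj hP.X_compact hP.X_nonempty y
  choose projZ hprojZ using fun m y => exists_isProj (hP.Zt_compact m) (hP.Zt_nonempty m) y
  choose projB hprojB using fun m y =>
    exists_isProj (isCompact_box (I m) (a m)) ⟨0, zero_mem_box (ha m)⟩ y
  -- Subgradients are selected as functions of the point, so the state (x, μ, z) determines them and
  -- need not carry them along.
  choose! ζ hζ using hB.gz_nonempty
  choose! η hη using hB.h_nonempty
  choose! ξ0 hξ0 using hB.f0_nonempty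
  choose! ξ hξ using hB.gx_nonempty
  obtain ⟨x₀, hx₀⟩ := hP.X_nonempty
  choose z₀ hz₀ using hP.Zt_nonempty
  let znext : Vec N × ((m : Fin M) → Vec (I m)) × ((m : Fin M) → Vec (J m)) →
      Vec N × ((m : Fin M) → Vec (I m)) × ((m : Fin M) → Vec (J m)) →
      (m : Fin M) → Vec (J m) := fun r s m =>
    projZ m (s.2.2 m - (p.δ * lam m) • ((2 : ℝ) • ζ m s.1 (s.2.2 m) - ζ m r.1 (r.2.2 m)
      + ∑ i, ((2 * s.2.1 m i) • η m i (s.2.2 m) - r.2.1 m i • η m i (r.2.2 m))))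
  obtain ⟨u, hu0, hu⟩ := exists_two_step_recursion (x₀, (0 : (m : Fin M) → Vec (I m)), z₀)
    fun r s =>
      (projX ((p.α * p.γ / (p.α + p.γ)) • ((1 / p.α) • xc + (1 / p.γ) • s.1
        - (ξ0 s.1 + ∑ m, lam m • ξ m s.1 (znext r s m)))),
      (fun m => projB m ((p.α * p.γ / (p.α + p.γ)) • ((1 / p.α) • μc m + (1 / p.γ) • s.2.1 m
        + lam m • P.hvec m (znext r s m)))),
      znext r s)
  have hx : ∀ t, (u t).1 ∈ P.X := by
    intro t
    cases t with
    | zero => rw [hu0]; exact hx₀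
    | succ t => rw [hu]; exact (hprojX _).1
  have hz : ∀ t m, (u t).2.2 m ∈ P.Zt m := by
    intro t m
    cases t with
    | zero => rw [hu0]; exact hz₀ m
    | succ t => rw [hu]; exact (hprojZ m _).1
  refine ⟨⟨fun t => (u t).1, fun t => (u t).2.1, fun t => (u t).2.2,
    fun t m => ζ m (u t).1 ((u t).2.2 m), fun t m i => η m i ((u t).2.2 m),
    fun t => ξ0 (u t).1, fun t m => ξ m (u t).1 ((u (t + 1)).2.2 m)⟩, ?_⟩
  constructor
  · exact hx 0
  · intro m
    simp only [hu0]
    exact zero_mem_box (ha m)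
  · exact hz 0
  · exact fun t _ m => hζ m _ (hx t) _ (hz t m)
  · exact fun t _ m i => hη m i _ (hz t m)
  · intro t _ m
    simp only [hu t]
    exact hprojZ m _
  · exact fun t _ => hξ0 _ (hx t)
  · exact fun t _ m => hξ m _ (hx t) _ (hz (t + 1) m)
  · intro t _
    simp only [hu t]
    exact hprojX _
  · intro t _ m
    simp only [hu t]
    exact hprojB m _

namespace Trace.IsRun

variable {R : Trace M N J I} {a : Fin M → ℝ} {p : Params} {x0 : Vec N}
  {μ0 : (m : Fin M) → Vec (I m)}

theorem x_mem (h : R.IsRun P a p x0 μ0) (hP : P.Regular) (hx0 : x0 ∈ P.X) {k : ℕ}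
    (hk : k ≤ p.K) : R.x k ∈ P.X := by
  cases k with
  | zero => rw [h.x_init]; exact hx0
  | succ k => rw [h.x_step k hk]; exact (h.inner_run k hk).xout_mem hP

theorem μ_mem (h : R.IsRun P a p x0 μ0) (hμ0 : ∀ m, μ0 m ∈ box (I m) (a m)) {k : ℕ}
    (hk : k ≤ p.K) (m : Fin M) : R.μ k m ∈ box (I m) (a m) := by
  cases k with
  | zero => rw [h.μ_init]; exact hμ0 m
  | succ k => rw [h.μ_step k hk]; exact (h.inner_run k hk).μout_mem m

end Trace.IsRun

theorem SubgradientBounds.exists_run {A L D : ℝ} (hB : SubgradientBounds P A L D)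
    (hP : P.Regular) {a : Fin M → ℝ} (ha : ∀ m, 0 ≤ a m) (p : Params) {x0 : Vec N}
    (hx0 : x0 ∈ P.X) {μ0 : (m : Fin M) → Vec (I m)} (hμ0 : ∀ m, μ0 m ∈ box (I m) (a m)) :
    ∃ R : Trace M N J I, R.IsRun P a p x0 μ0 := by
  choose inn hinn using fun xc μc lam => hB.exists_inner_run hP ha p xc μc lam
  choose zmax hzmax hzmax' using fun (m : Fin M) x (μ : Vec (I m)) =>
    hP.exists_penSup_le_gpen_add x μ p.θ_pos
  let lnext : Vec N × ((m : Fin M) → Vec (I m)) × (Fin M → ℝ) →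
      Vec N × ((m : Fin M) → Vec (I m)) × (Fin M → ℝ) → Fin M → ℝ := fun r s m =>
    max (s.2.2 m + p.β * (2 * P.gpen m s.1 (s.2.1 m) (zmax m s.1 (s.2.1 m))
      - P.gpen m r.1 (r.2.1 m) (zmax m r.1 (r.2.1 m)))) 0
  obtain ⟨u, hu0, hu⟩ := exists_two_step_recursion (x0, μ0, (0 : Fin M → ℝ)) fun r s =>
    ((inn s.1 s.2.1 (lnext r s)).xout p.T, (inn s.1 s.2.1 (lnext r s)).μout p.T, lnext r s)
  have hx : ∀ k, (u k).1 ∈ P.X := by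
    intro k
    cases k with
    | zero => rw [hu0]; exact hx0
    | succ k => rw [hu]; exact (hinn _ _ _).xout_mem hP
  have hμ : ∀ k m, (u k).2.1 m ∈ box (I m) (a m) := by
    intro k m
    cases k with
    | zero => rw [hu0]; exact hμ0 m
    | succ k => rw [hu]; exact (hinn _ _ _).μout_mem m
  refine ⟨⟨fun k => (u k).1, fun k => (u k).2.1, fun k => (u k).2.2,
    fun k m => zmax m (u k).1 ((u k).2.1 m),
    fun k => inn (u k).1 (u k).2.1 (lnext (u (k - 1)) (u k))⟩, ?_⟩
  constructor
  · simp only [hu0]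
  · simp only [hu0]
  · simp only [hu0]
  · exact fun k _ m => hzmax m _ _
  · exact fun k _ m w hw =>
      (hP.gpen_le_penSup hB (hx k) (fun i => (hμ k m i).1) hw).trans (hzmax' m _ _)
  · intro k _ m
    simp only [hu k]
    rfl
  · intro k _
    simp only [hu k]
    exact hinn _ _ _
  · intro k _
    simp only [hu k]
  · intro k _
    simp only [hu k]

/-! ### Lipschitz continuity and convexity of the penalized worst case -/

section PenSup

variable {A L D : ℝ}

/-- For fixed z the penalized function is Lipschitz in x by bounded subgradients and in μ because h
is bounded on Z̃_m. The constants do not depend on z, so the supremum inherits them. -/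
theorem Problem.Regular.exists_penSup_lipschitz (hP : P.Regular)
    (hB : SubgradientBounds P A L D) :
    ∃ l : ℝ, 0 ≤ l ∧ ∀ m, ∀ x ∈ P.X, ∀ x' ∈ P.X, ∀ μ μ' : Vec (I m), (∀ i, 0 ≤ μ' i) →
      P.penSup m x μ ≤ P.penSup m x' μ' + l * (‖x - x'‖ + ‖μ - μ'‖) := by
  have hD := hB.D_nonneg
  choose z₀ hz₀ using hP.Zt_nonempty
  choose R hR hR' using fun m => (hP.Zt_compact m).exists_norm_sub_le
  set H : (m : Fin M) → Fin (I m) → ℝ := fun m i => |(P.h m i (z₀ m)).toReal| + D * R m with hH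
  have hH0 : ∀ m i, 0 ≤ H m i := fun m i => by have := hR m; positivity
  have hh : ∀ m i, ∀ z ∈ P.Zt m, |(P.h m i z).toReal| ≤ H m i := by
    intro m i z hz
    have key : ∀ u ∈ P.Zt m, ∀ w ∈ P.Zt m,
        (P.h m i u).toReal ≤ (P.h m i w).toReal + D * R m := by
      intro u hu w hw
      obtain ⟨η, hη⟩ := hB.h_nonempty m i u hu
      have h1 := subdiff_real hη (hP.h_finite m i u hu) (hP.h_finite m i w hw)
      have h2 : -inner ℝ η (w - u) ≤ D * R m :=
        (neg_le_abs _).trans ((abs_real_inner_le_norm _ _).trans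
          (mul_le_mul (hB.h_bounded m i u hu η hη) (hR' m w hw u hu) (norm_nonneg _) hD))
      linarith
    have h1 := key z hz _ (hz₀ m)
    have h2 := key _ (hz₀ m) z hz
    have h3 := abs_le.1 (le_refl |(P.h m i (z₀ m)).toReal|)
    rw [abs_le]
    constructor <;> simp only [hH] <;> linarith [h3.1, h3.2]
  refine ⟨D + ∑ m, ∑ i, H m i, add_nonneg hD (Finset.sum_nonneg fun m _ =>
    Finset.sum_nonneg fun i _ => hH0 m i), fun m x hx x' hx' μ μ' hμ' => ?_⟩
  refine hP.penSup_le fun z hz => ?_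
  obtain ⟨ξ, hξ⟩ := hB.gx_nonempty m x hx z hz
  have h1 := subdiff_real hξ (hP.g_finite m x hx z hz) (hP.g_finite m x' hx' z hz)
  have h2 : -inner ℝ ξ (x' - x) ≤ D * ‖x - x'‖ := by
    rw [norm_sub_rev]
    exact (neg_le_abs _).trans ((abs_real_inner_le_norm _ _).trans
      (mul_le_mul_of_nonneg_right (hB.gx_bounded m x hx z hz ξ hξ) (norm_nonneg _)))
  have h3 : ∑ i, μ' i * (P.h m i z).toReal - ∑ i, μ i * (P.h m i z).toReal
      ≤ (∑ i, H m i) * ‖μ - μ'‖ := by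
    rw [← Finset.sum_sub_distrib, Finset.sum_mul]
    refine Finset.sum_le_sum fun i _ => ?_
    have e : μ' i * (P.h m i z).toReal - μ i * (P.h m i z).toReal
        = -((P.h m i z).toReal * (μ - μ') i) := by
      rw [PiLp.sub_apply]; ring
    rw [e]
    refine (neg_le_abs _).trans ?_
    rw [abs_mul]
    exact mul_le_mul (hh m i z hz) (abs_apply_le_norm _ i) (abs_nonneg _) (hH0 m i)
  have h4 : ∑ i, H m i ≤ ∑ m, ∑ i, H m i :=
    Finset.single_le_sum (f := fun m => ∑ i, H m i)
      (fun m _ => Finset.sum_nonneg fun i _ => hH0 m i) (Finset.mem_univ m)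
  have h5 := hP.gpen_le_penSup hB hx' hμ' hz
  have h6 : 0 ≤ ∑ m, ∑ i, H m i := (Finset.sum_nonneg fun i _ => hH0 m i).trans h4
  have h7 := mul_le_mul_of_nonneg_right h4 (norm_nonneg (μ - μ'))
  have h8 := mul_nonneg h6 (norm_nonneg (x - x'))
  have h9 := mul_nonneg hD (norm_nonneg (μ - μ'))
  unfold Problem.gpen at h5 ⊢
  linarith

theorem Problem.Regular.exists_penSup_sq_le (hP : P.Regular)
    (hB : SubgradientBounds P A L D) (a : Fin M → ℝ) :
    ∃ L₂ : ℝ, 0 ≤ L₂ ∧ ∀ m, ∀ x ∈ P.X, ∀ x' ∈ P.X, ∀ μ ∈ box (I m) (a m),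
      ∀ μ' ∈ box (I m) (a m),
      (P.penSup m x μ - P.penSup m x' μ') ^ 2 ≤ L₂ * (‖x - x'‖ ^ 2 + ‖μ - μ'‖ ^ 2) := by
  obtain ⟨l, hl, h⟩ := hP.exists_penSup_lipschitz hB
  refine ⟨2 * l ^ 2, by positivity, fun m x hx x' hx' μ hμ μ' hμ' => ?_⟩
  have h1 := h m x hx x' hx' μ μ' fun i => (hμ' i).1
  have h2 := h m x' hx' x hx μ' μ fun i => (hμ i).1
  rw [norm_sub_rev x', norm_sub_rev μ'] at h2
  have h3 : |P.penSup m x μ - P.penSup m x' μ'| ≤ l * (‖x - x'‖ + ‖μ - μ'‖) := by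
    rw [abs_le]; constructor <;> linarith
  have h4 : (P.penSup m x μ - P.penSup m x' μ') ^ 2 ≤ (l * (‖x - x'‖ + ‖μ - μ'‖)) ^ 2 := by
    rw [← sq_abs (P.penSup m x μ - _)]
    gcongr
  nlinarith [mul_nonneg (sq_nonneg l) (sq_nonneg (‖x - x'‖ - ‖μ - μ'‖))]

theorem Problem.Regular.exists_penSup_abs_le (hP : P.Regular)
    (hB : SubgradientBounds P A L D) {a : Fin M → ℝ} (ha : ∀ m, 0 ≤ a m) :
    ∃ B : ℝ, 0 ≤ B ∧ ∀ m, ∀ x ∈ P.X, ∀ μ ∈ box (I m) (a m), |P.penSup m x μ| ≤ B := by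
  obtain ⟨l, hl, h⟩ := hP.exists_penSup_lipschitz hB
  obtain ⟨R, hR⟩ := hP.exists_diameterLE a
  obtain ⟨x₀, hx₀⟩ := hP.X_nonempty
  have hR0 := hR.nonneg
  refine ⟨∑ m, |P.penSup m x₀ 0| + l * (R + R), by positivity, fun m x hx μ hμ => ?_⟩
  have h0 := zero_mem_box (n := I m) (ha m)
  have h1 := h m x hx x₀ hx₀ μ 0 fun i => (h0 i).1
  have h2 := h m x₀ hx₀ x hx 0 μ fun i => (hμ i).1
  have h3 : l * (‖x - x₀‖ + ‖μ - 0‖) ≤ l * (R + R) :=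
    mul_le_mul_of_nonneg_left (add_le_add (hR.x_le _ hx _ hx₀) (hR.μ_le m _ hμ _ h0)) hl
  rw [norm_sub_rev x₀, norm_sub_rev 0] at h2
  have h4 : |P.penSup m x₀ 0| ≤ ∑ m, |P.penSup m x₀ 0| :=
    Finset.single_le_sum (f := fun m => |P.penSup m x₀ 0|) (fun m _ => abs_nonneg _)
      (Finset.mem_univ m)
  have h5 := abs_le.1 (le_refl |P.penSup m x₀ 0|)
  rw [abs_le]
  constructor <;> linarith [h5.1, h5.2]

theorem Problem.Regular.convexOn_penSup (hP : P.Regular) (hB : SubgradientBounds P A L D)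
    (m : Fin M) (c : ℝ) :
    ConvexOn ℝ (P.X ×ˢ box (I m) c) fun w => P.penSup m w.1 w.2 := by
  refine ⟨hP.X_convex.prod (convex_box _ _), fun w hw w' hw' s t hs ht hst => ?_⟩
  refine hP.penSup_le fun z hz => ?_
  refine ((hP.convexOn_gpen hz).2 (x := w) (y := w') ⟨hw.1, trivial⟩ ⟨hw'.1, trivial⟩
    hs ht hst).trans ?_
  exact add_le_add
    (mul_le_mul_of_nonneg_left (hP.gpen_le_penSup hB hw.1 (fun i => (hw.2 i).1) hz) hs)
    (mul_le_mul_of_nonneg_left (hP.gpen_le_penSup hB hw'.1 (fun i => (hw'.2 i).1) hz) ht)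

/-- The penalized worst case bounds the worst case from above. -/
theorem Problem.Regular.worst_le_penSup (hP : P.Regular) (hB : SubgradientBounds P A L D)
    {m : Fin M} {x : Vec N} (hx : x ∈ P.X) {μ : Vec (I m)} (hμ : ∀ i, 0 ≤ μ i) :
    P.worst m x ≤ ((P.penSup m x μ : ℝ) : EReal) := by
  refine iSup₂_le fun z hz => ?_
  have hz' : ∀ i, P.h m i z ≤ 0 := by simpa using hz.2
  rw [← (hP.g_finite m x hx z hz.1).coe_toReal, EReal.coe_le_coe_iff]
  refine le_trans ?_ (hP.gpen_le_penSup hB hx hμ hz.1)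
  have h1 : ∑ i, μ i * (P.h m i z).toReal ≤ 0 :=
    Finset.sum_nonpos fun i _ => mul_nonpos_of_nonneg_of_nonpos (hμ i)
      (EReal.toReal_nonpos (hz' i))
  unfold Problem.gpen
  linarith

end PenSup

/-! ### Slater points, duality and the saddle point -/

theorem Problem.IsSlaterFamily.iSup_neg {zbar : (m : Fin M) → Vec (J m)}
    (hz : P.IsSlaterFamily zbar) (hP : P.Regular) {m : Fin M} (i₀ : Fin (I m)) :
    (⨆ i, (P.h m i (zbar m)).toReal) < 0 := by
  have : Nonempty (Fin (I m)) := ⟨i₀⟩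
  obtain ⟨i, hi⟩ := exists_eq_ciSup_of_finite (f := fun i => (P.h m i (zbar m)).toReal)
  rw [← hi]
  exact EReal.toReal_neg ((hz m).2 i) (hP.h_ne_bot m i _)

theorem Problem.Regular.multBound_nonneg (hP : P.Regular) {zbar : (m : Fin M) → Vec (J m)}
    (hz : P.IsSlaterFamily zbar) {G : Fin M → ℝ} (hG : P.IsLowerBound zbar G) (m : Fin M) :
    0 ≤ P.multBound zbar G m := by
  unfold Problem.multBound
  refine div_nonneg_of_nonpos (hG m).1.le ?_
  rcases isEmpty_or_nonempty (Fin (I m)) with h | ⟨⟨i⟩⟩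
  -- The real supremum over an empty index type is 0, hence so is the bound.
  · simp
  · exact (hz.iSup_neg hP i).le

/-- Strong duality of the inner maximization: at a feasible point some multiplier in the box makes
the penalized worst case non-positive. -/
theorem Problem.Regular.exists_multiplier (hP : P.Regular) {zbar : (m : Fin M) → Vec (J m)}
    (hz : P.IsSlaterFamily zbar) {G : Fin M → ℝ} (hG : P.IsLowerBound zbar G) {m : Fin M}
    {x : Vec N} (hx : x ∈ P.X) (hfeas : P.worst m x ≤ 0) :
    ∃ μ ∈ box (I m) (P.multBound zbar G m), P.penSup m x μ ≤ 0 := by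
  obtain ⟨hzbar, hslater⟩ := hz m
  -- The convex program minimizes -g_m(x, ·) under h ≤ 0; feasibility of x says that its value is at
  -- least 0.
  obtain ⟨l, hl, hdual⟩ := exists_lagrange_multiplier (S := P.Zt m)
    (f := fun z => (-P.g m x z).toReal) (c := fun i z => (P.h m i z).toReal) (v := 0)
    ((hP.g_concave m x hx).convexOn (hP.Zt_convex m) fun z hz => (hP.g_finite m x hx z hz).neg)
    (fun i => (hP.h_convex m i).convexOn (hP.Zt_convex m) fun z hz => hP.h_finite m i z hz)
    hzbar (fun i => EReal.toReal_neg (hslater i) (hP.h_ne_bot m i _)) (by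
      intro z hz hle
      have hzZ : z ∈ P.Z m := by
        refine ⟨hz, Set.mem_iInter.2 fun i => ?_⟩
        change P.h m i z ≤ 0
        rw [← (hP.h_finite m i z hz).coe_toReal]
        exact_mod_cast hle i
      have h1 : P.g m x z ≤ 0 :=
        (le_iSup₂ (f := fun z (_ : z ∈ P.Z m) => P.g m x z) z hzZ).trans hfeas
      rw [EReal.toReal_neg_eq]
      linarith [EReal.toReal_nonpos h1])
  refine ⟨WithLp.toLp 2 l, fun i => ⟨hl i, ?_⟩, hP.penSup_le fun z hz => ?_⟩
  -- At the Slater point, G_m ≤ ∑ l_j h_j(z̄_m) ≤ l_i s with s < 0 the largest h_j(z̄_m); dividing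
  -- by s reverses the inequality and gives l_i ≤ a_m.
  · have h1 := hdual _ hzbar
    have h2 : G m ≤ (P.g m x (zbar m)).toReal := by
      have := (hG m).2 x hx
      rw [← (hP.g_finite m x hx _ hzbar).coe_toReal] at this
      exact EReal.coe_le_coe_iff.1 this
    rw [EReal.toReal_neg_eq] at h1
    have hneg := hz.iSup_neg hP i
    set s := ⨆ i, (P.h m i (zbar m)).toReal with hs
    have h3 : ∑ j, l j * (P.h m j (zbar m)).toReal ≤ l i * s := by
      refine (Finset.sum_le_sum (g := fun j => l j * s) fun j _ => ?_).trans ?_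
      · exact mul_le_mul_of_nonneg_left (le_ciSup (f := fun j => (P.h m j (zbar m)).toReal)
          (Set.finite_range _).bddAbove j) (hl j)
      · rw [← Finset.sum_erase_add _ _ (Finset.mem_univ i)]
        have : ∑ j ∈ Finset.univ.erase i, l j * s ≤ 0 :=
          Finset.sum_nonpos fun j _ => mul_nonpos_of_nonneg_of_nonpos (hl j) hneg.le
        linarith
    unfold Problem.multBound
    rw [← hs, le_div_iff_of_neg hneg]
    change G m ≤ l i * s
    linarith
  · have h1 := hdual z hz
    rw [EReal.toReal_neg_eq] at h1
    unfold Problem.gpen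
    change (P.g m x z).toReal - ∑ i, l i * (P.h m i z).toReal ≤ 0
    linarith

/-- A saddle point of the Lagrangian of the penalized problem. -/
theorem Problem.Regular.exists_saddle {A L D : ℝ} (hP : P.Regular)
    (hB : SubgradientBounds P A L D) {zbar : (m : Fin M) → Vec (J m)}
    (hz : P.IsSlaterFamily zbar) {G : Fin M → ℝ} (hG : P.IsLowerBound zbar G) :
    ∃ xs, P.IsOptimal xs ∧ ∃ μs : (m : Fin M) → Vec (I m),
      (∀ m, μs m ∈ box (I m) (P.multBound zbar G m)) ∧ (∀ m, P.penSup m xs (μs m) ≤ 0) ∧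
      ∃ l : Fin M → ℝ, (∀ m, 0 ≤ l m) ∧ ∀ x ∈ P.X, ∀ μ : (m : Fin M) → Vec (I m),
        (∀ m, μ m ∈ box (I m) (P.multBound zbar G m)) →
        (P.f0 xs).toReal ≤ (P.f0 x).toReal + ∑ m, l m * P.penSup m x (μ m) := by
  obtain ⟨xs, hxs⟩ := hP.exists_optimal
  choose μs hμs hpen using fun m => hP.exists_multiplier hz hG hxs.1.1 (hxs.1.2 m)
  refine ⟨xs, hxs, μs, hμs, hpen, ?_⟩
  set a := P.multBound zbar G with ha
  set S : Set (Vec N × ((m : Fin M) → Vec (I m))) :=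
    {w | w.1 ∈ P.X ∧ ∀ m, w.2 m ∈ box (I m) (a m)} with hS
  have hSconv : Convex ℝ S := fun w hw w' hw' s t hs ht hst =>
    ⟨hP.X_convex hw.1 hw'.1 hs ht hst, fun m => convex_box _ _ (hw.2 m) (hw'.2 m) hs ht hst⟩
  obtain ⟨xbar, hxbar, hneg⟩ := hP.slater_x
  -- For μ = 0 the penalty disappears, so x̄ gives the Slater point (x̄, 0) of the lifted problem.
  obtain ⟨l, hl, hdual⟩ := exists_lagrange_multiplier (S := S)
    (f := fun w => (P.f0 w.1).toReal) (c := fun m w => P.penSup m w.1 (w.2 m))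
    (s₀ := (xbar, 0)) (v := (P.f0 xs).toReal)
    (((hP.f0_convex.convexOn hP.X_convex hP.f0_finite).comp_linearMap
      (LinearMap.fst ℝ (Vec N) ((m : Fin M) → Vec (I m)))).subset (fun w hw => hw.1) hSconv)
    (fun m => ((hP.convexOn_penSup hB m (a m)).comp_linearMap
        ((LinearMap.fst ℝ (Vec N) ((m : Fin M) → Vec (I m))).prod
          ((LinearMap.proj m).comp (LinearMap.snd ℝ (Vec N) ((m : Fin M) → Vec (I m)))))).subset
        (fun w hw => ⟨hw.1, hw.2 m⟩) hSconv)
    ⟨hxbar, fun m => zero_mem_box (hP.multBound_nonneg hz hG m)⟩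
    (by
      intro m
      obtain ⟨r, hr1, hr2⟩ := EReal.lt_iff_exists_real_btwn.1 (hneg m)
      refine lt_of_le_of_lt (hP.penSup_le fun z hz => ?_) (EReal.coe_neg'.1 hr2)
      have h1 : P.g m xbar z ≤ (r : EReal) :=
        (le_iSup₂ (f := fun z (_ : z ∈ P.Zt m) => P.g m xbar z) z hz).trans hr1.le
      rw [← (hP.g_finite m xbar hxbar z hz).coe_toReal] at h1
      simpa [Problem.gpen] using EReal.coe_le_coe_iff.1 h1)
    (by
      intro w hw hle
      have hf : P.IsFeasible w.1 := ⟨hw.1, fun m =>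
        (hP.worst_le_penSup hB hw.1 fun i => (hw.2 m i).1).trans (by exact_mod_cast hle m)⟩
      have h1 := hxs.2 w.1 hf
      rw [← (hP.f0_finite _ hxs.1.1).coe_toReal, ← (hP.f0_finite _ hw.1).coe_toReal] at h1
      exact EReal.coe_le_coe_iff.1 h1)
  exact ⟨l, hl, fun x hx μ hμ => hdual (x, μ) ⟨hx, hμ⟩⟩

/-! ### Analysis of the outer algorithm -/

/-- A strong approximate saddle point satisfies the proximal inequality for the penalized
worst-case constraint functions. -/
theorem Problem.IsStrongSaddle.prox_le {A L D : ℝ} {a : Fin M → ℝ} {α ν : ℝ} {xc : Vec N}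
    {μc : (m : Fin M) → Vec (I m)} {lam : Fin M → ℝ} {xs : Vec N}
    {μs : (m : Fin M) → Vec (I m)} {zs : (m : Fin M) → Vec (J m)}
    (h : P.IsStrongSaddle a α ν xc μc lam xs μs zs) (hP : P.Regular)
    (hB : SubgradientBounds P A L D) (hlam : ∀ m, 0 ≤ lam m) {x : Vec N} (hx : x ∈ P.X)
    {μ : (m : Fin M) → Vec (I m)} (hμ : ∀ m, μ m ∈ box (I m) (a m)) :
    (P.f0 xs).toReal + ∑ m, lam m * P.penSup m xs (μs m)
      - ((P.f0 x).toReal + ∑ m, lam m * P.penSup m x (μ m))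
    ≤ ((‖x - xc‖ ^ 2 + ∑ m, ‖μ m - μc m‖ ^ 2) - (‖x - xs‖ ^ 2 + ∑ m, ‖μ m - μs m‖ ^ 2)
      - (‖xs - xc‖ ^ 2 + ∑ m, ‖μs m - μc m‖ ^ 2)) / (2 * α) + ν := by
  obtain ⟨hxs, hμs, hzs, hsad⟩ := h
  refine le_of_forall_pos_le_add fun τ hτ => ?_
  have hs : 0 < 1 + ∑ m, lam m := by
    have := Finset.sum_nonneg fun m (_ : m ∈ Finset.univ) => hlam m
    linarith
  -- Near-maximizers turn the left side into the penalized suprema; the accuracy is chosen so that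
  -- the errors weighted by λ add up to at most τ.
  choose z hz hz' using fun m => hP.exists_penSup_le_gpen_add (m := m) xs (μs m) (div_pos hτ hs)
  have h1 := hsad x hx μ hμ z hz
  have h2 : ∑ m, lam m * P.gpen m x (μ m) (zs m) ≤ ∑ m, lam m * P.penSup m x (μ m) :=
    Finset.sum_le_sum fun m _ => mul_le_mul_of_nonneg_left
      (hP.gpen_le_penSup hB hx (fun i => (hμ m i).1) (hzs m)) (hlam m)
  have h3 : ∑ m, lam m * P.penSup m xs (μs m)
      ≤ ∑ m, lam m * P.gpen m xs (μs m) (z m) + τ := by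
    have h4 := Finset.sum_le_sum fun m (_ : m ∈ Finset.univ) =>
      mul_le_mul_of_nonneg_left (hz' m) (hlam m)
    simp only [mul_add, Finset.sum_add_distrib, ← Finset.sum_mul] at h4
    have h5 : (∑ m, lam m) * (τ / (1 + ∑ m, lam m)) ≤ τ := by
      rw [mul_div_assoc', div_le_iff₀ hs]
      nlinarith
    linarith
  simp only [Problem.innerObj] at h1
  have e : ∀ u v w : ℝ, (u - v - w) / (2 * α)
      = 1 / (2 * α) * u - 1 / α / 2 * v - 1 / (2 * α) * w := fun u v w => by
    rw [div_div, mul_comm α 2]; ring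
  rw [e]
  linarith

/-- The variational inequality of the projection onto the half-line, in three-point form. -/
theorem dual_step_le {β y s y' l : ℝ} (hβ : 0 < β) (hl : 0 ≤ l) (hy : y' = max (y + β * s) 0) :
    (l - y') * s ≤ ((l - y) ^ 2 - (l - y') ^ 2 - (y' - y) ^ 2) / (2 * β) := by
  have h : (y + β * s - y') * (l - y') ≤ 0 := by
    rcases max_cases (y + β * s) 0 with ⟨h1, h2⟩ | ⟨h1, h2⟩
    · rw [hy, h1]; simp
    · rw [hy, h1]
      nlinarith
  rw [le_div_iff₀ (by positivity)]
  nlinarith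

/-- Convergence estimate of the outer algorithm in terms of the values at the iterates: `F k` and
`c k m` are objective and constraint values, `U k` is the squared distance to the comparison point,
`q k` the squared length of the last step. -/
theorem outer_sum_le {M n : ℕ} {α β θ ν L₂ : ℝ} (hα : 0 < α) (hβ : 0 < β) (hL₂ : 0 ≤ L₂)
    {F U q : ℕ → ℝ} {F' : ℝ} {c φ lam : ℕ → Fin M → ℝ} {c' l : Fin M → ℝ} (hl : ∀ m, 0 ≤ l m)
    (hlam_nonneg : ∀ k ≤ n, ∀ m, 0 ≤ lam k m) (hU : 0 ≤ U n) (hq0 : q 0 = 0)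
    (hq : ∀ k, 0 ≤ q k) (hφ : ∀ k ≤ n, ∀ m, c k m - θ ≤ φ k m ∧ φ k m ≤ c k m)
    (hc : ∀ k < n, ∀ m, (c (k + 1) m - c k m) ^ 2 ≤ L₂ * q (k + 1))
    (hlam0 : lam 0 = 0)
    (hlam : ∀ k < n, ∀ m, lam (k + 1) m = max (lam k m + β * (2 * φ k m - φ (k - 1) m)) 0)
    (hprimal : ∀ k < n, F (k + 1) + ∑ m, lam (k + 1) m * c (k + 1) m
      - (F' + ∑ m, lam (k + 1) m * c' m) ≤ (U k - U (k + 1) - q (k + 1)) / (2 * α) + ν)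
    (hstep : 4 * α * β * (M * L₂) ≤ 1) :
    ∑ k ∈ Finset.range n, (F (k + 1) - F' + ∑ m, l m * c (k + 1) m - ∑ m, lam (k + 1) m * c' m)
      + ∑ m, (l m - lam n m) ^ 2 / (4 * β)
    ≤ U 0 / (2 * α) + ∑ m, l m ^ 2 / (2 * β) + n * (ν + θ * ∑ m, l m + M * (β * θ ^ 2))
      + 2 * (M * (β * θ ^ 2)) := by
  set d : ℕ → Fin M → ℝ := fun k m => φ k m - φ (k - 1) m with hd
  have hd2 : ∀ k ≤ n, ∀ m, d k m ^ 2 ≤ 2 * L₂ * q k + 2 * θ ^ 2 := by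
    intro k hk m
    cases k with
    | zero => simp only [hd, sub_self, hq0]; nlinarith [sq_nonneg θ]
    | succ k =>
      have h1 := hφ (k + 1) hk m
      have h2 := hφ k (by omega) m
      have h3 := hc k (by omega) m
      have h4 : (d (k + 1) m - (c (k + 1) m - c k m)) ^ 2 ≤ θ ^ 2 := by
        apply sq_le_sq'
        · simp only [hd, Nat.add_sub_cancel]; linarith [h1.1, h2.2]
        · simp only [hd, Nat.add_sub_cancel]; linarith [h1.2, h2.1]
      nlinarith [sq_nonneg (d (k + 1) m - 2 * (c (k + 1) m - c k m))]
  have hqα : ∀ k, 2 * M * (β * L₂ * q k) ≤ q k / (2 * α) := by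
    intro k
    rw [le_div_iff₀ (by positivity)]
    have := mul_le_mul_of_nonneg_right hstep (hq k)
    linarith
  -- The cross term stores the extrapolation; q k/(2α) stores the last primal step, which will pay
  -- for d² through the Lipschitz bound on c.
  set Ψ : ℕ → ℝ := fun k => U k / (2 * α)
    + ∑ m, ((l m - lam k m) ^ 2 / (2 * β) - (l m - lam k m) * d k m) + q k / (2 * α) with hΨ
  have hmain : ∀ k ∈ Finset.range n,
      F (k + 1) - F' + ∑ m, l m * c (k + 1) m - ∑ m, lam (k + 1) m * c' m
        ≤ Ψ k - Ψ (k + 1) + (ν + θ * ∑ m, l m + M * (β * θ ^ 2)) := by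
    intro k hk
    rw [Finset.mem_range] at hk
    have h1 : ∀ m, l m * c (k + 1) m - lam (k + 1) m * c (k + 1) m
        ≤ ((l m - lam k m) ^ 2 / (2 * β) - (l m - lam k m) * d k m)
          - ((l m - lam (k + 1) m) ^ 2 / (2 * β) - (l m - lam (k + 1) m) * d (k + 1) m)
          + β * L₂ * q k + β * θ ^ 2 + θ * l m := by
      intro m
      have h2 := dual_step_le hβ (hl m) (hlam k hk m)
      have h3 := hφ (k + 1) hk m
      have h4 := hd2 k hk.le m
      -- Since φ ≤ c and λ ≥ 0, the maximization error is weighted by l only. A bound on λ is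
      -- neither needed nor yet available.
      have h5 : (l m - lam (k + 1) m) * (c (k + 1) m - φ (k + 1) m) ≤ θ * l m := by
        nlinarith [mul_nonneg (hlam_nonneg (k + 1) hk m) (sub_nonneg.2 h3.2),
          mul_le_mul_of_nonneg_left (show c (k + 1) m - φ (k + 1) m ≤ θ by linarith [h3.1]) (hl m)]
      have h6 : (lam (k + 1) m - lam k m) * d k m
          ≤ (lam (k + 1) m - lam k m) ^ 2 / (2 * β) + β * L₂ * q k + β * θ ^ 2 := by
        have h7 : (lam (k + 1) m - lam k m) * d k m
            ≤ (lam (k + 1) m - lam k m) ^ 2 / (2 * β) + β / 2 * d k m ^ 2 := by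
          rw [div_add' _ _ _ (by positivity), le_div_iff₀ (by positivity)]
          nlinarith [sq_nonneg (lam (k + 1) m - lam k m - β * d k m)]
        have h8 := mul_le_mul_of_nonneg_left h4 (show 0 ≤ β / 2 by positivity)
        linarith
      have e1 : d (k + 1) m = φ (k + 1) m - φ k m := by simp [hd]
      have e2 : 2 * φ k m - φ (k - 1) m = φ k m + d k m := by simp only [hd]; ring
      rw [e2] at h2
      have d1 : ∀ u v w : ℝ, (u - v - w) / (2 * β) = u / (2 * β) - v / (2 * β) - w / (2 * β) :=
        fun u v w => by ring
      rw [d1] at h2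
      rw [e1]
      linarith
    have h2 := Finset.sum_le_sum fun m (_ : m ∈ Finset.univ) => h1 m
    simp only [Finset.sum_add_distrib, Finset.sum_sub_distrib, Finset.sum_const,
      Finset.card_univ, Fintype.card_fin, nsmul_eq_mul, ← Finset.mul_sum] at h2
    have h3 := hprimal k hk
    have h4 := hqα k
    have h5 : 0 ≤ M * (β * L₂ * q k) := by have := hq k; positivity
    have d1 : ∀ u v w : ℝ, (u - v - w) / (2 * α) = u / (2 * α) - v / (2 * α) - w / (2 * α) :=
      fun u v w => by ring
    rw [d1] at h3
    simp only [hΨ, Finset.sum_sub_distrib]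
    linarith
  have hsum := Finset.sum_le_sum hmain
  rw [Finset.sum_add_distrib, Finset.sum_range_sub', Finset.sum_const, Finset.card_range,
    nsmul_eq_mul] at hsum
  have h0 : Ψ 0 = U 0 / (2 * α) + ∑ m, l m ^ 2 / (2 * β) := by
    simp [hΨ, hd, hq0, hlam0]
  -- Half of (l - λ_n)²/(2β) pays for the cross term at n; the other half is kept and later bounds
  -- the multipliers.
  have hn : ∑ m, (l m - lam n m) ^ 2 / (4 * β) ≤ Ψ n + 2 * (M * (β * θ ^ 2)) := by
    have h1 : ∀ m, (l m - lam n m) ^ 2 / (4 * β)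
        ≤ ((l m - lam n m) ^ 2 / (2 * β) - (l m - lam n m) * d n m)
          + 2 * (β * L₂ * q n) + 2 * (β * θ ^ 2) := by
      intro m
      have h2 := hd2 n le_rfl m
      have h3 : (l m - lam n m) * d n m ≤ (l m - lam n m) ^ 2 / (4 * β) + β * d n m ^ 2 := by
        rw [div_add' _ _ _ (by positivity), le_div_iff₀ (by positivity)]
        nlinarith [sq_nonneg (l m - lam n m - 2 * β * d n m)]
      have h4 := mul_le_mul_of_nonneg_left h2 hβ.le
      have e : (l m - lam n m) ^ 2 / (2 * β) = 2 * ((l m - lam n m) ^ 2 / (4 * β)) := by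
        field_simp; ring
      linarith
    have h2 := Finset.sum_le_sum fun m (_ : m ∈ Finset.univ) => h1 m
    simp only [Finset.sum_add_distrib, Finset.sum_const, Finset.card_univ, Fintype.card_fin,
      nsmul_eq_mul] at h2
    have h3 := hqα n
    have h4 : 0 ≤ U n / (2 * α) := by positivity
    simp only [hΨ]
    linarith
  linarith

/-- Bound on the accumulated Lagrangian gaps of the outer algorithm. -/
noncomputable def gapBound (R α β : ℝ) {M : ℕ} (l : Fin M → ℝ) : ℝ :=
  (1 + M) * R ^ 2 / (2 * α) + ∑ m, l m ^ 2 / (2 * β) + (1 + ∑ m, l m + M * β) + 2 * (M * β)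

theorem gapBound_mono {R α β : ℝ} (hβ : 0 < β) {M : ℕ} {l l' : Fin M → ℝ}
    (hl : ∀ m, 0 ≤ l m) (hll' : ∀ m, l m ≤ l' m) : gapBound R α β l ≤ gapBound R α β l' := by
  have h1 : ∑ m, l m ≤ ∑ m, l' m := Finset.sum_le_sum fun m _ => hll' m
  have h2 : ∑ m, l m ^ 2 / (2 * β) ≤ ∑ m, l' m ^ 2 / (2 * β) :=
    Finset.sum_le_sum fun m _ => by
      have := hl m
      have := hll' m
      gcongr
  unfold gapBound
  linarith

theorem one_le_gapBound {R α β : ℝ} (hα : 0 < α) (hβ : 0 < β) {M : ℕ} {l : Fin M → ℝ}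
    (hl : ∀ m, 0 ≤ l m) : 1 ≤ gapBound R α β l := by
  have h1 : 0 ≤ ∑ m, l m := Finset.sum_nonneg fun m _ => hl m
  have h2 : 0 ≤ (1 + M) * R ^ 2 / (2 * α) := by positivity
  have h3 : 0 ≤ ∑ m, l m ^ 2 / (2 * β) := by positivity
  have h4 : 0 ≤ M * β := by positivity
  unfold gapBound
  linarith

namespace Trace.IsRun

variable {R : Trace M N J I} {a : Fin M → ℝ} {p : Params} {x0 : Vec N}
  {μ0 : (m : Fin M) → Vec (I m)} {A L D L₂ ρ : ℝ}

theorem lam_nonneg (h : R.IsRun P a p x0 μ0) {k : ℕ} (hk : k ≤ p.K) (m : Fin M) :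
    0 ≤ R.lam k m := by
  cases k with
  | zero => rw [h.lam_init]; rfl
  | succ k => rw [h.lam_step k hk]; exact le_max_right _ _

theorem gpen_mem_Icc (h : R.IsRun P a p x0 μ0) (hP : P.Regular) (hB : SubgradientBounds P A L D)
    (hx0 : x0 ∈ P.X) (hμ0 : ∀ m, μ0 m ∈ box (I m) (a m)) {k : ℕ} (hk : k < p.K) (m : Fin M) :
    P.penSup m (R.x k) (R.μ k m) - p.θ ≤ P.gpen m (R.x k) (R.μ k m) (R.z k m) ∧
      P.gpen m (R.x k) (R.μ k m) (R.z k m) ≤ P.penSup m (R.x k) (R.μ k m) := by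
  refine ⟨?_, hP.gpen_le_penSup hB (h.x_mem hP hx0 hk.le) (fun i => (h.μ_mem hμ0 hk.le m i).1)
    (h.z_mem k hk m)⟩
  linarith [hP.penSup_le fun w hw => h.z_approx k hk m w hw]

/-- With ν = θ = 1/K the errors of at most K iterations add up to a constant. The saddle property is
required only before n, so that the estimate can be used inside an induction. -/
theorem sum_gap_le (h : R.IsRun P a p x0 μ0) (hP : P.Regular) (hB : SubgradientBounds P A L D)
    (hx0 : x0 ∈ P.X) (hμ0 : ∀ m, μ0 m ∈ box (I m) (a m)) (hρ : DiameterLE P a ρ) (hL₂ : 0 ≤ L₂)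
    (hlip : ∀ m, ∀ x ∈ P.X, ∀ x' ∈ P.X, ∀ μ ∈ box (I m) (a m), ∀ μ' ∈ box (I m) (a m),
      (P.penSup m x μ - P.penSup m x' μ') ^ 2 ≤ L₂ * (‖x - x'‖ ^ 2 + ‖μ - μ'‖ ^ 2))
    (hstep : 4 * p.α * p.β * (M * L₂) ≤ 1) (hν : p.ν = 1 / p.K) (hθ : p.θ = 1 / p.K) {n : ℕ}
    (hn : n ≤ p.K)
    (hsad : ∀ k < n, P.IsStrongSaddle a p.α p.ν (R.x k) (R.μ k) (R.lam (k + 1))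
      ((R.inner k).xout p.T) ((R.inner k).μout p.T) ((R.inner k).zout p.T))
    {x : Vec N} (hx : x ∈ P.X) {μ : (m : Fin M) → Vec (I m)} (hμ : ∀ m, μ m ∈ box (I m) (a m))
    {l : Fin M → ℝ} (hl : ∀ m, 0 ≤ l m) :
    ∑ k ∈ Finset.range n, ((P.f0 (R.x (k + 1))).toReal - (P.f0 x).toReal
        + ∑ m, l m * P.penSup m (R.x (k + 1)) (R.μ (k + 1) m)
        - ∑ m, R.lam (k + 1) m * P.penSup m x (μ m))
      + ∑ m, (l m - R.lam n m) ^ 2 / (4 * p.β) ≤ gapBound ρ p.α p.β l := by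
  have hα := p.α_pos
  have hβ := p.β_pos
  -- A run has no approximate maximizer at index K, where the potential still needs a value; the
  -- exact supremum is used there.
  set φ : ℕ → Fin M → ℝ := fun k m => if k < p.K then P.gpen m (R.x k) (R.μ k m) (R.z k m)
    else P.penSup m (R.x k) (R.μ k m) with hφdef
  have hφlt : ∀ k < p.K, ∀ m, φ k m = P.gpen m (R.x k) (R.μ k m) (R.z k m) :=
    fun k hk m => if_pos hk
  set U : ℕ → ℝ := fun k => ‖x - R.x k‖ ^ 2 + ∑ m, ‖μ m - R.μ k m‖ ^ 2 with hU
  set q : ℕ → ℝ := fun k => ‖R.x k - R.x (k - 1)‖ ^ 2 + ∑ m, ‖R.μ k m - R.μ (k - 1) m‖ ^ 2 with hq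
  have key := outer_sum_le (n := n) (α := p.α) (β := p.β) (θ := p.θ) (ν := p.ν) hα hβ hL₂
    (F := fun k => (P.f0 (R.x k)).toReal) (U := U) (q := q) (F' := (P.f0 x).toReal)
    (c := fun k m => P.penSup m (R.x k) (R.μ k m)) (φ := φ) (lam := R.lam)
    (c' := fun m => P.penSup m x (μ m)) hl (fun k hk m => h.lam_nonneg (hk.trans hn) m)
    (by positivity) (by simp [hq]) (fun k => by positivity)
    (by
      intro k hk m
      by_cases hkK : k < p.K
      · rw [hφlt k hkK]
        exact h.gpen_mem_Icc hP hB hx0 hμ0 hkK m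
      · simp only [hφdef, if_neg hkK]
        exact ⟨by linarith [p.θ_pos], le_rfl⟩)
    (by
      intro k hk m
      refine (hlip m _ (h.x_mem hP hx0 (k := k + 1) (by omega)) _
        (h.x_mem hP hx0 (k := k) (by omega)) _ (h.μ_mem hμ0 (k := k + 1) (by omega) m) _
        (h.μ_mem hμ0 (k := k) (by omega) m)).trans (mul_le_mul_of_nonneg_left ?_ hL₂)
      simp only [hq, Nat.add_sub_cancel]
      have := Finset.single_le_sum (f := fun m => ‖R.μ (k + 1) m - R.μ k m‖ ^ 2)
        (fun m _ => by positivity) (Finset.mem_univ m)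
      linarith)
    h.lam_init
    (by
      intro k hk m
      rw [hφlt k (by omega), hφlt (k - 1) (by omega)]
      exact h.lam_step k (by omega) m)
    (by
      intro k hk
      have h1 := (hsad k hk).prox_le hP hB (fun m => h.lam_nonneg (k := k + 1) (by omega) m) hx hμ
      rw [← h.x_step k (by omega), ← h.μ_step k (by omega)] at h1
      simpa only [hU, hq, Nat.add_sub_cancel] using h1)
    hstep
  refine key.trans ?_
  have hU0 : U 0 ≤ (1 + M) * ρ ^ 2 := by
    have h1 := hρ.x_le _ hx _ (h.x_mem hP hx0 (k := 0) (by omega))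
    have h2 : ∑ m, ‖μ m - R.μ 0 m‖ ^ 2 ≤ ∑ _m : Fin M, ρ ^ 2 := Finset.sum_le_sum fun m _ => by
      have := hρ.μ_le m _ (hμ m) _ (h.μ_mem hμ0 (k := 0) (by omega) m)
      gcongr
    rw [Finset.sum_const, Finset.card_univ, Fintype.card_fin, nsmul_eq_mul] at h2
    have h3 : ‖x - R.x 0‖ ^ 2 ≤ ρ ^ 2 := by gcongr
    simp only [hU]
    linarith
  have hK : (1 : ℝ) ≤ p.K := by exact_mod_cast p.one_le_K
  have hθ1 : p.θ ≤ 1 := by rw [hθ]; exact (div_le_one (by linarith)).2 hK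
  have hθ0 := p.θ_pos
  have hθ2 : p.θ ^ 2 ≤ p.θ := by nlinarith
  have hs : 0 ≤ ∑ m, l m := Finset.sum_nonneg fun m _ => hl m
  have h1 : n * (p.ν + p.θ * ∑ m, l m + M * (p.β * p.θ ^ 2)) ≤ 1 + ∑ m, l m + M * p.β := by
    have hnK : (n : ℝ) * p.θ ≤ 1 := by
      rw [hθ, mul_one_div, div_le_one (by linarith)]
      exact_mod_cast hn
    have h2 : p.ν + p.θ * ∑ m, l m + M * (p.β * p.θ ^ 2)
        ≤ p.θ * (1 + ∑ m, l m + M * p.β) := by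
      have h3 : M * (p.β * p.θ ^ 2) ≤ M * (p.β * p.θ) := by gcongr
      rw [hν, ← hθ]
      linarith
    calc n * (p.ν + p.θ * ∑ m, l m + M * (p.β * p.θ ^ 2))
        ≤ n * (p.θ * (1 + ∑ m, l m + M * p.β)) := by gcongr
      _ = n * p.θ * (1 + ∑ m, l m + M * p.β) := by ring
      _ ≤ 1 * (1 + ∑ m, l m + M * p.β) := by gcongr
      _ = _ := one_mul _
  have h2 : 2 * (M * (p.β * p.θ ^ 2)) ≤ 2 * (M * p.β) := by
    have : p.β * p.θ ^ 2 ≤ p.β * 1 := by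
      gcongr
      linarith
    rw [mul_one] at this
    gcongr
  have h3 : U 0 / (2 * p.α) ≤ (1 + M) * ρ ^ 2 / (2 * p.α) := by gcongr
  unfold gapBound
  linarith

end Trace.IsRun

/-! ### Choice of parameters and oracle complexity -/

theorem SubgradientBounds.hasOracleComplexity {A L D : ℝ} (hB : SubgradientBounds P A L D)
    (hP : P.Regular) {zbar : (m : Fin M) → Vec (J m)} (hzbar : P.IsSlaterFamily zbar)
    {G : Fin M → ℝ} (hG : P.IsLowerBound zbar G) {r : ℕ} (hr : 2 ≤ r) (hrA : 3 ≤ r ∨ A = 0) :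
    HasOracleComplexity P (P.multBound zbar G) r := by
  have ha := fun m => hP.multBound_nonneg hzbar hG m
  obtain ⟨xs, hxs, μs, hμs, hpen, l, hl, hsaddle⟩ := hP.exists_saddle hB hzbar hG
  set a := P.multBound zbar G with hadef
  obtain ⟨ρ, hρ⟩ := hP.exists_diameterLE a
  obtain ⟨L₂, hL₂, hlip⟩ := hP.exists_penSup_sq_le hB a
  obtain ⟨B, hB0, hBle⟩ := hP.exists_penSup_abs_le hB ha
  set β : ℝ := 1 / (4 * (M * L₂) + 1) with hβdef
  have hβ : 0 < β := by positivity
  have hβstep : 4 * 1 * β * (M * L₂) ≤ 1 := by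
    have h1 : 4 * 1 * β * (M * L₂) = (4 * (M * L₂)) / (4 * (M * L₂) + 1) := by
      rw [hβdef]; ring
    rw [h1, div_le_one (by positivity)]
    linarith
  -- The comparison multipliers 0, l and l + e_m are all at most l + 1, so one constant serves them
  -- all.
  set E := gapBound ρ 1 β fun m => l m + 1 with hE
  have hE1 : 1 ≤ E := one_le_gapBound one_pos hβ fun m => by linarith [hl m]
  -- The first summands bound λ^n through (l - λ^n)² ≤ 4βE; the last bounds one more update, each
  -- penalized value being at most B + 1 in modulus.
  set Λ := ∑ m, l m + (4 * β * E + 1) + 3 * β * (B + 1) with hΛdef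
  have hlsum : 0 ≤ ∑ m, l m := Finset.sum_nonneg fun m _ => hl m
  have hΛ : 0 ≤ Λ := by positivity
  obtain ⟨c, hc, c₀, hc₀, hinner⟩ := hB.exists_inner_params hP ha hΛ
  set w : ℝ := ((Params.innerIterCalls M I : ℕ) : ℝ) with hw
  have hw0 : 0 ≤ w := Nat.cast_nonneg _
  refine ⟨(M + c * w) * (E + 1) ^ r + 1, by positivity, fun ε hε => ?_⟩
  set X := max 1 (1 / ε) with hX
  have hX1 : 1 ≤ X := le_max_left _ _
  obtain ⟨K, hKdef⟩ : ∃ K : ℕ, K = ⌈E * X⌉₊ := ⟨_, rfl⟩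
  have hKle : E * X ≤ K := by rw [hKdef]; exact Nat.le_ceil _
  have hKlt : (K : ℝ) ≤ (E + 1) * X := by
    have h1 : (K : ℝ) < E * X + 1 := by rw [hKdef]; exact Nat.ceil_lt_add_one (by positivity)
    linarith
  have hK1 : 1 ≤ K := by
    have h1 : (1 : ℝ) ≤ K := by nlinarith
    exact_mod_cast h1
  have hK1' : (1 : ℝ) ≤ K := by exact_mod_cast hK1
  have hEK : E / K ≤ ε := by
    rw [div_le_iff₀ (by linarith)]
    have h1 : 1 / ε ≤ X := le_max_right _ _
    have h2 : 1 ≤ X * ε := by rwa [div_le_iff₀ hε] at h1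
    calc E ≤ E * (X * ε) := le_mul_of_one_le_right (by linarith) h2
      _ = E * X * ε := by ring
      _ ≤ K * ε := by gcongr
      _ = ε * K := mul_comm _ _
  -- The factor s of the inner parameters is K^(r-2): then T is of order K^(r-1), γ of order
  -- K^(2-r), and the total work of order K^r.
  have hs1 : 1 ≤ K ^ (r - 2) := Nat.one_le_pow _ _ hK1
  have hs1' : (0 : ℝ) < (K ^ (r - 2) : ℕ) := by exact_mod_cast hs1
  obtain ⟨p, hpK, hpT, hpα, hpβ, hpθ, hpν, hpγ, hpδ⟩ : ∃ p : Params, p.K = K ∧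
      p.T = c * (K * K ^ (r - 2)) ∧ p.α = 1 ∧ p.β = β ∧ p.θ = 1 / p.K ∧ p.ν = 1 / p.K ∧
      p.γ = c₀ / (K ^ (r - 2) : ℕ) ∧ p.δ = c₀ / (K ^ (r - 2) : ℕ) :=
    ⟨⟨K, c * (K * K ^ (r - 2)), 1, β, 1 / K, 1 / K, c₀ / (K ^ (r - 2) : ℕ),
      c₀ / (K ^ (r - 2) : ℕ), hK1, Nat.mul_pos hc (Nat.mul_pos hK1 hs1), one_pos, hβ,
      by positivity, by positivity, by positivity, by positivity⟩, rfl, rfl, rfl, rfl, rfl, rfl,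
      rfl, rfl⟩
  refine ⟨p, ?_, fun x0 hx0 μ0 hμ0 => ⟨hB.exists_run hP ha p hx0 hμ0, fun R hR => ?_⟩⟩
  · have h1 : (p.calls M I : ℝ) = K * (M + c * (K * K ^ (r - 2)) * w) := by
      simp only [Params.calls, Finset.sum_const, Finset.card_range, smul_eq_mul, hpK, hpT, hw]
      push_cast
      ring
    have h2 : (K : ℝ) * (K * K ^ (r - 2)) = K ^ r := by
      rw [← pow_succ', ← pow_succ']
      congr 1
      omega
    have h3 : (K : ℝ) ≤ K ^ r := le_self_pow₀ hK1' (by omega)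
    have h4 : (p.calls M I : ℝ) ≤ (M + c * w) * K ^ r := by
      rw [h1]
      calc K * (M + c * (K * K ^ (r - 2)) * w) = M * K + c * w * (K * (K * K ^ (r - 2))) := by ring
        _ ≤ M * K ^ r + c * w * K ^ r := by rw [h2]; gcongr
        _ = _ := by ring
    have h5 : X ^ r ≤ max 1 ((1 / ε) ^ r) := by
      rcases max_cases 1 (1 / ε) with ⟨h, -⟩ | ⟨h, -⟩
      · rw [hX, h, one_pow]; exact le_max_left _ _
      · rw [hX, h]; exact le_max_right _ _
    calc (p.calls M I : ℝ) ≤ (M + c * w) * K ^ r := h4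
      _ ≤ (M + c * w) * ((E + 1) * X) ^ r := by gcongr
      _ = (M + c * w) * (E + 1) ^ r * X ^ r := by rw [mul_pow]; ring
      _ ≤ (M + c * w) * (E + 1) ^ r * max 1 ((1 / ε) ^ r) := by gcongr
      _ ≤ ((M + c * w) * (E + 1) ^ r + 1) * max 1 ((1 / ε) ^ r) := by
        gcongr
        linarith
  have hgap : ∀ n ≤ p.K, (∀ k < n, P.IsStrongSaddle a p.α p.ν (R.x k) (R.μ k) (R.lam (k + 1))
      ((R.inner k).xout p.T) ((R.inner k).μout p.T) ((R.inner k).zout p.T)) →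
      ∀ l' : Fin M → ℝ, (∀ m, 0 ≤ l' m) → (∀ m, l' m ≤ l m + 1) →
      ∑ k ∈ Finset.range n, ((P.f0 (R.x (k + 1))).toReal - (P.f0 xs).toReal
        + ∑ m, l' m * P.penSup m (R.x (k + 1)) (R.μ (k + 1) m))
      + ∑ m, (l' m - R.lam n m) ^ 2 / (4 * β) ≤ E := by
    intro n hn hsad l' hl' hll'
    have h1 := hR.sum_gap_le hP hB hx0 hμ0 hρ hL₂ hlip (by rw [hpα, hpβ]; exact hβstep) hpν hpθ
      hn hsad hxs.1.1 hμs hl'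
    rw [hpα, hpβ] at h1
    have h2 : gapBound ρ 1 β l' ≤ E := gapBound_mono hβ hl' hll'
    have h3 : ∑ k ∈ Finset.range n, ∑ m, R.lam (k + 1) m * P.penSup m xs (μs m) ≤ 0 :=
      Finset.sum_nonpos fun k hk => Finset.sum_nonpos fun m _ =>
        mul_nonpos_of_nonneg_of_nonpos
          (hR.lam_nonneg (by have := Finset.mem_range.1 hk; omega) m) (hpen m)
    rw [Finset.sum_sub_distrib] at h1
    linarith
  have hlam : ∀ n < p.K, (∀ k < n, P.IsStrongSaddle a p.α p.ν (R.x k) (R.μ k) (R.lam (k + 1))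
      ((R.inner k).xout p.T) ((R.inner k).μout p.T) ((R.inner k).zout p.T)) →
      ∀ m, 0 ≤ R.lam (n + 1) m ∧ R.lam (n + 1) m ≤ Λ := by
    intro n hn hsad m
    refine ⟨hR.lam_nonneg (by omega) m, ?_⟩
    have h1 := hgap n hn.le hsad l hl fun m => by linarith
    -- At l' = l every gap is non-negative by the saddle inequality, so the squared distance of the
    -- multipliers alone is at most E.
    have h2 : 0 ≤ ∑ k ∈ Finset.range n, ((P.f0 (R.x (k + 1))).toReal - (P.f0 xs).toReal
        + ∑ m, l m * P.penSup m (R.x (k + 1)) (R.μ (k + 1) m)) :=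
      Finset.sum_nonneg fun k hk => by
        have hk' : k + 1 ≤ p.K := by have := Finset.mem_range.1 hk; omega
        linarith [hsaddle _ (hR.x_mem hP hx0 hk') _ fun m => hR.μ_mem hμ0 hk' m]
    have h3 : (l m - R.lam n m) ^ 2 / (4 * β) ≤ ∑ m, (l m - R.lam n m) ^ 2 / (4 * β) :=
      Finset.single_le_sum (f := fun m => (l m - R.lam n m) ^ 2 / (4 * β))
        (fun m _ => by positivity) (Finset.mem_univ m)
    have h4 : (l m - R.lam n m) ^ 2 ≤ 4 * β * E := by
      have h5 : (l m - R.lam n m) ^ 2 / (4 * β) ≤ E := by linarith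
      rw [div_le_iff₀ (by positivity)] at h5
      linarith
    have h5 : R.lam n m ≤ l m + (4 * β * E + 1) := by nlinarith [sq_nonneg (l m - R.lam n m + 1)]
    have h6 : l m ≤ ∑ m, l m :=
      Finset.single_le_sum (f := l) (fun m _ => hl m) (Finset.mem_univ m)
    have hθ1 : p.θ ≤ 1 := by
      rw [hpθ, hpK]; exact (div_le_one (by linarith)).2 hK1'
    have hval : ∀ k < p.K, |P.gpen m (R.x k) (R.μ k m) (R.z k m)| ≤ B + 1 := by
      intro k hk
      have h7 := hR.gpen_mem_Icc hP hB hx0 hμ0 hk m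
      have h8 := abs_le.1 (hBle m _ (hR.x_mem hP hx0 hk.le) _ (hR.μ_mem hμ0 hk.le m))
      rw [abs_le]
      constructor <;> linarith [h7.1, h7.2, h8.1, h8.2]
    have h7 := abs_le.1 (hval n hn)
    have h8 := abs_le.1 (hval (n - 1) (by omega))
    rw [hR.lam_step n hn m, hpβ]
    refine max_le ?_ hΛ
    have h9 : β * (2 * P.gpen m (R.x n) (R.μ n m) (R.z n m)
        - P.gpen m (R.x (n - 1)) (R.μ (n - 1) m) (R.z (n - 1) m)) ≤ β * (3 * (B + 1)) :=
      mul_le_mul_of_nonneg_left (by linarith [h7.2, h8.1]) hβ.le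
    rw [hΛdef]
    linarith
  -- Earlier saddle properties bound λ^{k+1} by Λ, which validates the inner step sizes for the k-th
  -- call.
  have hsad : ∀ k < p.K, P.IsStrongSaddle a p.α p.ν (R.x k) (R.μ k) (R.lam (k + 1))
      ((R.inner k).xout p.T) ((R.inner k).μout p.T) ((R.inner k).zout p.T) := by
    intro k
    induction k using Nat.strong_induction_on with
    | _ k ih =>
      intro hk
      have h1 := hlam k hk fun j hj => ih j hj (hj.trans hk)
      have h2 := hinner K (K ^ (r - 2)) hK1 hs1 (hrA.imp_left fun h => by
        exact Nat.le_self_pow (by omega) K) p hpT hpγ hpδ (R.inner k) _ _ _ h1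
        (hR.inner_run k hk)
      rw [hpν, hpK]
      exact h2
  refine ⟨hsad, ?_⟩
  set μo : (m : Fin M) → Vec (I m) := fun m => (1 / (p.K : ℝ)) • ∑ k ∈ Finset.Icc 1 p.K, R.μ k m
    with hμo
  have hxo : R.output p.K ∈ P.X :=
    hP.X_convex.average_Icc_mem p.one_le_K fun k hk => hR.x_mem hP hx0 (Finset.mem_Icc.1 hk).2
  have hμo_mem : ∀ m, μo m ∈ box (I m) (a m) := fun m =>
    (convex_box _ _).average_Icc_mem p.one_le_K fun k hk => hR.μ_mem hμ0 (Finset.mem_Icc.1 hk).2 m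
  have hfinal : ∀ l' : Fin M → ℝ, (∀ m, 0 ≤ l' m) → (∀ m, l' m ≤ l m + 1) →
      (P.f0 (R.output p.K)).toReal + ∑ m, l' m * P.penSup m (R.output p.K) (μo m)
        ≤ (P.f0 xs).toReal + ε := by
    intro l' hl' hll'
    have h1 := hgap p.K le_rfl hsad l' hl' hll'
    have h2 : 0 ≤ ∑ m, (l' m - R.lam p.K m) ^ 2 / (4 * β) := by positivity
    rw [Finset.sum_add_distrib, Finset.sum_sub_distrib, Finset.sum_const, Finset.card_range,
      nsmul_eq_mul, ← sum_Icc_one_eq_sum_range (fun k => (P.f0 (R.x k)).toReal),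
      ← sum_Icc_one_eq_sum_range (fun k => ∑ m, l' m * P.penSup m (R.x k) (R.μ k m)),
      Finset.sum_comm] at h1
    have h3 : (P.f0 (R.output p.K)).toReal
        ≤ 1 / (p.K : ℝ) * ∑ k ∈ Finset.Icc 1 p.K, (P.f0 (R.x k)).toReal :=
      (hP.f0_convex.convexOn hP.X_convex hP.f0_finite).map_average_Icc_le p.one_le_K
        fun k hk => hR.x_mem hP hx0 (Finset.mem_Icc.1 hk).2
    have h4 : ∑ m, l' m * P.penSup m (R.output p.K) (μo m)
        ≤ 1 / (p.K : ℝ) * ∑ m, ∑ k ∈ Finset.Icc 1 p.K, l' m * P.penSup m (R.x k) (R.μ k m) := by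
      rw [Finset.mul_sum]
      refine Finset.sum_le_sum fun m _ => ?_
      have h5 := (hP.convexOn_penSup hB m (a m)).map_average_Icc_le p.one_le_K
        (u := fun k => (R.x k, R.μ k m)) fun k hk => ⟨hR.x_mem hP hx0 (Finset.mem_Icc.1 hk).2,
          hR.μ_mem hμ0 (Finset.mem_Icc.1 hk).2 m⟩
      have e : (1 / (p.K : ℝ)) • ∑ k ∈ Finset.Icc 1 p.K, (R.x k, R.μ k m)
          = (R.output p.K, μo m) := by
        ext i
        · simp [Trace.output, Prod.fst_sum]
        · simp [hμo, Prod.snd_sum]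
      rw [e] at h5
      have h6 := mul_le_mul_of_nonneg_left h5 (hl' m)
      rw [← Finset.mul_sum]
      simp only at h6
      linarith
    have hK0 : (0 : ℝ) < p.K := by rw [hpK]; linarith
    have h5 := mul_le_mul_of_nonneg_left (le_trans (le_add_of_nonneg_right h2) h1)
      (show 0 ≤ 1 / (p.K : ℝ) by positivity)
    have e1 : 1 / (p.K : ℝ) * E = E / K := by rw [hpK]; ring
    have e2 : 1 / (p.K : ℝ) * (p.K * (P.f0 xs).toReal) = (P.f0 xs).toReal := by field_simp
    rw [e1] at h5
    rw [mul_add, mul_sub, e2] at h5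
    linarith
  refine ⟨hxo, fun xs' hxs' => ?_, fun m => max_le ?_ (by exact_mod_cast hε.le)⟩
  · have h1 := hfinal 0 (fun _ => le_rfl) fun m => by
      simp only [Pi.zero_apply]; linarith [hl m]
    simp only [Pi.zero_apply, zero_mul, Finset.sum_const_zero, add_zero] at h1
    refine le_trans ?_ (add_le_add_left (hxs.2 xs' hxs'.1) (ε : EReal))
    rw [← (hP.f0_finite _ hxo).coe_toReal, ← (hP.f0_finite _ hxs.1.1).coe_toReal]
    exact_mod_cast h1
  · refine (hP.worst_le_penSup hB hxo fun i => (hμo_mem m i).1).trans ?_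
    -- Raising the m-th multiplier by 1 and subtracting the saddle inequality for l isolates the
    -- m-th penalized constraint.
    have h1 := hfinal (fun j => l j + if j = m then 1 else 0)
      (fun j => by have := hl j; split_ifs <;> linarith)
      (fun j => by have := hl j; split_ifs <;> linarith)
    have h2 := hsaddle _ hxo μo hμo_mem
    simp only [add_mul, Finset.sum_add_distrib, ite_mul, one_mul, zero_mul,
      Finset.sum_ite_eq', Finset.mem_univ, if_true] at h1
    exact_mod_cast (by linarith : P.penSup m (R.output p.K) (μo m) ≤ ε)

end RobustOpt

theorem mainTheorem6 {M N : ℕ} {J I : Fin M → ℕ} (P : RobustOpt.Problem M N J I)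
    (hP : P.Regular)
    (zbar : (m : Fin M) → RobustOpt.Vec (J m)) (hzbar : P.IsSlaterFamily zbar)
    (G : Fin M → ℝ) (hG : P.IsLowerBound zbar G) :
    (P.BoundedSubgradients → RobustOpt.HasOracleComplexity P (P.multBound zbar G) 3) ∧
    (P.LipschitzGradients → RobustOpt.HasOracleComplexity P (P.multBound zbar G) 2) := by
  constructor
  · intro h
    obtain ⟨A, D, hB⟩ := h.exists_bounds
    exact hB.hasOracleComplexity hP hzbar hG (by norm_num) (Or.inl le_rfl)
  · intro h
    obtain ⟨L, D, hB⟩ := h.exists_bounds hP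
    exact hB.hasOracleComplexity hP hzbar hG le_rfl (Or.inr rfl)
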